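/- Let $P=(P_1,\dots,P_n)$ with $P_i\in\mathbb C[x_1,\dots,x_n]$, and consider the polynomial system $\dot x=P(x)$ on $\mathbb C^n$. Let $(\mathbb C(x),\partial_1,\dots,\partial_n)$ be the differential field of rational functions with its partial derivatives, and call an element of a differential field extension $M$ of it (commuting derivations extending the $\partial_i$, again denoted $\partial_i$) *Liouvillian* if it lies in an intermediate field $L$ that is the top of a finite tower of differential fields $\mathbb C(x)=K_0\subset K_1\subset\dots\subset K_r=L$ in which, for every $k$, either $K_{k+1}/K_k$ is a finite algebraic extension, or $K_{k+1}=K_k(t)$ with $t$ transcendental over $K_k$ and $\partial_i t/t\in K_k$ for all $i$, or $K_{k+1}=K_k(t)$ with $t$ transcendental over $K_k$ and $\partial_i t\in K_k$ for all $i$. **Theorem.** Suppose that the system is Liouvillian integrable, i.e. in some differential field extension $M$ of $\mathbb C(x)$ (for instance a field of meromorphic functions on a connected domain) there are $n-1$ Liouvillian elements $H_1,\dots,H_{n-1}$ that are first integrals, $\sum_{i=1}^n P_i\,\partial_iH_j=0$, and functionally independent, i.e. the gradients $(\partial_1H_j,\dots,\partial_nH_j)$, $1\le j\le n-1$, are linearly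 independent over $M$. Then the system has a Darboux Jacobian multiplier: there are relatively prime polynomials $g,h\in\mathbb C[x]$ with $h\neq0$, finitely many irreducible, pairwise non-associated polynomials $f_1,\dots,f_r\in\mathbb C[x]$ and exponents $l_1,\dots,l_r\in\mathbb C$ such that, on some open set $U\subset\mathbb C^n$ whose complement has Lebesgue measure zero, on which $h$ and the $f_i$ do not vanish and the $\log f_i$ have continuous branches, the function $$J=\exp\Big(\frac gh\Big)\,f_1^{l_1}\cdots f_r^{l_r},\qquad f_i^{l_i}=\exp(l_i\log f_i),$$ is smooth and satisfies $$\partial_1(JP_1)+\dots+\partial_n(JP_n)=0 .$$ -/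

import Mathlib

/-!
# Liouvillian integrability and Darboux Jacobian multipliers

A polynomial system `ẋ = P(x)` on `ℂⁿ` is given by `P : Fin n → MvPolynomial (Fin n) ℂ`.
-/

universe u

namespace LiouvilleDarboux

open MeasureTheory

open scoped ContDiff IntermediateField

/-- The field `ℂ(x)` of rational functions in `x = (x₁, …, xₙ)`. -/
abbrev RatField (n : ℕ) : Type := FractionRing (MvPolynomial (Fin n) ℂ)

/-- The structure of a differential field extension of `(ℂ(x), ∂₁, …, ∂ₙ)` on a field extension `M`
of `ℂ(x)`: commuting derivations `δ₁, …, δₙ` of `M`, that is, additive maps with the Leibniz rule, which extend the partial derivatives. (A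
derivation of `ℂ(x)` is determined by its values on polynomials, through the quotient rule; it
vanishes on `ℂ` because the partial derivatives do.) -/
structure DiffExtension (n : ℕ) (M : Type*) [Field M] [Algebra (RatField n) M] where
  /-- The derivations `δᵢ`. -/
  δ : Fin n → M →+ M
  leibniz : ∀ (i : Fin n) (a b : M), δ i (a * b) = a * δ i b + b * δ i a
  commute : ∀ (i j : Fin n) (a : M), δ i (δ j a) = δ j (δ i a)
  extend : ∀ (i : Fin n) (p : MvPolynomial (Fin n) ℂ),
    δ i (algebraMap (RatField n) M (algebraMap _ (RatField n) p)) =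
      algebraMap (RatField n) M (algebraMap _ (RatField n) (MvPolynomial.pderiv i p))

section Extension

variable {n : ℕ} {M : Type*} [Field M] [Algebra (RatField n) M]

/-- One step `E ⊆ F` of a Liouvillian tower: `F` is a finite extension of `E`, or `F = E(t)` with
`t` transcendental over `E` and either all `δᵢ t / t ∈ E`, or all `δᵢ t ∈ E`. -/
def IsLiouvillianStep (𝒟 : DiffExtension n M) (E F : IntermediateField (RatField n) M) : Prop :=
  ∃ h : E ≤ F,
    FiniteDimensional E (IntermediateField.extendScalars h) ∨
    (∃ t : M, Transcendental E t ∧ IntermediateField.extendScalars h = E⟮t⟯ ∧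
      ∀ i, 𝒟.δ i t / t ∈ E) ∨
    (∃ t : M, Transcendental E t ∧ IntermediateField.extendScalars h = E⟮t⟯ ∧
      ∀ i, 𝒟.δ i t ∈ E)

/-- An intermediate field `L` of `M / ℂ(x)` is a Liouvillian extension of `ℂ(x)` if there is a tower
`ℂ(x) = K₀ ⊆ K₁ ⊆ … ⊆ K_r = L` of differential fields with Liouvillian steps. -/
def IsLiouvillianExtension (𝒟 : DiffExtension n M) (L : IntermediateField (RatField n) M) : Prop :=
  ∃ (r : ℕ) (K : ℕ → IntermediateField (RatField n) M),
    K 0 = ⊥ ∧ K r = L ∧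
    (∀ k ≤ r, ∀ i, ∀ a ∈ K k, 𝒟.δ i a ∈ K k) ∧
    ∀ k < r, IsLiouvillianStep 𝒟 (K k) (K (k + 1))

/-- `a` is Liouvillian if it lies in a Liouvillian extension of `ℂ(x)`. -/
def IsLiouvillian (𝒟 : DiffExtension n M) (a : M) : Prop :=
  ∃ L : IntermediateField (RatField n) M, IsLiouvillianExtension 𝒟 L ∧ a ∈ L

/-- `H` is a first integral of `ẋ = P(x)`: `P₁ ∂₁H + … + Pₙ ∂ₙH = 0`. -/
def IsFirstIntegral (𝒟 : DiffExtension n M) (P : Fin n → MvPolynomial (Fin n) ℂ) (H : M) : Prop :=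
  ∑ i, algebraMap (RatField n) M (algebraMap _ (RatField n) (P i)) * 𝒟.δ i H = 0

/-- Functional independence: the gradients are linearly independent. -/
def FunctionallyIndependent (𝒟 : DiffExtension n M) {m : ℕ} (H : Fin m → M) : Prop :=
  LinearIndependent M (fun j : Fin m => fun i : Fin n => 𝒟.δ i (H j))

end Extension

/-- `ẋ = P(x)` is Liouvillian integrable: in some differential field extension of `ℂ(x)` there are
`n - 1` functionally independent Liouvillian first integrals. -/
def IsLiouvillianIntegrable {n : ℕ} (P : Fin n → MvPolynomial (Fin n) ℂ) : Prop :=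
  ∃ (M : Type u) (_ : Field M) (_ : Algebra (RatField n) M) (𝒟 : DiffExtension n M)
    (H : Fin (n - 1) → M),
    (∀ j, IsLiouvillian 𝒟 (H j) ∧ IsFirstIntegral 𝒟 P (H j)) ∧ FunctionallyIndependent 𝒟 H

/-- `J` is, on the set `U`, a (single-valued) Darboux function
`exp (g / h) * f₁ ^ l₁ * ⋯ * f_r ^ l_r`, with `g`, `h` relatively prime and the `fᵢ` irreducible and
pairwise distinct (up to constant factors); the complex power `fᵢ ^ lᵢ` is `exp (lᵢ * log fᵢ)` for
a continuous branch `ℓᵢ` on `U` of the logarithm of `fᵢ`. -/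
def IsDarbouxFunctionOn {n : ℕ} (J : (Fin n → ℂ) → ℂ) (U : Set (Fin n → ℂ)) : Prop :=
  ∃ (r : ℕ) (g h : MvPolynomial (Fin n) ℂ) (f : Fin r → MvPolynomial (Fin n) ℂ) (l : Fin r → ℂ)
    (ℓ : Fin r → (Fin n → ℂ) → ℂ),
    h ≠ 0 ∧ IsRelPrime g h ∧ (∀ i, Irreducible (f i)) ∧
    (∀ i j, i ≠ j → ¬ Associated (f i) (f j)) ∧
    (∀ x ∈ U, MvPolynomial.eval x h ≠ 0) ∧
    (∀ i, ContinuousOn (ℓ i) U ∧ ∀ x ∈ U, Complex.exp (ℓ i x) = MvPolynomial.eval x (f i)) ∧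
    ∀ x ∈ U, J x = Complex.exp (MvPolynomial.eval x g / MvPolynomial.eval x h) *
      ∏ i, Complex.exp (l i * ℓ i x)

/-- `J` is, on the open set `U`, a Jacobian multiplier of `ẋ = P(x)`: it is smooth and
`∂₁(J P₁) + … + ∂ₙ(J Pₙ) = 0`. -/
def IsJacobianMultiplierOn {n : ℕ} (P : Fin n → MvPolynomial (Fin n) ℂ)
    (J : (Fin n → ℂ) → ℂ) (U : Set (Fin n → ℂ)) : Prop :=
  ContDiffOn ℂ ∞ J U ∧
  ∀ x ∈ U, ∑ i, fderiv ℂ (fun y => J y * MvPolynomial.eval y (P i)) x (Pi.single i 1) = 0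

/-- `ẋ = P(x)` has a Darboux Jacobian multiplier, defined on an open subset of `ℂⁿ` of full
Lebesgue measure. -/
def HasDarbouxJacobianMultiplier {n : ℕ} (P : Fin n → MvPolynomial (Fin n) ℂ) : Prop :=
  ∃ (U : Set (Fin n → ℂ)) (J : (Fin n → ℂ) → ℂ), IsOpen U ∧ volume Uᶜ = 0 ∧
    IsDarbouxFunctionOn J U ∧ IsJacobianMultiplierOn P J U

end LiouvilleDarboux

/-!
The differential of the vector `H` of `n - 1` independent first integrals has rank `n - 1` and
annihilates the vector field `P`. More generally, call a flat connection together with a vector `H`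
a triangular system if the connection is triangular and the covariant derivative of `H` has these
two properties. Such systems descend along a Liouvillian tower. At a step `K(t)`, embed the
algebraic closure of `K(t)` into Puiseux series in `t` (exponential case) or `1/t` (primitive case);
splitting the connection and twisting it by closed forms that annihilate `P` makes it regular at
the place, and the coefficients of a truncation of `H` form a system over `K`. Over the algebraic
closure of `ℂ(x)`, the trace of the connection corrected by the logarithmic differential of a
maximal minor of the covariant derivative is a closed form `α` with `∑ Pᵢ αᵢ = -div P`. Its average
over the conjugates is a rational closed form with the same property, and a closed rational form is
`d(g / h) + ∑ lᵢ dfᵢ / fᵢ`. Then `exp (g / h) * ∏ fᵢ ^ lᵢ` is a Jacobian multiplier wherever `h` and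
the `fᵢ` do not vanish; rotating the arguments of the logarithms moves the branch cuts to a null
set.
-/

namespace LiouvilleDarboux

section Derivations

/-- The derivations of a field, which are not required to vanish on any subfield of constants. -/
abbrev Der (K : Type*) [Field K] : Type _ := Derivation ℤ K K

/-- The derivation with a given underlying additive map. -/
def Der.ofAddMonoidHom {K : Type*} [Field K] (f : K →+ K)
    (h : ∀ a b, f (a * b) = a * f b + b * f a) : Der K :=
  Derivation.mk' f.toIntLinearMap h

theorem Der.ofAddMonoidHom_apply {K : Type*} [Field K] (f : K →+ K)
    (h : ∀ a b, f (a * b) = a * f b + b * f a) (x : K) : Der.ofAddMonoidHom f h x = f x := rfl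

theorem Der.map_mul {K : Type*} [Field K] (D : Der K) (a b : K) :
    D (a * b) = a * D b + b * D a := D.leibniz a b

theorem Der.map_inv {K : Type*} [Field K] (D : Der K) (a : K) : D a⁻¹ = -a⁻¹ ^ 2 * D a :=
  D.leibniz_inv a

/-- The restriction of a derivation to a stable subfield. -/
def Der.restrict {Ω : Type*} [Field Ω] (D : Der Ω) (S : Subfield Ω) (h : ∀ x ∈ S, D x ∈ S) :
    Der S :=
  Der.ofAddMonoidHom
    { toFun := fun x => ⟨D x, h x x.2⟩
      map_zero' := Subtype.ext (map_zero D)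
      map_add' := fun x y => Subtype.ext (map_add D (x : Ω) (y : Ω)) }
    (fun x y => Subtype.ext (D.map_mul (x : Ω) (y : Ω)))

theorem Der.coe_restrict {Ω : Type*} [Field Ω] (D : Der Ω) (S : Subfield Ω)
    (h : ∀ x ∈ S, D x ∈ S) (x : S) : (D.restrict S h x : Ω) = D x := rfl

theorem map_derivation_of_isAlgebraic {A T E : Type*} [Field A] [Field T] [Field E] [Algebra A T]
    [CharZero A] (ψ : T →+* E) (d : Der T) (d' : Der E)
    (h : ∀ a : A, d' (ψ (algebraMap A T a)) = ψ (d (algebraMap A T a)))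
    {x : T} (hx : IsAlgebraic A x) : d' (ψ x) = ψ (d x) := by
  let _ : Algebra T E := ψ.toAlgebra
  let _ : Algebra A E := (ψ.comp (algebraMap A T)).toAlgebra
  have _ : IsScalarTower A T E := IsScalarTower.of_algebraMap_eq fun _ => rfl
  have hψ : ∀ y, algebraMap T E y = ψ y := fun _ => rfl
  -- the defect of compatibility is an `A`-linear derivation, and such derivations kill `x`
  let δ : Derivation A T E := Derivation.mk'
    { toFun := fun y => d' (ψ y) - ψ (d y)
      map_add' := fun y z => by simp only [map_add]; ring
      map_smul' := fun a y => by
        simp only [Algebra.smul_def, _root_.map_mul, Der.map_mul, map_add, h, RingHom.id_apply,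
          IsScalarTower.algebraMap_apply A T E, hψ]
        ring }
    (fun y z => by
      simp only [LinearMap.coe_mk, AddHom.coe_mk, Algebra.smul_def, _root_.map_mul, Der.map_mul,
        map_add, hψ]
      ring)
  have hx' : IsIntegral A x := hx.isIntegral
  have hδ : δ (Polynomial.aeval x (minpoly A x)) = 0 := by rw [minpoly.aeval, map_zero]
  rw [Derivation.map_aeval, smul_eq_zero] at hδ
  have hsep : Polynomial.aeval x (Polynomial.derivative (minpoly A x)) ≠ 0 :=
    (minpoly.irreducible hx').separable.aeval_derivative_ne_zero (minpoly.aeval A x)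
  exact sub_eq_zero.mp (hδ.resolve_left hsep)

theorem exists_derivation_extension (M Ω : Type*) [Field M] [Field Ω] [Algebra M Ω] [CharZero M]
    [Algebra.IsAlgebraic M Ω] (d : Der M) :
    ∃ d' : Der Ω, ∀ a, d' (algebraMap M Ω a) = algebraMap M Ω (d a) := by
  have _ : Algebra.FormallyEtale M Ω := Algebra.FormallyEtale.of_isSeparable M Ω
  let δ : Derivation ℤ M Ω := (Algebra.linearMap M Ω).compDer d
  let L : KaehlerDifferential ℤ Ω →ₗ[Ω] Ω :=
    (KaehlerDifferential.isBaseChange_of_formallyEtale ℤ M Ω).lift δ.liftKaehlerDifferential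
  refine ⟨L.compDer (KaehlerDifferential.D ℤ Ω), fun a => ?_⟩
  have hL := (KaehlerDifferential.isBaseChange_of_formallyEtale ℤ M Ω).lift_eq
    δ.liftKaehlerDifferential (KaehlerDifferential.D ℤ M a)
  rwa [KaehlerDifferential.map_D, Derivation.liftKaehlerDifferential_comp_D] at hL

theorem derivation_mem_of_isAlgebraic {Ω : Type*} [Field Ω] [CharZero Ω] {S T : Subfield Ω}
    (D : Der Ω) (hS : ∀ x ∈ S, D x ∈ S) (hST : S ≤ T) {x : Ω} (hxT : x ∈ T)
    (hx : IsAlgebraic S x) : D x ∈ T := by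
  let _ : Differential S := ⟨D.restrict S hS⟩
  let _ : Differential Ω := ⟨D⟩
  have _ : DifferentialAlgebra S Ω := ⟨fun _ => rfl⟩
  have hx' : IsIntegral S x := hx.isIntegral
  have hsep : Polynomial.aeval x (Polynomial.derivative (minpoly S x)) ≠ 0 :=
    (minpoly.irreducible hx').separable.aeval_derivative_ne_zero (minpoly.aeval S x)
  have hD : D (Polynomial.aeval x (minpoly S x)) =
      Polynomial.aeval x (Differential.mapCoeffs (minpoly S x)) +
        Polynomial.aeval x (Polynomial.derivative (minpoly S x)) * D x :=
    Differential.deriv_aeval_eq x (minpoly S x)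
  have hT : ∀ p : Polynomial S, Polynomial.aeval x p ∈ T := fun p => by
    rw [Polynomial.aeval_eq_sum_range]
    exact sum_mem fun i _ => mul_mem (hST (p.coeff i).2) (pow_mem hxT i)
  have hDx : D x = -Polynomial.aeval x (Differential.mapCoeffs (minpoly S x)) /
      Polynomial.aeval x (Polynomial.derivative (minpoly S x)) := by
    rw [minpoly.aeval, map_zero] at hD
    rw [eq_div_iff hsep]
    linear_combination -hD
  rw [hDx]
  exact div_mem (neg_mem (hT _)) (hT _)

end Derivations

section AlgClosure

variable {Ω : Type*} [Field Ω]

/-- The algebraic closure of a subfield `S` in the ambient field, as a subfield of that field rather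
than as an extension of `S`. -/
noncomputable def algClosure (S : Subfield Ω) : Subfield Ω :=
  (algebraicClosure S Ω).toSubfield

variable {S T : Subfield Ω}

theorem mem_algClosure {x : Ω} : x ∈ algClosure S ↔ IsAlgebraic S x := by
  rw [algClosure, IntermediateField.mem_toSubfield, mem_algebraicClosure_iff]

theorem le_algClosure (S : Subfield Ω) : S ≤ algClosure S := fun x hx =>
  mem_algClosure.2 (isAlgebraic_algebraMap (⟨x, hx⟩ : S))

theorem isAlgebraic_of_subfield_le (h : S ≤ T) {x : Ω} (hx : IsAlgebraic S x) :
    IsAlgebraic T x := by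
  let _ : Algebra S T := (Subfield.inclusion h).toAlgebra
  have _ : IsScalarTower S T Ω := IsScalarTower.of_algebraMap_eq fun _ => rfl
  exact hx.tower_top (L := T)

theorem algClosure_mono (h : S ≤ T) : algClosure S ≤ algClosure T := fun _ hx =>
  mem_algClosure.2 (isAlgebraic_of_subfield_le h (mem_algClosure.1 hx))

theorem mem_algClosure_of_isAlgebraic {x : Ω} (hx : IsAlgebraic (algClosure S) x) :
    x ∈ algClosure S := by
  have h : x ∈ algebraicClosure (algebraicClosure S Ω) Ω := mem_algebraicClosure_iff.2 hx
  rw [algebraicClosure.algebraicClosure_eq_bot, IntermediateField.mem_bot] at h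
  obtain ⟨y, rfl⟩ := h
  exact y.2

theorem isAlgClosed_of_forall_mem [IsAlgClosed Ω] (hS : ∀ x : Ω, IsAlgebraic S x → x ∈ S) :
    IsAlgClosed S := by
  refine IsAlgClosed.of_exists_root _ fun p _ hirr => ?_
  obtain ⟨x, hx⟩ := IsAlgClosed.exists_aeval_eq_zero Ω p
    (Polynomial.degree_pos_of_irreducible hirr).ne'
  have hxS : x ∈ S := hS x ⟨p, hirr.ne_zero, hx⟩
  refine ⟨⟨x, hxS⟩, (algebraMap S Ω).injective ?_⟩
  rw [map_zero, ← hx]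
  exact (Polynomial.aeval_algebraMap_apply Ω (⟨x, hxS⟩ : S) p).symm

/-- A subfield is stable under a family of derivations. -/
def IsStable {σ : Type*} (d : σ → Der Ω) (S : Subfield Ω) : Prop :=
  ∀ i, ∀ x ∈ S, d i x ∈ S

theorem IsStable.algClosure [CharZero Ω] {σ : Type*} {d : σ → Der Ω} (hS : IsStable d S) :
    IsStable d (algClosure S) :=
  fun i _ hx => derivation_mem_of_isAlgebraic (d i) (hS i) (le_algClosure S) hx
    (mem_algClosure.1 hx)

end AlgClosure

section Adjoin

open scoped IntermediateField

variable {K Ω E : Type*} [Field K] [Field Ω] [Field E] [Algebra K Ω] {t : Ω}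

theorem derivation_mem_adjoin (D : Der Ω) (hK : ∀ a : K, D (algebraMap K Ω a) ∈ K⟮t⟯)
    (ht : D t ∈ K⟮t⟯) {x : Ω} (hx : x ∈ K⟮t⟯) : D x ∈ K⟮t⟯ := by
  induction hx using IntermediateField.adjoin_induction with
  | mem x hx => rwa [Set.mem_singleton_iff.1 hx]
  | algebraMap a => exact hK a
  | add x y _ _ h1 h2 => exact map_add D x y ▸ add_mem h1 h2
  | inv x hx h1 => exact D.map_inv x ▸ mul_mem (neg_mem (pow_mem (inv_mem hx) 2)) h1
  | mul x y hx hy h1 h2 => exact D.map_mul x y ▸ add_mem (mul_mem hx h2) (mul_mem hy h1)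

theorem map_derivation_of_mem_adjoin (D : Der Ω) (D' : Der E) (ψ : K⟮t⟯ →+* E)
    (hst : ∀ x ∈ K⟮t⟯, D x ∈ K⟮t⟯)
    (hK : ∀ a : K, D' (ψ (algebraMap K K⟮t⟯ a)) =
      ψ ⟨D (algebraMap K Ω a), hst _ (K⟮t⟯.algebraMap_mem a)⟩)
    (ht : D' (ψ (IntermediateField.AdjoinSimple.gen K t)) =
      ψ ⟨D t, hst _ (IntermediateField.mem_adjoin_simple_self K t)⟩)
    (x : K⟮t⟯) : D' (ψ x) = ψ ⟨D x, hst x x.2⟩ := by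
  let R : Der K⟮t⟯ := D.restrict K⟮t⟯.toSubfield hst
  change D' (ψ x) = ψ (R x)
  obtain ⟨x, hx⟩ := x
  induction hx using IntermediateField.adjoin_induction with
  | mem x hx =>
    obtain rfl : x = t := hx
    exact ht
  | algebraMap a => exact hK a
  | add x y hx hy h1 h2 =>
    have hxy : (⟨x + y, add_mem hx hy⟩ : K⟮t⟯) = ⟨x, hx⟩ + ⟨y, hy⟩ := rfl
    rw [hxy, map_add, map_add, map_add, h1, h2, map_add]
  | inv x hx h1 =>
    have hx' : (⟨x⁻¹, inv_mem hx⟩ : K⟮t⟯) = (⟨x, hx⟩ : K⟮t⟯)⁻¹ := rfl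
    rw [hx', map_inv₀, Der.map_inv, Der.map_inv, h1, _root_.map_mul, map_neg, map_pow, map_inv₀]
  | mul x y hx hy h1 h2 =>
    have hxy : (⟨x * y, mul_mem hx hy⟩ : K⟮t⟯) = ⟨x, hx⟩ * ⟨y, hy⟩ := rfl
    rw [hxy, _root_.map_mul, Der.map_mul, Der.map_mul, h1, h2, map_add, _root_.map_mul,
      _root_.map_mul]

end Adjoin

section Laurent

open HahnSeries

open scoped LaurentSeries

variable {F : Type*} [Field F]

/-- The operator `∑ aₖ sᵏ ↦ ∑ (d aₖ + k c aₖ) sᵏ`, which is the derivation of the field of Laurent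
series that extends `d` and maps `s` to `c s`. -/
noncomputable def coeffDeriv (d : Der F) (c : F) : F⸨X⸩ →+ F⸨X⸩ where
  toFun := fun x =>
    { coeff := fun k => d (x.coeff k) + k * c * x.coeff k
      isPWO_support' := x.isPWO_support.mono fun k hk hx => hk (by
        change d _ + _ = 0
        rw [hx, map_zero, mul_zero, add_zero]) }
  map_zero' := by
    ext k
    simp only [coeff_zero, map_zero, mul_zero, add_zero]
  map_add' := fun x y => by
    ext k
    simp only [coeff_add, map_add]
    ring

theorem coeff_coeffDeriv (d : Der F) (c : F) (x : F⸨X⸩) (k : ℤ) :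
    (coeffDeriv d c x).coeff k = d (x.coeff k) + k * c * x.coeff k := rfl

theorem support_coeffDeriv_subset (d : Der F) (c : F) (x : F⸨X⸩) :
    (coeffDeriv d c x).support ⊆ x.support := fun k hk hx => hk (by
  rw [coeff_coeffDeriv, hx, map_zero, mul_zero, add_zero])

theorem coeffDeriv_mul (d : Der F) (c : F) (x y : F⸨X⸩) :
    coeffDeriv d c (x * y) = x * coeffDeriv d c y + y * coeffDeriv d c x := by
  ext k
  rw [coeff_add, coeff_mul_right' y.isPWO_support (support_coeffDeriv_subset d c y), mul_comm y,
    coeff_mul_left' x.isPWO_support (support_coeffDeriv_subset d c x)]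
  simp only [coeff_coeffDeriv, coeff_mul, map_sum, Finset.mul_sum, ← Finset.sum_add_distrib]
  refine Finset.sum_congr rfl fun ij hij => ?_
  rw [Finset.mem_antidiagonal] at hij
  rw [← hij.2.2, Der.map_mul]
  push_cast
  ring

/-- The derivation `∑ aₖ sᵏ ↦ ∑ (d aₖ) sᵏ + k γ aₖ s ^ (k + e)` of the field of Laurent series,
which extends `d` and maps `s` to `γ s ^ (e + 1)`. -/
noncomputable def laurentDeriv (d : Der F) (γ : F) (e : ℕ) : Der F⸨X⸩ :=
  Der.ofAddMonoidHom
    (coeffDeriv d 0 + (AddMonoidHom.mulLeft (single (e : ℤ) γ)).comp (coeffDeriv 0 1))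
    (fun x y => by
      simp only [AddMonoidHom.add_apply, AddMonoidHom.comp_apply, AddMonoidHom.coe_mulLeft,
        coeffDeriv_mul]
      ring)

theorem coeff_laurentDeriv (d : Der F) (γ : F) (e : ℕ) (x : F⸨X⸩) (k : ℤ) :
    (laurentDeriv d γ e x).coeff k = d (x.coeff k) + (k - e : ℤ) * γ * x.coeff (k - e) := by
  simp only [laurentDeriv, Der.ofAddMonoidHom_apply, AddMonoidHom.add_apply,
    AddMonoidHom.comp_apply, AddMonoidHom.coe_mulLeft, coeff_add,
    coeff_coeffDeriv, coeff_single_mul, Derivation.zero_apply]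
  ring

theorem laurentDeriv_C (d : Der F) (γ : F) (e : ℕ) (a : F) :
    laurentDeriv d γ e (C a) = C (d a) := by
  ext k
  rw [coeff_laurentDeriv, C_apply, C_apply, coeff_single, coeff_single, coeff_single]
  rcases eq_or_ne (k - e) 0 with h | h
  · rw [h]; split_ifs <;> simp
  · rw [if_neg h]; split_ifs <;> simp

theorem laurentDeriv_single (d : Der F) (γ : F) (e : ℕ) (k : ℤ) :
    laurentDeriv d γ e (single k 1) = single (k + e) (k * γ) := by
  ext j
  have hd : d ((single k 1 : F⸨X⸩).coeff j) = 0 := by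
    rw [coeff_single]
    split_ifs <;> simp
  rw [coeff_laurentDeriv, hd, zero_add]
  rcases eq_or_ne j (k + e) with rfl | h
  · simp
  · rw [coeff_single_of_ne h, coeff_single_of_ne (by omega), mul_zero]

theorem laurentDeriv_comm {d₁ d₂ : Der F} {γ₁ γ₂ : F} (e : ℕ)
    (hd : ∀ a, d₁ (d₂ a) = d₂ (d₁ a)) (hγ : d₁ γ₂ = d₂ γ₁) (x : F⸨X⸩) :
    laurentDeriv d₁ γ₁ e (laurentDeriv d₂ γ₂ e x) =
      laurentDeriv d₂ γ₂ e (laurentDeriv d₁ γ₁ e x) := by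
  ext k
  simp only [coeff_laurentDeriv, map_add, Der.map_mul, Derivation.map_intCast, hd, hγ]
  ring

end Laurent

section Order

open HahnSeries

open scoped LaurentSeries

variable {F : Type*} [Field F] {k l : ℤ} {x y : F⸨X⸩}

/-- The Laurent series all of whose terms have degree at least `k`. -/
def ordGE (F : Type*) [Field F] (k : ℤ) : AddSubgroup F⸨X⸩ where
  carrier := {x | ∀ j < k, x.coeff j = 0}
  zero_mem' := fun _ _ => rfl
  add_mem' := fun hx hy j hj => by rw [coeff_add, hx j hj, hy j hj, add_zero]
  neg_mem' := fun hx j hj => by rw [coeff_neg, hx j hj, neg_zero]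

theorem ordGE_antitone : Antitone (ordGE F) := fun _ _ h _ hx j hj => hx j (hj.trans_le h)

theorem mul_mem_ordGE (hx : x ∈ ordGE F k) (hy : y ∈ ordGE F l) : x * y ∈ ordGE F (k + l) := by
  intro j hj
  rw [coeff_mul]
  refine Finset.sum_eq_zero fun ij hij => ?_
  rw [Finset.mem_antidiagonal] at hij
  rcases lt_or_ge ij.1 k with h | h
  · rw [hx _ h, zero_mul]
  · rw [hy _ (by linarith [hij.2.2]), mul_zero]

theorem laurentDeriv_mem_ordGE (d : Der F) (γ : F) (e : ℕ) (hx : x ∈ ordGE F k) :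
    laurentDeriv d γ e x ∈ ordGE F k := fun j hj => by
  rw [coeff_laurentDeriv, hx j hj, hx (j - e) (by omega), map_zero, mul_zero, add_zero]

theorem single_mem_ordGE (k : ℤ) (a : F) : single k a ∈ ordGE F k := fun j hj => by
  rw [coeff_single_of_ne hj.ne]

theorem C_mem_ordGE (a : F) : (C a : F⸨X⸩) ∈ ordGE F 0 := single_mem_ordGE 0 a

theorem mem_ordGE_order (x : F⸨X⸩) : x ∈ ordGE F x.order :=
  fun _ hj => coeff_eq_zero_of_lt_order hj

theorem exists_nonpos_forall_mem_ordGE {ι : Type*} [Finite ι] (f : ι → F⸨X⸩) :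
    ∃ k ≤ 0, ∀ i, f i ∈ ordGE F k := by
  cases nonempty_fintype ι
  refine ⟨-∑ i, |(f i).order|, neg_nonpos.2 (Finset.sum_nonneg fun i _ => abs_nonneg _), fun i =>
    ordGE_antitone ?_ (mem_ordGE_order (f i))⟩
  have hi := Finset.single_le_sum (f := fun i => |(f i).order|) (fun i _ => abs_nonneg _)
    (Finset.mem_univ i)
  linarith [neg_abs_le (f i).order]

theorem inv_mem_ordGE (hx : x ≠ 0) : x⁻¹ ∈ ordGE F (-x.order) := by
  have h : x⁻¹.order = -x.order := by
    have hmul := order_mul hx (inv_ne_zero hx)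
    rw [mul_inv_cancel₀ hx, order_one] at hmul
    linarith
  exact h ▸ mem_ordGE_order x⁻¹

theorem logDeriv_mem_ordGE (d : Der F) (γ : F) (e : ℕ) (hx : x ≠ 0) :
    laurentDeriv d γ e x / x ∈ ordGE F 0 := by
  have h := mul_mem_ordGE (laurentDeriv_mem_ordGE d γ e (mem_ordGE_order x)) (inv_mem_ordGE hx)
  rwa [add_neg_cancel, ← div_eq_mul_inv] at h

theorem ne_zero_of_notMem_ordGE (hx : x ∉ ordGE F k) : x ≠ 0 :=
  fun h => hx (h ▸ zero_mem _)

theorem order_lt_of_notMem_ordGE (hx : x ∉ ordGE F k) : x.order < k := by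
  by_contra! h
  exact hx (ordGE_antitone h (mem_ordGE_order x))

theorem eq_zero_of_forall_mem_ordGE (hx : ∀ N : ℕ, x ∈ ordGE F (k + N)) : x = 0 := by
  ext j
  exact hx (j - k + 1).toNat j (by omega)

theorem exists_forall_sub_mem_ordGE {k : ℤ} {S : ℕ → F⸨X⸩} (h0 : S 0 ∈ ordGE F k)
    (hS : ∀ N : ℕ, S (N + 1) - S N ∈ ordGE F (k + N)) :
    ∃ x, ∀ N : ℕ, x - S N ∈ ordGE F (k + N) := by
  have hle : ∀ N M : ℕ, N ≤ M → S M - S N ∈ ordGE F (k + N) := fun N M h => by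
    rw [← Finset.sum_Ico_sub S h]
    exact sum_mem fun j hj => ordGE_antitone (by simpa using (Finset.mem_Ico.1 hj).1) (hS j)
  let N : ℤ → ℕ := fun j => (j - k + 1).toNat
  refine ⟨HahnSeries.ofSuppBddBelow (fun j => (S (N j)).coeff j) ⟨k, fun j hj => ?_⟩,
    fun M j hj => ?_⟩
  · by_contra! h
    have hN : N j = 0 := by simp only [N]; omega
    exact hj (by simpa only [hN] using h0 j h)
  · have hM := hle (N j) M (by simp only [N]; omega) j (by simp only [N]; omega)
    rw [coeff_sub] at hM ⊢
    change (S (N j)).coeff j - _ = 0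
    linear_combination -hM

theorem iterate_mem_ordGE {U : F⸨X⸩ → F⸨X⸩}
    (hU : ∀ k x, x ∈ ordGE F k → U x ∈ ordGE F (k + 1)) (hx : x ∈ ordGE F k) (N : ℕ) :
    U^[N] x ∈ ordGE F (k + N) := by
  induction N with
  | zero => simpa using hx
  | succ N ih =>
    rw [Function.iterate_succ_apply', Nat.cast_succ, ← add_assoc]
    exact hU _ _ ih

-- The solution is the Neumann series `∑ U^j y`.
theorem exists_sub_eq_of_raising (U : F⸨X⸩ →+ F⸨X⸩)
    (hU : ∀ k x, x ∈ ordGE F k → U x ∈ ordGE F (k + 1)) (y : F⸨X⸩) : ∃ x, x - U x = y := by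
  let S : ℕ → F⸨X⸩ := fun N => ∑ j ∈ Finset.range N, U^[j] y
  have hS : ∀ N, S N - U (S N) = y - U^[N] y := fun N => by
    simp only [S, map_sum, ← Finset.sum_sub_distrib, ← Function.iterate_succ_apply' U]
    exact Finset.sum_range_sub' _ N
  have hy := iterate_mem_ordGE hU (mem_ordGE_order y)
  obtain ⟨x, hx⟩ := exists_forall_sub_mem_ordGE (S := S) (zero_mem _) fun N => by
    simpa only [S, Finset.sum_range_succ_sub_sum] using hy N
  refine ⟨x, sub_eq_zero.1 (eq_zero_of_forall_mem_ordGE (k := y.order) fun N => ?_)⟩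
  have hrem : x - U x - y = (x - S N) - U (x - S N) - U^[N] y := by
    rw [map_sub]
    linear_combination hS N
  rw [hrem]
  exact sub_mem (sub_mem (hx N) (ordGE_antitone (by omega) (hU _ _ (hx N)))) (hy N)

theorem eq_zero_of_eq_raising {U : F⸨X⸩ → F⸨X⸩}
    (hU : ∀ k x, x ∈ ordGE F k → U x ∈ ordGE F (k + 1)) (hx : x = U x) : x = 0 :=
  eq_zero_of_forall_mem_ordGE fun N => by
    simpa only [Function.iterate_fixed hx.symm N] using
      iterate_mem_ordGE hU (mem_ordGE_order x) N

theorem existsUnique_laurentDeriv_add_mul_eq {d : Der F} {γ : F} {e : ℕ} {η : F⸨X⸩}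
    (hη : η ∉ ordGE F 0) (φ : F⸨X⸩) : ∃! G, laurentDeriv d γ e G + η * G = φ := by
  have hη0 := ne_zero_of_notMem_ordGE hη
  let U : F⸨X⸩ →+ F⸨X⸩ :=
    -(AddMonoidHom.mulLeft η⁻¹).comp (laurentDeriv d γ e : F⸨X⸩ →+ F⸨X⸩)
  have hU_apply : ∀ x, U x = -(η⁻¹ * laurentDeriv d γ e x) := fun _ => rfl
  have hU : ∀ k x, x ∈ ordGE F k → U x ∈ ordGE F (k + 1) := fun k x hx =>
    neg_mem (ordGE_antitone (by linarith [Int.add_one_le_of_lt (order_lt_of_notMem_ordGE hη)])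
      (mul_mem_ordGE (inv_mem_ordGE hη0) (laurentDeriv_mem_ordGE d γ e hx)))
  have hiff : ∀ G ψ, laurentDeriv d γ e G + η * G = ψ ↔ G - U G = η⁻¹ * ψ := fun G ψ => by
    rw [hU_apply]
    field_simp
    constructor <;> intro h <;> linear_combination h
  obtain ⟨G, hG⟩ := exists_sub_eq_of_raising U hU (η⁻¹ * φ)
  refine ⟨G, (hiff G φ).2 hG, fun G' hG' => sub_eq_zero.1 (eq_zero_of_eq_raising hU ?_)⟩
  rw [map_sub]
  linear_combination (hiff G' φ).1 hG' - hG

theorem exists_primitive_of_irregular {σ : Type*} {d : σ → Der F} {γ : σ → F} {e : ℕ}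
    (hcomm : ∀ i j x, laurentDeriv (d i) (γ i) e (laurentDeriv (d j) (γ j) e x) =
      laurentDeriv (d j) (γ j) e (laurentDeriv (d i) (γ i) e x))
    {η φ : σ → F⸨X⸩}
    (hη : ∀ i j, laurentDeriv (d i) (γ i) e (η j) = laurentDeriv (d j) (γ j) e (η i))
    (hirr : ∃ i, η i ∉ ordGE F 0)
    (hφ : ∀ i j, laurentDeriv (d i) (γ i) e (φ j) + η i * φ j =
      laurentDeriv (d j) (γ j) e (φ i) + η j * φ i) :
    ∃ G, ∀ i, φ i = laurentDeriv (d i) (γ i) e G + η i * G := by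
  obtain ⟨i, hi⟩ := hirr
  obtain ⟨G, hG, -⟩ := existsUnique_laurentDeriv_add_mul_eq (d := d i) (γ := γ i) (e := e) hi (φ i)
  refine ⟨G, fun j => ?_⟩
  -- By flatness both sides solve the equation of direction `i`, whose solution is unique.
  refine (existsUnique_laurentDeriv_add_mul_eq hi _).unique (hφ i j) ?_
  have hDj := congrArg (laurentDeriv (d j) (γ j) e) hG
  simp only [map_add, Der.map_mul] at hDj ⊢
  linear_combination hDj + hcomm i j G + G * hη i j + η j * hG

end Order

section WeierstrassFactor

open Polynomial

variable {A : Type*} [CommRing A]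

theorem dvd_of_coe_dvd_coe {I : Ideal A} [IsAdicComplete I A] {f q : A[X]}
    (hf : f.IsDistinguishedAt I) (h : (f : PowerSeries A) ∣ q) : f ∣ q := by
  have h0 : hf.algEquivQuotient (Ideal.Quotient.mk _ q) =
      Ideal.Quotient.mk _ (q : PowerSeries A) := by
    rw [hf.algEquivQuotient_apply]
    change Ideal.Quotient.mk _ (coeToPowerSeries.algHom A q) = _
    rw [coeToPowerSeries.algHom_apply, Algebra.algebraMap_self, PowerSeries.map_id,
      id_eq]
  rwa [(Ideal.Quotient.eq_zero_iff_dvd _ _).2 h,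
    map_eq_zero_iff _ hf.algEquivQuotient.injective, Ideal.Quotient.eq_zero_iff_dvd] at h0

theorem exists_monic_dvd_of_coeff_mem [IsLocalRing A]
    [IsAdicComplete (IsLocalRing.maximalIdeal A) A] {q : A[X]} {e : ℕ}
    (h0 : ∀ i < e, q.coeff i ∈ IsLocalRing.maximalIdeal A)
    (he : q.coeff e ∉ IsLocalRing.maximalIdeal A) :
    ∃ f : A[X], f.Monic ∧ f.natDegree = e ∧ f ∣ q := by
  have hord : ((q : PowerSeries A).map (IsLocalRing.residue A)).order = e := by
    simp only [PowerSeries.order_eq_nat, PowerSeries.coeff_map, Polynomial.coeff_coe, Ne,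
      IsLocalRing.residue_eq_zero_iff]
    exact ⟨he, h0⟩
  have hne : (q : PowerSeries A).map (IsLocalRing.residue A) ≠ 0 := fun h => by
    rw [h, PowerSeries.order_zero] at hord
    exact ENat.top_ne_natCast e hord
  obtain ⟨f, g, H⟩ := PowerSeries.exists_isWeierstrassFactorization hne
  refine ⟨f, H.isDistinguishedAt.monic, ?_, ?_⟩
  · rw [H.natDegree_eq_toNat_order_map, hord, ENat.toNat_natCast]
  · exact dvd_of_coe_dvd_coe H.isDistinguishedAt ⟨g, H.eq_mul⟩

end WeierstrassFactor

section Puiseux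

open HahnSeries

open scoped LaurentSeries

section Polynomials

open Polynomial

theorem coeff_taylor_natDegree_sub_one {R : Type*} [CommRing R] {p : R[X]} (hp : p.Monic)
    (h : 0 < p.natDegree) (c : R) : (taylor c p).coeff (p.natDegree - 1) =
      p.coeff (p.natDegree - 1) + p.natDegree * c := by
  have h1 : 1 + (p.natDegree - 1) = p.natDegree := by omega
  have h2 : (p.natDegree).choose (p.natDegree - 1) = p.natDegree := by
    rw [Nat.choose_symm_of_eq_add (b := 1) (by omega), Nat.choose_one_right]
  rw [taylor_coeff, eval_eq_sum_range' (n := 2)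
    ((natDegree_hasseDeriv_le _ _).trans_lt (by omega))]
  simp only [Finset.sum_range_succ, Finset.sum_range_zero, hasseDeriv_coeff]
  rw [h1, hp.coeff_natDegree, h2]
  simp

variable {F : Type*} [Field F] [IsAlgClosed F] [CharZero F]

/- The vanishing of the second coefficient excludes a power of a linear polynomial. -/
theorem exists_isRoot_coeff_taylor_ne_zero {r : F[X]} (hr : r.Monic) (hd : 0 < r.natDegree)
    (h1 : r.coeff (r.natDegree - 1) = 0) {i : ℕ} (hi : i < r.natDegree) (h2 : r.coeff i ≠ 0) :
    ∃ c, r.IsRoot c ∧ ∃ j < r.natDegree, (taylor c r).coeff j ≠ 0 := by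
  obtain ⟨c, hc⟩ := IsAlgClosed.exists_root r (degree_ne_of_natDegree_ne hd.ne')
  refine ⟨c, hc, ?_⟩
  by_contra! hcon
  have hc0 : c = 0 := by
    have h := coeff_taylor_natDegree_sub_one hr hd c
    rw [hcon _ (by omega), h1, zero_add] at h
    exact (mul_eq_zero.1 h.symm).resolve_left (by exact_mod_cast hd.ne')
  exact h2 (by simpa only [hc0, taylor_zero] using hcon i hi)

theorem exists_monic_dvd_taylor {q : (PowerSeries F)[X]} (hq : q.Monic) (hd : 0 < q.natDegree)
    (h1 : PowerSeries.constantCoeff (q.coeff (q.natDegree - 1)) = 0)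
    {i : ℕ} (hi : i < q.natDegree) (h2 : PowerSeries.constantCoeff (q.coeff i) ≠ 0) :
    ∃ (c : F) (f : (PowerSeries F)[X]), f.Monic ∧ 0 < f.natDegree ∧
      f.natDegree < q.natDegree ∧ f ∣ taylor (PowerSeries.C c) q := by
  have hI : IsAdicComplete (IsLocalRing.maximalIdeal (PowerSeries F)) (PowerSeries F) := by
    rw [PowerSeries.maximalIdeal_eq_span_X]
    infer_instance
  have hmem : ∀ a : PowerSeries F,
      a ∈ IsLocalRing.maximalIdeal _ ↔ PowerSeries.constantCoeff a = 0 := fun a => by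
    rw [PowerSeries.maximalIdeal_eq_span_X, Ideal.mem_span_singleton, PowerSeries.X_dvd_iff]
  set r := q.map (PowerSeries.constantCoeff (R := F)) with hr
  have hrd : r.natDegree = q.natDegree := hq.natDegree_map _
  obtain ⟨c, hc, j, hj, hcj⟩ := exists_isRoot_coeff_taylor_ne_zero (r := r) (hq.map _)
    (hrd ▸ hd) (by rw [hrd, hr, coeff_map, h1]) (hrd ▸ hi) (by rwa [hr, coeff_map])
  have hT : ∀ j, PowerSeries.constantCoeff ((taylor (PowerSeries.C c) q).coeff j) =
      (taylor c r).coeff j := fun j => by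
    rw [← coeff_map, map_taylor, PowerSeries.constantCoeff_C]
  classical
  have hex : ∃ j, (taylor c r).coeff j ≠ 0 := ⟨j, hcj⟩
  obtain ⟨f, hf, hfd, hfq⟩ := exists_monic_dvd_of_coeff_mem
    (q := taylor (PowerSeries.C c) q) (e := Nat.find hex)
    (fun k hk => by rw [hmem, hT]; exact not_not.1 (Nat.find_min hex hk))
    (by rw [hmem, hT]; exact Nat.find_spec hex)
  refine ⟨c, f, hf, ?_, ?_, hfq⟩
  · rw [hfd, Nat.find_pos, taylor_coeff_zero, not_not]
    exact hc
  · rw [hfd, ← hrd]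
    exact (Nat.find_min' hex hcj).trans_lt hj

end Polynomials

/-- The substitution `s ↦ s ^ m` in Laurent series; an element `y` with
`p.eval₂ (expandHom F m hm) y = 0` encodes the Puiseux series root `y (s ^ (1 / m))` of `p`. -/
noncomputable def expandHom (F : Type*) [Field F] (m : ℕ) (hm : 0 < m) : F⸨X⸩ →+* F⸨X⸩ :=
  embDomainRingHom (AddMonoidHom.mulLeft (m : ℤ))
    (mul_right_injective₀ (by exact_mod_cast hm.ne'))
    (fun _ _ => mul_le_mul_iff_right₀ (by exact_mod_cast hm))

variable {F : Type*} [Field F]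

theorem coeff_expandHom_mul {m : ℕ} (hm : 0 < m) (x : F⸨X⸩) (k : ℤ) :
    (expandHom F m hm x).coeff (m * k) = x.coeff k :=
  embDomain_coeff

theorem coeff_expandHom_of_not_dvd {m : ℕ} (hm : 0 < m) (x : F⸨X⸩) {k : ℤ}
    (hk : ¬ (m : ℤ) ∣ k) : (expandHom F m hm x).coeff k = 0 := by
  refine embDomain_of_notMem_range ?_
  rintro ⟨j, rfl⟩
  exact hk (Dvd.intro _ rfl)

theorem expandHom_single {m : ℕ} (hm : 0 < m) (k : ℤ) (a : F) :
    expandHom F m hm (single k a) = single (m * k) a :=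
  embDomain_single

theorem expandHom_C {m : ℕ} (hm : 0 < m) (a : F) : expandHom F m hm (C a) = C a := by
  rw [C_apply, expandHom_single, mul_zero]

theorem expandHom_comp_expandHom {m l : ℕ} (hm : 0 < m) (hl : 0 < l) :
    (expandHom F l hl).comp (expandHom F m hm) = expandHom F (l * m) (mul_pos hl hm) := by
  ext x k
  rw [RingHom.comp_apply]
  by_cases h : (l : ℤ) ∣ k
  · obtain ⟨j, rfl⟩ := h
    rw [coeff_expandHom_mul]
    by_cases h' : (m : ℤ) ∣ j
    · obtain ⟨i, rfl⟩ := h'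
      rw [coeff_expandHom_mul, ← mul_assoc, ← Nat.cast_mul, coeff_expandHom_mul]
    · rw [coeff_expandHom_of_not_dvd _ _ h', coeff_expandHom_of_not_dvd]
      rwa [Nat.cast_mul, mul_dvd_mul_iff_left (by exact_mod_cast hl.ne')]
  · rw [coeff_expandHom_of_not_dvd _ _ h, coeff_expandHom_of_not_dvd]
    exact fun h' => h ((Dvd.intro _ (Nat.cast_mul l m).symm).trans h')

theorem expandHom_mem_ordGE {m : ℕ} (hm : 0 < m) {k : ℤ} {x : F⸨X⸩} (hx : x ∈ ordGE F k) :
    expandHom F m hm x ∈ ordGE F (m * k) := by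
  intro j hj
  by_cases h : (m : ℤ) ∣ j
  · obtain ⟨i, rfl⟩ := h
    rw [coeff_expandHom_mul]
    exact hx i (lt_of_mul_lt_mul_left hj (by positivity))
  · exact coeff_expandHom_of_not_dvd hm x h

/-- Roots of polynomials over the Laurent series, as Puiseux series. -/
def HasPuiseuxRoot (p : Polynomial F⸨X⸩) : Prop :=
  ∃ (m : ℕ) (hm : 0 < m) (y : F⸨X⸩), p.eval₂ (expandHom F m hm) y = 0

namespace HasPuiseuxRoot

variable {p q : Polynomial F⸨X⸩} {c : F⸨X⸩}

theorem of_map_expandHom {m : ℕ} {hm : 0 < m} (h : HasPuiseuxRoot (p.map (expandHom F m hm))) :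
    HasPuiseuxRoot p := by
  obtain ⟨l, hl, y, hy⟩ := h
  rw [Polynomial.eval₂_map, expandHom_comp_expandHom] at hy
  exact ⟨l * m, mul_pos hl hm, y, hy⟩

theorem of_taylor (h : HasPuiseuxRoot (Polynomial.taylor c p)) : HasPuiseuxRoot p := by
  obtain ⟨l, hl, y, hy⟩ := h
  refine ⟨l, hl, y + expandHom F l hl c, ?_⟩
  simpa only [Polynomial.taylor_apply, Polynomial.eval₂_comp, Polynomial.eval₂_add,
    Polynomial.eval₂_X, Polynomial.eval₂_C] using hy

theorem of_scaleRoots (hc : c ≠ 0) (h : HasPuiseuxRoot (p.scaleRoots c)) : HasPuiseuxRoot p := by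
  obtain ⟨l, hl, y, hy⟩ := h
  refine ⟨l, hl, y / expandHom F l hl c, ?_⟩
  have hc' : expandHom F l hl c ≠ 0 := (map_ne_zero _).2 hc
  have h1 := Polynomial.scaleRoots_eval₂_mul (p := p) (expandHom F l hl)
    (y / expandHom F l hl c) c
  rw [mul_div_cancel₀ _ hc', hy] at h1
  exact (mul_eq_zero.1 h1.symm).resolve_left (pow_ne_zero _ hc')

theorem of_dvd (h : HasPuiseuxRoot p) (hpq : p ∣ q) : HasPuiseuxRoot q := by
  obtain ⟨l, hl, y, hy⟩ := h
  exact ⟨l, hl, y, Polynomial.eval₂_eq_zero_of_dvd_of_eval₂_eq_zero _ _ hpq hy⟩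

end HasPuiseuxRoot

theorem exists_ofPowerSeries_eq {x : F⸨X⸩} (hx : x ∈ ordGE F 0) :
    ∃ a : PowerSeries F, ofPowerSeries ℤ F a = x := by
  refine ⟨PowerSeries.mk fun k => x.coeff k, ?_⟩
  ext k
  rcases lt_or_ge k 0 with hk | hk
  · rw [hx k hk, PowerSeries.coeff_coe, if_pos hk]
  · lift k to ℕ using hk
    rw [LaurentSeries.coeff_coe_powerSeries, PowerSeries.coeff_mk]

theorem exists_map_ofPowerSeries_eq {b : Polynomial F⸨X⸩} (hb : b.Monic)
    (h : ∀ i < b.natDegree, b.coeff i ∈ ordGE F 0) :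
    ∃ q : Polynomial (PowerSeries F), q.map (ofPowerSeries ℤ F) = b ∧
      q.natDegree = b.natDegree ∧ q.Monic := by
  refine Polynomial.lifts_and_natDegree_eq_and_monic
    ((Polynomial.lifts_iff_coeff_lifts _).2 fun i => exists_ofPowerSeries_eq ?_) hb
  rcases lt_trichotomy i b.natDegree with hi | rfl | hi
  · exact h i hi
  · rw [hb.coeff_natDegree]
    exact C_mem_ordGE 1
  · rw [Polynomial.coeff_eq_zero_of_natDegree_lt hi]
    exact zero_mem _

/- The slope of the Newton polygon at the leading vertex is `u / m`. -/
theorem exists_newton_slope {N : ℕ} (x : ℕ → F⸨X⸩) (hx : ∃ i < N, x i ≠ 0) :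
    ∃ (m : ℕ) (hm : 0 < m) (u : ℤ),
      (∀ i < N, expandHom F m hm (x i) ∈ ordGE F ((N - i : ℕ) * u)) ∧
        ∃ i < N, (expandHom F m hm (x i)).coeff ((N - i : ℕ) * u) ≠ 0 := by
  classical
  obtain ⟨i₀, hi₀, hmin⟩ := Finset.exists_min_image
    ((Finset.range N).filter fun i => x i ≠ 0) (fun i => ((x i).order : ℚ) / (N - i : ℕ))
    (by simpa only [Finset.Nonempty, Finset.mem_filter, Finset.mem_range] using hx)
  rw [Finset.mem_filter, Finset.mem_range] at hi₀
  have hm : 0 < N - i₀ := by omega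
  refine ⟨N - i₀, hm, (x i₀).order, fun i hi => ?_, i₀, hi₀.1, ?_⟩
  · by_cases h : x i = 0
    · rw [h, map_zero]
      exact zero_mem _
    · refine ordGE_antitone ?_ (expandHom_mem_ordGE hm (mem_ordGE_order _))
      have hle := hmin i (Finset.mem_filter.2 ⟨Finset.mem_range.2 hi, h⟩)
      rw [div_le_div_iff₀ (by exact_mod_cast hm) (by exact_mod_cast Nat.sub_pos_of_lt hi),
        mul_comm, mul_comm ((x i).order : ℚ)] at hle
      exact_mod_cast hle
  · rw [coeff_expandHom_mul]
    exact coeff_order_eq_zero.not.2 hi₀.2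

theorem exists_integral_model {p : Polynomial F⸨X⸩} (hp : p.Monic)
    (hx : ∃ i < p.natDegree, p.coeff i ≠ 0) :
    ∃ (m : ℕ) (hm : 0 < m) (u : ℤ) (q : Polynomial (PowerSeries F)),
      q.map (ofPowerSeries ℤ F) = (p.map (expandHom F m hm)).scaleRoots (single u 1) ∧
      q.natDegree = p.natDegree ∧ q.Monic ∧
      (∃ i < q.natDegree, PowerSeries.constantCoeff (q.coeff i) ≠ 0) ∧
      ∀ i, p.coeff i = 0 → q.coeff i = 0 := by
  obtain ⟨m, hm, u, hord, i, hi, hne⟩ := exists_newton_slope p.coeff hx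
  set b := (p.map (expandHom F m hm)).scaleRoots (single (-u) 1) with hb
  have hbd : b.natDegree = p.natDegree := by
    rw [hb, Polynomial.natDegree_scaleRoots, hp.natDegree_map]
  have hbc : ∀ i, b.coeff i =
      single (-((p.natDegree - i : ℕ) * u)) 1 * expandHom F m hm (p.coeff i) := fun i => by
    rw [hb, Polynomial.coeff_scaleRoots, Polynomial.coeff_map, hp.natDegree_map, mul_comm,
      single_pow, one_pow, nsmul_eq_mul, mul_neg]
  obtain ⟨q, hqb, hqd, hqm⟩ := exists_map_ofPowerSeries_eq
    ((Polynomial.monic_scaleRoots_iff _).2 (hp.map _)) (b := b) fun i hi => by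
      rw [hbc]
      exact ordGE_antitone (neg_add_cancel _).ge
        (mul_mem_ordGE (single_mem_ordGE _ _) (hord i (hbd ▸ hi)))
  have hqc : ∀ i, ofPowerSeries ℤ F (q.coeff i) = b.coeff i := fun i => by
    rw [← hqb, Polynomial.coeff_map]
  refine ⟨m, hm, -u, q, hqb, hqd.trans hbd, hqm, ⟨i, by rwa [hqd, hbd], ?_⟩, fun i hi => ?_⟩
  · rw [← PowerSeries.coeff_zero_eq_constantCoeff_apply, ← LaurentSeries.coeff_coe_powerSeries]
    change (ofPowerSeries ℤ F (q.coeff i)).coeff 0 ≠ 0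
    rwa [hqc, hbc, coeff_single_mul, one_mul, zero_sub, neg_neg]
  · refine (map_eq_zero_iff _ (ofPowerSeries_injective (Γ := ℤ))).1 ?_
    rw [hqc, hbc, hi, map_zero, mul_zero]

variable [IsAlgClosed F] [CharZero F]

theorem hasPuiseuxRoot_of_monic {p : Polynomial F⸨X⸩} (hp : p.Monic) (hN : 0 < p.natDegree) :
    HasPuiseuxRoot p := by
  induction hn : p.natDegree using Nat.strong_induction_on generalizing p with
  | _ N ih =>
  subst hn
  have hch : CharZero F⸨X⸩ := charZero_of_injective_algebraMap (algebraMap F F⸨X⸩).injective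
  set c := -p.coeff (p.natDegree - 1) / p.natDegree with hc
  refine HasPuiseuxRoot.of_taylor (c := c) ?_
  set p' := Polynomial.taylor c p
  have hp'm : p'.Monic := by
    rw [Polynomial.Monic, Polynomial.leadingCoeff_taylor, hp.leadingCoeff]
  have hp'd : p'.natDegree = p.natDegree := Polynomial.natDegree_taylor p c
  have hdep : p'.coeff (p.natDegree - 1) = 0 := by
    rw [coeff_taylor_natDegree_sub_one hp hN, hc, mul_div_cancel₀ _ (by exact_mod_cast hN.ne'),
      add_neg_cancel]
  by_cases hz : ∃ i < p'.natDegree, p'.coeff i ≠ 0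
  · obtain ⟨m, hm, u, q, hqp, hqd, hqm, ⟨i, hi, hqi⟩, hq0⟩ := exists_integral_model hp'm hz
    rw [hp'd] at hqd
    obtain ⟨a, f, hf, hf0, hfd, hfq⟩ := exists_monic_dvd_taylor hqm (hqd ▸ hN)
      (by rw [hqd, hq0 _ hdep, map_zero]) hi hqi
    have hroot : HasPuiseuxRoot (f.map (ofPowerSeries ℤ F)) :=
      ih _ (hqd ▸ hfd) (hf.map _) (by rwa [hf.natDegree_map]) (hf.natDegree_map _)
    refine .of_map_expandHom (hm := hm) (.of_scaleRoots (c := single u 1) (by simp) ?_)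
    refine .of_taylor (c := ofPowerSeries ℤ F (PowerSeries.C a)) (hroot.of_dvd ?_)
    rw [← hqp, ← Polynomial.map_taylor]
    exact Polynomial.map_dvd _ hfq
  · push Not at hz
    refine ⟨1, one_pos, 0, ?_⟩
    rw [Polynomial.eval₂_at_zero, hz 0 (hp'd ▸ hN), map_zero]

theorem hasPuiseuxRoot {p : Polynomial F⸨X⸩} (hp : 0 < p.natDegree) : HasPuiseuxRoot p := by
  have hp0 : p ≠ 0 := Polynomial.ne_zero_of_natDegree_gt hp
  refine (hasPuiseuxRoot_of_monic (Polynomial.monic_mul_leadingCoeff_inv hp0)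
    (by rwa [Polynomial.natDegree_mul_leadingCoeff_self_inv])).of_dvd
    ⟨Polynomial.C p.leadingCoeff, ?_⟩
  rw [mul_assoc, ← Polynomial.C_mul, inv_mul_cancel₀ (Polynomial.leadingCoeff_ne_zero.2 hp0),
    Polynomial.C_1, mul_one]

end Puiseux

section Embedding

open HahnSeries

open scoped LaurentSeries IntermediateField

theorem exists_algHom_of_transcendental {K Ω E : Type*} [Field K] [Field Ω] [Field E]
    [Algebra K Ω] [Algebra K E] {t : Ω} {y : E} (ht : Transcendental K t)
    (hy : Transcendental K y) :
    ∃ ψ : K⟮t⟯ →ₐ[K] E, ψ (IntermediateField.AdjoinSimple.gen K t) = y := by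
  have hX : (RatFunc.algEquivOfTranscendental t ht).symm
      (IntermediateField.AdjoinSimple.gen K t) = RatFunc.X := by
    rw [AlgEquiv.symm_apply_eq]
    exact Subtype.ext (RatFunc.algEquivOfTranscendental_X t ht).symm
  refine ⟨(IntermediateField.val _).comp
    ((RatFunc.algEquivOfTranscendental t ht).symm.trans
      (RatFunc.algEquivOfTranscendental y hy)).toAlgHom, ?_⟩
  simp [hX]

section Series

variable {F : Type*} [Field F]

theorem algebraMap_eq_C (a : F) : algebraMap F F⸨X⸩ a = C a := by
  rw [algebraMap_apply', PowerSeries.algebraMap_apply, Algebra.algebraMap_self,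
    RingHom.id_apply, ofPowerSeries_C]

theorem transcendental_single {k : ℤ} (hk : k ≠ 0) : Transcendental F (single k 1 : F⸨X⸩) := by
  refine transcendental_iff.2 fun p hp => Polynomial.ext fun j => ?_
  have hterm : ∀ i : ℕ, (C (p.coeff i) * (single k 1 : F⸨X⸩) ^ i).coeff (j * k) =
      if j = i then p.coeff i else 0 := fun i => by
    rw [single_pow, one_pow, nsmul_eq_mul, C_apply, single_mul_single, zero_add, mul_one,
      coeff_single]
    simp only [mul_left_inj' hk, Nat.cast_inj]
  have h := congrArg (fun x : F⸨X⸩ => x.coeff (j * k)) hp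
  simp only [Polynomial.aeval_def, Polynomial.eval₂_eq_sum_range, coeff_sum, algebraMap_eq_C,
    hterm, Finset.sum_ite_eq, Finset.mem_range, Order.lt_add_one_iff, coeff_zero,
    ite_eq_right_iff] at h
  rw [Polynomial.coeff_zero]
  exact (le_or_gt j p.natDegree).elim h Polynomial.coeff_eq_zero_of_natDegree_lt

/- An exponential `t` is sent to `s ^ m`, a primitive to `s ^ (-m)`. -/
theorem exists_laurentDeriv_single_eq [CharZero F] {ι : Type*} {d : ι → Der F} {a b : ι → F}
    (ha : ∀ i j, d i (a j) = d j (a i)) (hb : ∀ i j, d i (b j) = d j (b i))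
    (hab : a = 0 ∨ b = 0) :
    ∃ v : ℤ, v ≠ 0 ∧ ∀ m : ℕ, 0 < m → ∃ (γ : ι → F) (e : ℕ),
      (∀ i j, d i (γ j) = d j (γ i)) ∧
      ∀ i, laurentDeriv (d i) (γ i) e (single (m * v) 1) =
        C (a i) * single (m * v) 1 + C (b i) := by
  rcases hab with rfl | rfl
  · refine ⟨-1, by norm_num, fun m hm => ⟨fun i => -b i / m, m, fun i j => ?_, fun i => ?_⟩⟩
    · rw [Derivation.leibniz_div_const _ _ _ (Derivation.map_natCast _ m),
        Derivation.leibniz_div_const _ _ _ (Derivation.map_natCast _ m), map_neg, map_neg, hb]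
    · have hm0 : (m : F) ≠ 0 := by exact_mod_cast hm.ne'
      have hγ : ((m * (-1 : ℤ) : ℤ) : F) * (-b i / m) = b i := by
        push_cast
        field_simp
      rw [laurentDeriv_single, hγ, mul_neg_one, neg_add_cancel, Pi.zero_apply, map_zero,
        zero_mul, zero_add, C_apply]
  · refine ⟨1, one_ne_zero, fun m hm => ⟨fun i => a i / m, 0, fun i j => ?_, fun i => ?_⟩⟩
    · rw [Derivation.leibniz_div_const _ _ _ (Derivation.map_natCast _ m),
        Derivation.leibniz_div_const _ _ _ (Derivation.map_natCast _ m), ha]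
    · have hm0 : (m : F) ≠ 0 := by exact_mod_cast hm.ne'
      have hγ : ((m * (1 : ℤ) : ℤ) : F) * (a i / m) = a i := by
        push_cast
        field_simp
      rw [laurentDeriv_single, hγ, Pi.zero_apply, map_zero, add_zero, C_apply,
        single_mul_single, mul_one, mul_one, zero_add, Nat.cast_zero, add_zero]

theorem exists_puiseux_embedding [IsAlgClosed F] [CharZero F] {Ω : Type*} [Field Ω] [Algebra F Ω]
    {t : Ω} (ht : Transcendental F t) {Z : Set Ω} (hZf : Z.Finite)
    (hZ : ∀ z ∈ Z, IsAlgebraic F⟮t⟯ z) {v : ℤ} (hv : v ≠ 0) :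
    ∃ m : ℕ, 0 < m ∧ ∃ (T : IntermediateField F⟮t⟯ Ω) (ψ : T →+* F⸨X⸩),
      Z ⊆ T ∧ Algebra.IsAlgebraic F⟮t⟯ T ∧
      (∀ a : F, ψ (algebraMap F⟮t⟯ T (algebraMap F F⟮t⟯ a)) = C a) ∧
      ψ (algebraMap F⟮t⟯ T (IntermediateField.AdjoinSimple.gen F t)) = single (m * v) 1 := by
  obtain ⟨ψ₀, hψ₀⟩ := exists_algHom_of_transcendental ht (transcendental_single (F := F) hv)
  let T : IntermediateField F⟮t⟯ Ω := IntermediateField.adjoin F⟮t⟯ Z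
  have hZ' : Finite Z := hZf
  have hfin : FiniteDimensional F⟮t⟯ T :=
    IntermediateField.finiteDimensional_adjoin fun z hz => (hZ z hz).isIntegral
  have hch : CharZero F⟮t⟯ := charZero_of_injective_algebraMap (algebraMap F F⟮t⟯).injective
  let pb := Field.powerBasisOfFiniteOfSeparable F⟮t⟯ T
  obtain ⟨m, hm, y, hy⟩ := hasPuiseuxRoot (p := (minpoly F⟮t⟯ pb.gen).map ψ₀.toRingHom) (by
    rw [Polynomial.natDegree_map]
    exact minpoly.natDegree_pos (Algebra.IsIntegral.isIntegral _))
  rw [Polynomial.eval₂_map] at hy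
  let _ : Algebra F⟮t⟯ F⸨X⸩ := ((expandHom F m hm).comp ψ₀.toRingHom).toAlgebra
  let ψ : T →ₐ[F⟮t⟯] F⸨X⸩ := pb.lift y hy
  have hψ : ∀ x : F⟮t⟯, ψ (algebraMap F⟮t⟯ T x) = expandHom F m hm (ψ₀ x) := ψ.commutes
  refine ⟨m, hm, T, ψ.toRingHom, IntermediateField.subset_adjoin _ _, inferInstance,
    fun a => (hψ _).trans ?_, (hψ _).trans ?_⟩
  · rw [ψ₀.commutes, algebraMap_eq_C, expandHom_C]
  · rw [hψ₀, expandHom_single]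

end Series

variable {Ω : Type*} [Field Ω] [CharZero Ω] {S : Subfield Ω} {t : Ω}

theorem laurentDeriv_map_eq (T : IntermediateField S⟮t⟯ Ω) [Algebra.IsAlgebraic S⟮t⟯ T]
    {D : Der Ω} (hS : ∀ x ∈ S, D x ∈ S) (hst : ∀ x ∈ S⟮t⟯, D x ∈ S⟮t⟯)
    (hT : ∀ x ∈ T.toSubfield, D x ∈ T.toSubfield) {ψ : T →+* S⸨X⸩}
    (hψ : ∀ a : S, ψ (algebraMap S⟮t⟯ T (algebraMap S S⟮t⟯ a)) = C a) {γ : S} {e : ℕ}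
    (ht : laurentDeriv (D.restrict S hS) γ e
        (ψ (algebraMap S⟮t⟯ T (IntermediateField.AdjoinSimple.gen S t))) =
      ψ (algebraMap S⟮t⟯ T ⟨D t, hst _ (IntermediateField.mem_adjoin_simple_self S t)⟩))
    (x : T) : laurentDeriv (D.restrict S hS) γ e (ψ x) = ψ (D.restrict T.toSubfield hT x) := by
  refine map_derivation_of_isAlgebraic (A := S⟮t⟯) (T := T) ψ (D.restrict T.toSubfield hT) _
    (fun a => ?_) (Algebra.IsAlgebraic.isAlgebraic x)
  refine map_derivation_of_mem_adjoin D _ (ψ.comp (algebraMap S⟮t⟯ T)) hst (fun a => ?_) ht a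
  rw [RingHom.comp_apply, hψ, laurentDeriv_C]
  exact (hψ (D.restrict S hS a)).symm

variable {ι : Type*} {d : ι → Der Ω}

theorem exists_eq_mul_add (hd : ∀ i j a, d i (d j a) = d j (d i a)) (hS : IsStable d S)
    (ht : t ≠ 0) (htS : (∀ i, d i t ∈ S) ∨ (∀ i, d i t / t ∈ S)) :
    ∃ a b : ι → S,
      (∀ i j, (d i).restrict S (hS i) (a j) = (d j).restrict S (hS j) (a i)) ∧
      (∀ i j, (d i).restrict S (hS i) (b j) = (d j).restrict S (hS j) (b i)) ∧
      (a = 0 ∨ b = 0) ∧ ∀ i, d i t = a i * t + b i := by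
  rcases htS with h | h
  · refine ⟨0, fun i => ⟨d i t, h i⟩, fun i j => ?_, fun i j => Subtype.ext (hd i j t),
      Or.inl rfl, fun i => ?_⟩
    · rw [Pi.zero_apply, map_zero, Pi.zero_apply, map_zero]
    · rw [Pi.zero_apply, ZeroMemClass.coe_zero, zero_mul, zero_add]
  · refine ⟨fun i => ⟨d i t / t, h i⟩, 0, fun i j => Subtype.ext ?_, fun i j => ?_,
      Or.inr rfl, fun i => ?_⟩
    · rw [Der.coe_restrict, Der.coe_restrict, Derivation.leibniz_div, Derivation.leibniz_div,
        hd i j]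
      simp only [smul_eq_mul]
      ring
    · rw [Pi.zero_apply, map_zero, Pi.zero_apply, map_zero]
    · rw [Pi.zero_apply, ZeroMemClass.coe_zero, add_zero, div_mul_cancel₀ _ ht]

theorem exists_laurent_embedding [IsAlgClosed Ω] (hd : ∀ i j a, d i (d j a) = d j (d i a))
    (hS : IsStable d S) (hSc : ∀ x : Ω, IsAlgebraic S x → x ∈ S) (ht : Transcendental S t)
    (htS : (∀ i, d i t ∈ S) ∨ (∀ i, d i t / t ∈ S)) {Z : Set Ω} (hZf : Z.Finite)
    (hZ : ∀ z ∈ Z, IsAlgebraic S⟮t⟯ z) :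
    ∃ (γ : ι → S) (e : ℕ),
      (∀ i j, (d i).restrict S (hS i) (γ j) = (d j).restrict S (hS j) (γ i)) ∧
      ∃ (T : Subfield Ω) (hST : S ≤ T) (hT : IsStable d T) (ψ : T →+* S⸨X⸩), Z ⊆ T ∧
        (∀ a : S, ψ ⟨a, hST a.2⟩ = C a) ∧
        ∀ i (x : T), laurentDeriv ((d i).restrict S (hS i)) (γ i) e (ψ x) =
          ψ ((d i).restrict T (hT i) x) := by
  have hcl : IsAlgClosed S := isAlgClosed_of_forall_mem hSc
  have ht0 : t ≠ 0 := by
    rintro rfl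
    exact ht isAlgebraic_zero
  obtain ⟨a, b, ha, hb, hab, hdt⟩ :=
    exists_eq_mul_add hd hS ht0 htS
  obtain ⟨v, hv, hγ⟩ := exists_laurentDeriv_single_eq ha hb hab
  obtain ⟨m, hm, T, ψ, hZT, hTalg, hψS, hψt⟩ := exists_puiseux_embedding ht hZf hZ hv
  obtain ⟨γ, e, hγc, hγt⟩ := hγ m hm
  have hSt : ∀ c : S, (c : Ω) ∈ S⟮t⟯ := S⟮t⟯.algebraMap_mem
  have htmem := IntermediateField.mem_adjoin_simple_self S t
  have hst : ∀ i, ∀ x ∈ S⟮t⟯, d i x ∈ S⟮t⟯ := fun i x hx =>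
    derivation_mem_adjoin (d i) (fun c => hSt ⟨_, hS i _ c.2⟩)
      (hdt i ▸ add_mem (mul_mem (hSt _) htmem) (hSt _)) hx
  have hAT : S⟮t⟯.toSubfield ≤ T.toSubfield := fun x hx => T.algebraMap_mem ⟨x, hx⟩
  have hT : IsStable d T.toSubfield := fun i x hx =>
    derivation_mem_of_isAlgebraic (S := S⟮t⟯.toSubfield) (d i) (hst i) hAT hx
      ((hTalg.isAlgebraic ⟨x, hx⟩).algebraMap (A := Ω))
  refine ⟨γ, e, hγc, T.toSubfield, fun c hc => hAT (hSt ⟨c, hc⟩), hT, ψ, hZT, hψS, fun i x =>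
    laurentDeriv_map_eq T (hS i) (hst i) (hT i) hψS ?_ x⟩
  have hgen : (⟨d i t, hst i t htmem⟩ : S⟮t⟯) = algebraMap S S⟮t⟯ (a i) *
      IntermediateField.AdjoinSimple.gen S t + algebraMap S S⟮t⟯ (b i) :=
    Subtype.ext (hdt i)
  rw [hgen, hψt, hγt, map_add, map_add, map_mul, map_mul, hψS, hψS, hψt]

end Embedding

section Connections

open Matrix

variable {K : Type*} [Field K] {σ : Type*} {ι : Type*} [Fintype ι]

/-- The connection `∇ⱼ = dⱼ + Bⱼ` on column vectors, given by derivations `dⱼ` and matrices `Bⱼ`. -/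
def conn (d : σ → Der K) (B : σ → Matrix ι ι K) (j : σ) : (ι → K) →+ (ι → K) where
  toFun v := d j ∘ v + B j *ᵥ v
  map_zero' := by
    ext a
    simp
  map_add' v w := by
    ext a
    simp only [mulVec_add, Pi.add_apply, Function.comp_apply, map_add]
    ring

theorem conn_def (d : σ → Der K) (B : σ → Matrix ι ι K) (j : σ) (v : ι → K) :
    conn d B j v = d j ∘ v + B j *ᵥ v := rfl

theorem conn_apply (d : σ → Der K) (B : σ → Matrix ι ι K) (j : σ) (v : ι → K) (a : ι) :
    conn d B j v a = d j (v a) + ∑ b, B j a b * v b := rfl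

theorem conn_smul (d : σ → Der K) (B : σ → Matrix ι ι K) (j : σ) (c : K) (v : ι → K) :
    conn d B j (c • v) = d j c • v + c • conn d B j v := by
  ext a
  simp only [conn_def, mulVec_smul, Pi.add_apply, Function.comp_apply, Pi.smul_apply, smul_eq_mul,
    Der.map_mul]
  ring

theorem conn_single [DecidableEq ι] (d : σ → Der K) (B : σ → Matrix ι ι K) (j : σ) (a b : ι) :
    conn d B j (Pi.single b 1) a = B j a b := by
  rw [conn_def, mulVec_single_one, Pi.add_apply, Function.comp_apply, Pi.single_apply]
  split_ifs <;> simp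

theorem conn_congr {d : σ → Der K} {B : σ → Matrix ι ι K} {v w : ι → K} {a : ι} {j : σ}
    (ha : v a = w a) (hvw : ∀ c, B j a c ≠ 0 → v c = w c) : conn d B j v a = conn d B j w a := by
  rw [conn_apply, conn_apply, ha]
  congr 1
  refine Finset.sum_congr rfl fun c _ => ?_
  by_cases hc : B j a c = 0
  · rw [hc, zero_mul, zero_mul]
  · rw [hvw c hc]

theorem map_ringHom_conn {E : Type*} [Field E] {d : σ → Der K} {D : σ → Der E} (ψ : K →+* E)
    (hψ : ∀ i x, D i (ψ x) = ψ (d i x)) (B : σ → Matrix ι ι K) (j : σ) (v : ι → K) :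
    conn D (fun j => (B j).map ψ) j (ψ ∘ v) = ψ ∘ conn d B j v := by
  ext a
  simp only [conn_apply, Function.comp_apply, map_apply, hψ, map_add, map_sum, map_mul]

/-- The matrices of a family of operators on column vectors in the standard basis. -/
def matrixOf [DecidableEq ι] (f : σ → (ι → K) →+ (ι → K)) (j : σ) : Matrix ι ι K :=
  of fun a b => f j (Pi.single b 1) a

theorem conn_matrixOf [DecidableEq ι] {d : σ → Der K} {f : σ → (ι → K) →+ (ι → K)}
    (hf : ∀ j (c : K) v, f j (c • v) = d j c • v + c • f j v) (j : σ) :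
    conn d (matrixOf f) j = f j := by
  refine AddMonoidHom.functions_ext _ _ _ fun b x => ?_
  have hx : (Pi.single b x : ι → K) = x • Pi.single b 1 := by
    rw [← Pi.single_smul, smul_eq_mul, mul_one]
  rw [hx, hf, conn_smul]
  congr 2
  ext a
  exact conn_single d _ j a b

theorem derivation_comp_mulVec (D : Der K) (M : Matrix ι ι K) (v : ι → K) :
    D ∘ (M *ᵥ v) = M.map D *ᵥ v + M *ᵥ (D ∘ v) := by
  ext a
  simp only [Function.comp_apply, Pi.add_apply, mulVec, dotProduct, map_sum, Der.map_mul, map_apply,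
    ← Finset.sum_add_distrib]
  exact Finset.sum_congr rfl fun b _ => by ring

theorem conn_conn (d : σ → Der K) (B : σ → Matrix ι ι K) (i j : σ) (v : ι → K) :
    conn d B i (conn d B j v) = d i ∘ d j ∘ v + (B j *ᵥ (d i ∘ v) + B i *ᵥ (d j ∘ v)) +
      ((B j).map (d i) + B i * B j) *ᵥ v := by
  have hadd (w w' : ι → K) : d i ∘ (w + w') = d i ∘ w + d i ∘ w' :=
    funext fun a => map_add (d i) (w a) (w' a)
  rw [conn_def, conn_def, hadd, derivation_comp_mulVec, mulVec_add, mulVec_mulVec, add_mulVec]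
  abel

theorem conn_comm_iff {d : σ → Der K} (hd : ∀ i j a, d i (d j a) = d j (d i a))
    {B : σ → Matrix ι ι K} :
    (∀ i j v, conn d B i (conn d B j v) = conn d B j (conn d B i v)) ↔
      ∀ i j, (B j).map (d i) + B i * B j = (B i).map (d j) + B j * B i := by
  have hdd (i j : σ) (v : ι → K) : d i ∘ d j ∘ v = d j ∘ d i ∘ v := funext fun a => hd i j (v a)
  refine forall₂_congr fun i j => ?_
  rw [← mulVec_injective.eq_iff, funext_iff]
  refine forall_congr' fun v => ?_
  rw [conn_conn, conn_conn, hdd i j, add_comm (B j *ᵥ _), add_right_inj]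

theorem conn_gauge [DecidableEq ι] {T T' : Matrix ι ι K} (hT : T' * T = 1) (d : σ → Der K)
    (B : σ → Matrix ι ι K) (j : σ) (v : ι → K) :
    conn d (fun j => T' * (B j * T + T.map (d j))) j v = T' *ᵥ conn d B j (T *ᵥ v) := by
  rw [conn_def, conn_def, derivation_comp_mulVec, ← mulVec_mulVec, add_mulVec, ← mulVec_mulVec,
    mulVec_add, mulVec_add, mulVec_add, mulVec_mulVec (d j ∘ v), hT, one_mulVec]
  abel

end Connections

section Triangular

open Matrix

variable {K : Type*} [Field K] {σ : Type*} [Fintype σ] {ι : Type*} [Fintype ι]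
  {d : σ → Der K} {P : σ → K} {k₀ : σ} {ρ : ι → ℕ} {B : σ → Matrix ι ι K} {h : ι → K}

/-- A flat connection `∇`, upper triangular for the order on the index set given by `ρ`, and a
vector `h` with `∑ Pⱼ ∇ⱼ h = 0` all of whose derivatives `∇ⱼ h`, `j ≠ k₀`, are independent. A
maximal independent family of first integrals is an instance with the trivial connection; unlike
the first integrals themselves, such data descend along Liouvillian extensions. -/
structure IsTriangularSystem (d : σ → Der K) (P : σ → K) (k₀ : σ) (ρ : ι → ℕ) (B : σ → Matrix ι ι K)
    (h : ι → K) : Prop where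
  inj : Function.Injective ρ
  tri : ∀ j, (B j).BlockTriangular ρ
  comm : ∀ i j v, conn d B i (conn d B j v) = conn d B j (conn d B i v)
  proj : ∑ j, P j • conn d B j h = 0
  indep : LinearIndependent K fun j : {j // j ≠ k₀} => conn d B j h

theorem IsTriangularSystem.of_leibniz [DecidableEq ι] {f : σ → (ι → K) →+ (ι → K)}
    (hf : ∀ j (c : K) v, f j (c • v) = d j c • v + c • f j v) (hρ : Function.Injective ρ)
    (htri : ∀ j a b, ρ b < ρ a → f j (Pi.single b 1) a = 0)
    (hcomm : ∀ i j v, f i (f j v) = f j (f i v)) (hproj : ∑ j, P j • f j h = 0)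
    (hindep : LinearIndependent K fun j : {j // j ≠ k₀} => f j h) :
    IsTriangularSystem d P k₀ ρ (matrixOf f) h where
  inj := hρ
  tri j a b hab := htri j a b hab
  comm := by simpa only [conn_matrixOf hf] using hcomm
  proj := by simpa only [conn_matrixOf hf] using hproj
  indep := by simpa only [conn_matrixOf hf] using hindep

theorem IsTriangularSystem.lt_of_ne_zero (H : IsTriangularSystem d P k₀ ρ B h) {j : σ} {a b : ι}
    (hab : a ≠ b) (h0 : B j a b ≠ 0) : ρ a < ρ b :=
  (not_lt.1 fun hlt => h0 (H.tri j hlt)).lt_of_ne (H.inj.ne hab)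

theorem IsTriangularSystem.map_diag (H : IsTriangularSystem d P k₀ ρ B h)
    (hd : ∀ i j a, d i (d j a) = d j (d i a))
    (i j : σ) (a : ι) : d i (B j a a) = d j (B i a a) := by
  have hmul (i j : σ) : (B i * B j) a a = B i a a * B j a a := by
    rw [mul_apply, Fintype.sum_eq_single a]
    intro c hca
    by_contra h0
    rw [← ne_eq, mul_ne_zero_iff] at h0
    exact (H.lt_of_ne_zero hca.symm h0.1).not_gt (H.lt_of_ne_zero hca h0.2)
  have hflat := congrFun₂ ((conn_comm_iff hd).1 H.comm i j) a a
  simp only [Matrix.add_apply, map_apply, hmul] at hflat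
  linear_combination hflat

theorem exists_mul_eq_one_of_linearIndependent_row {J : Type*} [Finite J] [DecidableEq J]
    {A : Matrix J ι K} (hA : LinearIndependent K A.row) : ∃ C : Matrix ι J K, A * C = 1 := by
  classical
  cases nonempty_fintype J
  obtain ⟨g, hg⟩ := A.vecMulLinear.exists_leftInverse_of_injective
    (LinearMap.ker_eq_bot.2 (vecMul_injective_iff.2 hA))
  refine ⟨LinearMap.toMatrixRight' g, Matrix.toLinearMapRight'.injective ?_⟩
  rw [toLinearMapRight'_mul, toLinearMapRight'_one]
  exact (congrArg (· ∘ₗ _) (LinearMap.toMatrixRight'.symm_apply_apply g)).trans hg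

theorem linearIndependent_row_of_mul_eq_one {J : Type*} [Finite J] [DecidableEq J]
    {A : Matrix J ι K} {C : Matrix ι J K} (hAC : A * C = 1) : LinearIndependent K A.row := by
  cases nonempty_fintype J
  rw [← vecMul_injective_iff]
  refine Function.LeftInverse.injective (g := fun w => w ᵥ* C) fun v => ?_
  change v ᵥ* A ᵥ* C = v
  rw [vecMul_vecMul, hAC, vecMul_one]

theorem linearIndependent_ringHom_comp_iff {J κ : Type*} [Finite J] [Finite κ] {E : Type*}
    [Field E] (ψ : K →+* E) {A : J → κ → K} :
    LinearIndependent E (fun j => ψ ∘ A j) ↔ LinearIndependent K A := by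
  classical
  cases nonempty_fintype J
  cases nonempty_fintype κ
  constructor <;> intro hA
  · rw [Fintype.linearIndependent_iff] at hA ⊢
    intro c hc j
    refine (map_eq_zero ψ).1 (hA (ψ ∘ c) (funext fun a => ?_) j)
    have hca := congrArg ψ (congrFun hc a)
    simpa only [Finset.sum_apply, Pi.smul_apply, smul_eq_mul, map_sum, _root_.map_mul,
      Function.comp_apply, Pi.zero_apply, map_zero] using hca
  · obtain ⟨C, hC⟩ := exists_mul_eq_one_of_linearIndependent_row (A := of A) hA
    refine linearIndependent_row_of_mul_eq_one (A := (of A).map ψ) (C := C.map ψ) ?_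
    rw [← Matrix.map_mul, hC, Matrix.map_one ψ ψ.map_zero ψ.map_one]

theorem isTriangularSystem_map_iff (hd : ∀ i j a, d i (d j a) = d j (d i a)) {E : Type*} [Field E]
    {D : σ → Der E} (hD : ∀ i j a, D i (D j a) = D j (D i a)) (ψ : K →+* E)
    (hψ : ∀ i x, D i (ψ x) = ψ (d i x)) :
    IsTriangularSystem D (ψ ∘ P) k₀ ρ (fun j => (B j).map ψ) (ψ ∘ h) ↔
      IsTriangularSystem d P k₀ ρ B h := by
  have hmap : Function.Injective fun M : Matrix ι ι K => M.map ψ := map_injective ψ.injective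
  have hcomm : (∀ i j v, conn D (fun j => (B j).map ψ) i (conn D (fun j => (B j).map ψ) j v) =
      conn D (fun j => (B j).map ψ) j (conn D (fun j => (B j).map ψ) i v)) ↔
      ∀ i j v, conn d B i (conn d B j v) = conn d B j (conn d B i v) := by
    rw [conn_comm_iff hD, conn_comm_iff hd]
    refine forall₂_congr fun i j => ?_
    rw [← hmap.eq_iff]
    simp only [Matrix.map_add ψ (map_add ψ), Matrix.map_mul, Matrix.map_map]
    congr! 3 <;> ext <;> simp [hψ]
  have hproj : ∑ j, (ψ ∘ P) j • conn D (fun j => (B j).map ψ) j (ψ ∘ h) =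
      ψ ∘ ∑ j, P j • conn d B j h := by
    ext a
    simp [map_ringHom_conn ψ hψ]
  refine ⟨fun H => ⟨H.inj, fun j _ _ hab => ?_, hcomm.1 H.comm, ?_, ?_⟩,
    fun H => ⟨H.inj, fun j => (H.tri j).map ψ, hcomm.2 H.comm, ?_, ?_⟩⟩
  · exact (map_eq_zero ψ).1 (H.tri j hab)
  · ext a
    exact (map_eq_zero ψ).1 (congrFun (hproj.symm.trans H.proj) a)
  · rw [← linearIndependent_ringHom_comp_iff ψ]
    simpa only [map_ringHom_conn ψ hψ] using H.indep
  · rw [hproj, H.proj]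
    ext
    exact map_zero ψ
  · simpa only [map_ringHom_conn ψ hψ] using (linearIndependent_ringHom_comp_iff ψ).2 H.indep

/-- Data as in `IsTriangularSystem`, of some finite size, with entries in the subfield `S`. -/
def HasTriangularSystem {Ω : Type*} [Field Ω] (d : σ → Der Ω) (P : σ → Ω) (k₀ : σ)
    (S : Subfield Ω) : Prop :=
  ∃ (ι : Type) (_ : Fintype ι) (ρ : ι → ℕ) (B : σ → Matrix ι ι S) (h : ι → S),
    IsTriangularSystem d P k₀ ρ (fun j => (B j).map S.subtype) (S.subtype ∘ h)

theorem IsTriangularSystem.gauge [DecidableEq ι] (H : IsTriangularSystem d P k₀ ρ B h)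
    {T T' : Matrix ι ι K} (hT : T' * T = 1) (hTρ : T.BlockTriangular ρ)
    (hTρ' : T'.BlockTriangular ρ) :
    IsTriangularSystem d P k₀ ρ (fun j => T' * (B j * T + T.map (d j))) (T' *ᵥ h) := by
  have hT' : T * T' = 1 := mul_eq_one_comm.1 hT
  have hTT' (v : ι → K) : T *ᵥ (T' *ᵥ v) = v := by rw [mulVec_mulVec, hT', one_mulVec]
  have hinj : LinearMap.ker T'.mulVecLin = ⊥ := LinearMap.ker_eq_bot.2
    (Function.LeftInverse.injective hTT')
  refine ⟨H.inj, fun j => hTρ'.mul (((H.tri j).mul hTρ).add (hTρ.map (d j))), fun i j v => ?_, ?_,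
    ?_⟩
  · simp only [conn_gauge hT, hTT', H.comm i j]
  · simp only [conn_gauge hT, hTT', ← mulVec_smul, ← mulVec_sum, H.proj, mulVec_zero]
  · simp only [conn_gauge hT, hTT']
    exact H.indep.map' T'.mulVecLin hinj

theorem IsTriangularSystem.exists_transvection (H : IsTriangularSystem d P k₀ ρ B h) {l i : ι}
    (hli : ρ l < ρ i) (G : K) :
    ∃ B' h', IsTriangularSystem d P k₀ ρ B' h' ∧
      (∀ j a b, (b = i → ρ l < ρ a) → (a = l → ρ b < ρ i) → B' j a b = B j a b) ∧
      ∀ j, B' j l i = B j l i + d j G + (B j l l - B j i i) * G := by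
  classical
  have hne : l ≠ i := fun h0 => hli.ne (congrArg ρ h0)
  have hT : transvection l i (-G) * transvection l i G = 1 := by
    rw [transvection_mul_transvection_same _ _ hne, neg_add_cancel, transvection_zero]
  have hmap (j : σ) : (transvection l i G).map (d j) = single l i (d j G) := by
    ext a b
    simp only [transvection, map_apply, Matrix.add_apply, map_add, Matrix.one_apply,
      Matrix.single_apply]
    split_ifs <;> simp
  let M (j : σ) : Matrix ι ι K := B j * transvection l i G + single l i (d j G)
  have hM (j : σ) {a b : ι} (hb : b ≠ i) : M j a b = B j a b := by
    simp [M, hb, Matrix.single_apply_of_col_ne _ _ hb.symm]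
  have hMi (j : σ) {a : ι} (ha : a ≠ l) : M j a i = B j a i + G * B j a l := by
    simp [M, Matrix.single_apply_of_row_ne ha.symm]
  refine ⟨_, _, H.gauge hT (blockTriangular_transvection hli.le G)
    (blockTriangular_transvection hli.le (-G)), fun j a b hb ha => ?_, fun j => ?_⟩ <;>
    rw [hmap] <;> change (transvection l i (-G) * M j) _ _ = _
  · rcases eq_or_ne a l with rfl | hal
    · have hbi : b ≠ i := fun h0 => (ha rfl).ne (congrArg ρ h0)
      rw [transvection_mul_apply_same, hM j hbi, hM j hbi, H.tri j (ha rfl), mul_zero, add_zero]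
    · rw [transvection_mul_apply_of_ne _ _ _ _ hal]
      rcases eq_or_ne b i with rfl | hbi
      · rw [hMi j hal, H.tri j (hb rfl), mul_zero, add_zero]
      · exact hM j hbi
  · rw [transvection_mul_apply_same, hMi j hne.symm, H.tri j hli]
    simp only [M, Matrix.add_apply, mul_transvection_apply_same, single_apply_same]
    ring

end Triangular

theorem exists_nat_rank {κ : Type*} [Finite κ] {α : Type*} [LinearOrder α] (f : κ → α) :
    ∃ ρ : κ → ℕ, ∀ a b, ρ a < ρ b ↔ f a < f b := by
  classical
  cases nonempty_fintype κ
  refine ⟨fun a => (Finset.univ.filter fun b => f b < f a).card, fun a b => ⟨fun hab => ?_,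
    fun hab => Finset.card_lt_card ⟨fun c hc => ?_, fun hsub => ?_⟩⟩⟩
  · contrapose! hab
    exact Finset.card_le_card (Finset.monotone_filter_right _ fun c _ hc => hc.trans_le hab)
  · simpa using (by simpa using hc : f c < f a).trans hab
  · simpa using hsub (by simpa using hab : a ∈ _)

section Split

open HahnSeries

open scoped LaurentSeries

/-- Two basis vectors have the same irregular part when the corresponding diagonal entries differ by
power series. -/
def SameIrregularPart {F : Type*} [Field F] {σ ι : Type*} (B : σ → Matrix ι ι F⸨X⸩) (a b : ι) :
    Prop :=
  ∀ j, B j a a - B j b b ∈ ordGE F 0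

namespace SameIrregularPart

variable {F : Type*} [Field F] {σ ι : Type*} {B B' : σ → Matrix ι ι F⸨X⸩} {a b : ι}

theorem equivalence (B : σ → Matrix ι ι F⸨X⸩) : Equivalence (SameIrregularPart B) where
  refl a j := by
    rw [sub_self]
    exact zero_mem _
  symm hab j := by
    rw [← neg_sub]
    exact neg_mem (hab j)
  trans hab hbc j := by
    rw [← sub_add_sub_cancel]
    exact add_mem (hab j) (hbc j)

theorem congr_diag (hB : ∀ j, B' j a a = B j a a ∧ B' j b b = B j b b) :
    SameIrregularPart B' a b ↔ SameIrregularPart B a b :=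
  forall_congr' fun j => by rw [(hB j).1, (hB j).2]

end SameIrregularPart

/-- The order in which entries are eliminated: columns from left to right, and each column from
bottom to top. -/
def elimOrder {ι : Type*} (ρ : ι → ℕ) (p : ι × ι) : ℕ ×ₗ ℕᵒᵈ :=
  toLex (ρ p.2, OrderDual.toDual (ρ p.1))

theorem elimOrder_lt {ι : Type*} {ρ : ι → ℕ} {a b l i : ι} :
    elimOrder ρ (a, b) < elimOrder ρ (l, i) ↔ ρ b < ρ i ∨ ρ b = ρ i ∧ ρ l < ρ a :=
  Prod.Lex.toLex_lt_toLex

variable {F : Type*} [Field F] {σ : Type*} [Fintype σ] {d : σ → Der F} {γ : σ → F} {e : ℕ}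
  {ι : Type*} [Fintype ι] {P : σ → F⸨X⸩} {k₀ : σ} {ρ : ι → ℕ} {B : σ → Matrix ι ι F⸨X⸩}
  {h : ι → F⸨X⸩}

theorem IsTriangularSystem.exists_eliminate
    (hcomm : ∀ i j x, laurentDeriv (d i) (γ i) e (laurentDeriv (d j) (γ j) e x) =
      laurentDeriv (d j) (γ j) e (laurentDeriv (d i) (γ i) e x))
    (H : IsTriangularSystem (fun i => laurentDeriv (d i) (γ i) e) P k₀ ρ B h) {l i : ι}
    (hli : ρ l < ρ i) (hirr : ¬ SameIrregularPart B l i)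
    (hz : ∀ a b, elimOrder ρ (a, b) < elimOrder ρ (l, i) → ¬ SameIrregularPart B a b →
      ∀ j, B j a b = 0) :
    ∃ B' h', IsTriangularSystem (fun i => laurentDeriv (d i) (γ i) e) P k₀ ρ B' h' ∧
      (∀ j a, B' j a a = B j a a) ∧ (∀ j, B' j l i = 0) ∧
      ∀ j a b, elimOrder ρ (a, b) < elimOrder ρ (l, i) → B' j a b = B j a b := by
  have hne : l ≠ i := fun h0 => hli.ne (congrArg ρ h0)
  have hmul (j k : σ) : (B j * B k) l i = B j l l * B k l i + B j l i * B k i i := by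
    rw [Matrix.mul_apply, Fintype.sum_eq_add l i hne]
    intro c hc
    by_contra h0
    rw [← ne_eq, mul_ne_zero_iff] at h0
    have hlc : ρ l < ρ c := H.lt_of_ne_zero hc.1.symm h0.1
    have hci : ρ c < ρ i := H.lt_of_ne_zero hc.2 h0.2
    exact hirr ((SameIrregularPart.equivalence B).trans
      (not_imp_comm.1 (hz l c (elimOrder_lt.2 (.inl hci))) fun hB => h0.1 (hB j))
      (not_imp_comm.1 (hz c i (elimOrder_lt.2 (.inr ⟨rfl, hlc⟩))) fun hB => h0.2 (hB k)))
  obtain ⟨G, hG⟩ := exists_primitive_of_irregular hcomm (η := fun j => B j l l - B j i i)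
    (φ := fun j => -B j l i) (fun j k => by
      simp only [map_sub]
      rw [H.map_diag hcomm j k l, H.map_diag hcomm j k i]) (not_forall.1 hirr) fun j k => by
        have hflat := congrFun₂ ((conn_comm_iff hcomm).1 H.comm j k) l i
        simp only [Matrix.add_apply, Matrix.map_apply, hmul] at hflat
        simp only [map_neg]
        linear_combination -hflat
  obtain ⟨B', h', H', hB', hB'li⟩ := H.exists_transvection hli G
  refine ⟨B', h', H', fun j a => hB' j a a (fun h0 => h0 ▸ hli) fun h0 => h0 ▸ hli, fun j => ?_,
    fun j a b hab => hB' j a b ?_ ?_⟩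
  · rw [hB'li]
    linear_combination -hG j
  · rintro rfl
    exact ((elimOrder_lt.1 hab).resolve_left (lt_irrefl _)).2
  · rintro rfl
    exact (elimOrder_lt.1 hab).resolve_right fun h0 => lt_irrefl _ h0.2

theorem IsTriangularSystem.exists_split
    (hcomm : ∀ i j x, laurentDeriv (d i) (γ i) e (laurentDeriv (d j) (γ j) e x) =
      laurentDeriv (d j) (γ j) e (laurentDeriv (d i) (γ i) e x))
    (H : IsTriangularSystem (fun i => laurentDeriv (d i) (γ i) e) P k₀ ρ B h) :
    ∃ B' h', IsTriangularSystem (fun i => laurentDeriv (d i) (γ i) e) P k₀ ρ B' h' ∧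
      ∀ j a b, B' j a b ≠ 0 → SameIrregularPart B' a b := by
  obtain ⟨code, hcode⟩ := exists_nat_rank (elimOrder ρ)
  have key (m : ℕ) : ∃ B' h',
      IsTriangularSystem (fun i => laurentDeriv (d i) (γ i) e) P k₀ ρ B' h' ∧
      ∀ a b, code (a, b) < m → ¬ SameIrregularPart B' a b → ∀ j, B' j a b = 0 := by
    induction m with
    | zero => exact ⟨B, h, H, fun a b h0 => absurd h0 (Nat.not_lt_zero _)⟩
    | succ m ih =>
      obtain ⟨B', h', H', hz⟩ := ih
      by_cases hex : ∃ l i, code (l, i) = m ∧ ¬ SameIrregularPart B' l i ∧ ∃ j, B' j l i ≠ 0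
      swap
      · push Not at hex
        exact ⟨B', h', H', fun a b hab hr => (Nat.lt_succ_iff_lt_or_eq.1 hab).elim
          (fun hlt => hz a b hlt hr) fun heq => hex a b heq hr⟩
      obtain ⟨l, i, rfl, hr, j, hj⟩ := hex
      have hne : l ≠ i := fun h0 => hr (h0 ▸ (SameIrregularPart.equivalence B').refl l)
      obtain ⟨B₂, h₂, H₂, hdiag, hB₂, hlt⟩ := H'.exists_eliminate hcomm (H'.lt_of_ne_zero hne hj) hr
        fun a b hab => hz a b ((hcode _ _).2 hab)
      refine ⟨B₂, h₂, H₂, fun a b hab hr' j => ?_⟩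
      rw [SameIrregularPart.congr_diag fun j => ⟨hdiag j a, hdiag j b⟩] at hr'
      rcases Nat.lt_succ_iff_lt_or_eq.1 hab with hab' | hab'
      · rw [hlt j a b ((hcode _ _).1 hab'), hz a b hab' hr']
      · have hnlt := not_or.1 (mt elimOrder_lt.2 (mt (hcode _ _).2 hab'.not_lt))
        have hngt := not_or.1 (mt elimOrder_lt.2 (mt (hcode _ _).2 hab'.not_gt))
        have hb : b = i := H'.inj (by omega)
        have ha : a = l := H'.inj (by omega)
        rw [ha, hb, hB₂]
  obtain ⟨N, hN⟩ := (Set.finite_range code).bddAbove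
  obtain ⟨B', h', H', hz⟩ := key (N + 1)
  exact ⟨B', h', H', fun j a b h0 => not_imp_comm.1 (hz a b (Nat.lt_succ_of_le (hN ⟨_, rfl⟩)))
    fun hB => h0 (hB j)⟩

end Split

section SumElim

variable {K : Type*} [Field K] {ι J : Type*}

theorem sum_smul_sumElim_add_mul [Fintype J] (c : J → K) (u τ : J → ι → K)
    (h : ι → K) :
    ∑ j, c j • Sum.elim (u j + τ j * h) (Sum.elim (τ j) (0 : Unit → K)) =
      Sum.elim (∑ j, c j • u j + (∑ j, c j • τ j) * h) (Sum.elim (∑ j, c j • τ j) 0) := by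
  ext (a | a | a) <;> simp [mul_add, Finset.sum_add_distrib, Finset.sum_mul]

theorem linearIndependent_sumElim_add_mul [Finite J] {u : J → ι → K}
    (hu : LinearIndependent K u) (τ : J → ι → K) (h : ι → K) :
    LinearIndependent K fun j => Sum.elim (u j + τ j * h) (Sum.elim (τ j) (0 : Unit → K)) := by
  cases nonempty_fintype J
  rw [Fintype.linearIndependent_iff] at hu ⊢
  intro c hc
  rw [sum_smul_sumElim_add_mul] at hc
  have hcτ : ∑ j, c j • τ j = 0 := funext fun a => congrFun hc (.inr (.inl a))
  exact hu c (funext fun a => by simpa [hcτ] using congrFun hc (.inl a))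

theorem injective_sumElim_two_mul {ρ : ι → ℕ} (hρ : Function.Injective ρ) {R : ℕ}
    (hR : ∀ a, ρ a ≤ R) :
    Function.Injective (Sum.elim (fun a => 2 * ρ a)
      (Sum.elim (fun a => 2 * ρ a + 1) fun _ : Unit => 2 * R + 3)) := by
  refine .sumElim (fun a b hab => hρ (by simpa using hab)) (.sumElim (fun a b hab => hρ
    (by simpa using hab)) (Function.injective_of_subsingleton _) ?_) ?_
  · intro a _
    have := hR a
    omega
  · rintro a (b | b) <;> simp only [Sum.elim_inl, Sum.elim_inr] <;> omega

end SumElim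

section Twist

open Matrix

variable {K : Type*} [Field K] {σ : Type*} {ι κ : Type*} [Fintype ι] [Fintype κ]
  {d : σ → Der K} {P : σ → K} {k₀ : σ} {ρ : ι → ℕ} {B : σ → Matrix ι ι K} {h : ι → K}

theorem conn_fromBlocks (d : σ → Der K) (B : σ → Matrix ι ι K) (N : σ → Matrix κ κ K) (j : σ)
    (v : ι → K) (w : κ → K) :
    conn d (fun j => fromBlocks (B j) 0 0 (N j)) j (Sum.elim v w) =
      Sum.elim (conn d B j v) (conn d N j w) := by
  ext (a | a) <;> simp [conn_def, fromBlocks_mulVec]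

theorem conn_add_diagonal [DecidableEq ι] (d : σ → Der K) (B : σ → Matrix ι ι K) (τ : σ → ι → K)
    (j : σ) (v : ι → K) :
    conn d (fun j => B j + diagonal (τ j)) j v = conn d B j v + τ j * v := by
  ext a
  simp [conn_def, add_mulVec, mulVec_diagonal, add_assoc]

theorem conn_nilpotent (d : σ → Der K) (τ : σ → ι → K) (j : σ) :
    conn d (fun j => fromBlocks 0 (replicateCol Unit (τ j)) 0 0) j (Sum.elim 0 1) =
      Sum.elim (τ j) 0 := by
  ext (a | a) <;> simp [conn_def, fromBlocks_mulVec, mulVec, dotProduct]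

theorem flat_twist [DecidableEq ι] {B : σ → Matrix ι ι K} {τ : σ → ι → K}
    (hB : ∀ i j, (B j).map (d i) + B i * B j = (B i).map (d j) + B j * B i)
    (hτB : ∀ j a b, B j a b ≠ 0 → ∀ i, τ i a = τ i b) (hτ : ∀ i j, d i ∘ τ j = d j ∘ τ i)
    (i j : σ) :
    (B j + diagonal (τ j)).map (d i) + (B i + diagonal (τ i)) * (B j + diagonal (τ j)) =
      (B i + diagonal (τ i)).map (d j) + (B j + diagonal (τ j)) * (B i + diagonal (τ i)) := by
  have hdiag (i j : σ) : B j * diagonal (τ i) = diagonal (τ i) * B j := by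
    ext a b
    rw [mul_diagonal, diagonal_mul]
    by_cases h0 : B j a b = 0
    · rw [h0, zero_mul, mul_zero]
    · rw [hτB j a b h0 i, mul_comm]
  have hτij : diagonal (τ i) * diagonal (τ j) = diagonal (τ j) * diagonal (τ i) := by
    simp only [diagonal_mul_diagonal, mul_comm]
  rw [Matrix.map_add _ (map_add (d i)), Matrix.map_add _ (map_add (d j)),
    diagonal_map (map_zero (d i)), diagonal_map (map_zero (d j))]
  change (B j).map (d i) + diagonal (d i ∘ τ j) + _ = (B i).map (d j) + diagonal (d j ∘ τ i) + _
  rw [hτ i j, add_mul, add_mul, mul_add, mul_add, mul_add, mul_add, hdiag i j, hdiag j i, hτij]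
  rw [eq_sub_of_add_eq (hB i j)]
  abel

variable [Fintype σ]

theorem IsTriangularSystem.prune (H : IsTriangularSystem d P k₀ ρ B h) {p : ι → Prop}
    [DecidablePred p] (hp : ∀ j a b, B j a b ≠ 0 → p a → p b)
    (hh : ∀ a, ¬ p a → ∀ j, conn d B j h a = 0 ∧ h a = 0)
    (hd : ∀ i j a, d i (d j a) = d j (d i a)) :
    IsTriangularSystem d P k₀ ρ (fun j => of fun a b => if p a then B j a b else 0) h := by
  set B' : σ → Matrix ι ι K := fun j => of fun a b => if p a then B j a b else 0 with hB'
  have hpos {a : ι} (ha : p a) (j : σ) (v : ι → K) : conn d B' j v a = conn d B j v a := by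
    simp only [conn_apply, hB', of_apply, if_pos ha]
  have hneg {a : ι} (ha : ¬ p a) (j : σ) (v : ι → K) : conn d B' j v a = d j (v a) := by
    simp only [conn_apply, hB', of_apply, if_neg ha, zero_mul, Finset.sum_const_zero, add_zero]
  have hconn (j : σ) : conn d B' j h = conn d B j h := by
    ext a
    by_cases ha : p a
    · exact hpos ha j h
    · rw [hneg ha, (hh a ha j).1, (hh a ha j).2, map_zero]
  refine ⟨H.inj, fun j a b hab => ?_, fun i j v => funext fun a => ?_, ?_, ?_⟩
  · simp only [hB', of_apply, H.tri j hab, ite_self]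
  · by_cases ha : p a
    · have hstep (i j : σ) : conn d B i (conn d B' j v) a = conn d B i (conn d B j v) a :=
        conn_congr (hpos ha j v) fun c hc => hpos (hp i a c hc ha) j v
      rw [hpos ha, hpos ha, hstep, hstep, H.comm]
    · rw [hneg ha, hneg ha, hneg ha, hneg ha, hd]
  · simpa only [hconn] using H.proj
  · simpa only [hconn] using H.indep

/- The components of the new vector are those of `h`, a constant `1`, and zeros whose derivatives
are the entries of `τ`; the latter keep the derivatives of the vector independent. -/
theorem IsTriangularSystem.exists_twist [DecidableEq ι] (H : IsTriangularSystem d P k₀ ρ B h)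
    (hd : ∀ i j a, d i (d j a) = d j (d i a)) {τ : σ → ι → K}
    (hτB : ∀ j a b, B j a b ≠ 0 → ∀ i, τ i a = τ i b)
    (hτ : ∀ i j, d i ∘ τ j = d j ∘ τ i) (hPτ : ∑ j, P j • τ j = 0) :
    ∃ ρ' : ι ⊕ (ι ⊕ Unit) → ℕ, IsTriangularSystem d P k₀ ρ'
      (fun j => fromBlocks (B j + diagonal (τ j)) 0 0
        (fromBlocks 0 (replicateCol Unit (τ j)) 0 0)) (Sum.elim h (Sum.elim 0 1)) := by
  classical
  obtain ⟨R, hR⟩ := (Set.finite_range ρ).bddAbove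
  have hR (a : ι) : ρ a ≤ R := hR ⟨a, rfl⟩
  have hconn (j : σ) := (conn_fromBlocks d (fun j => B j + diagonal (τ j))
    (fun j => fromBlocks 0 (replicateCol Unit (τ j)) 0 0) j h (Sum.elim 0 1)).trans
    (congrArg₂ Sum.elim (conn_add_diagonal d B τ j h) (conn_nilpotent d τ j))
  refine ⟨Sum.elim (fun a => 2 * ρ a) (Sum.elim (fun a => 2 * ρ a + 1) fun _ => 2 * R + 3),
    injective_sumElim_two_mul H.inj hR, fun j => ?_, (conn_comm_iff hd).2 fun i j => ?_, ?_, ?_⟩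
  · rintro (a | a | a) (b | b | b) hab
    · have hab : ρ b < ρ a := by simpa using hab
      simp [H.tri j hab, diagonal_apply_ne _ fun h0 => hab.ne (congrArg ρ h0.symm)]
    all_goals simp
    have := hR a
    simp only [Sum.elim_inl, Sum.elim_inr] at hab
    omega
  · have hcol : (replicateCol Unit (τ j)).map (d i) = (replicateCol Unit (τ i)).map (d j) :=
      Matrix.ext fun a _ => congrFun (hτ i j) a
    simp [fromBlocks_map, fromBlocks_multiply, fromBlocks_add, hcol,
      flat_twist ((conn_comm_iff hd).1 H.comm) hτB hτ i j]
  · simp only [hconn, sum_smul_sumElim_add_mul]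
    simp [H.proj, hPτ]
  · simpa only [hconn] using linearIndependent_sumElim_add_mul H.indep (fun j => τ j) h

end Twist

section Regular

open HahnSeries Matrix

open scoped LaurentSeries

variable {F : Type*} [Field F] {σ : Type*} [Fintype σ] {d : σ → Der F} {γ : σ → F} {e : ℕ}
  {ι : Type*} [Fintype ι] {P : σ → F⸨X⸩} {k₀ : σ} {ρ : ι → ℕ} {B : σ → Matrix ι ι F⸨X⸩}
  {h : ι → F⸨X⸩}

theorem derivation_logDeriv_comm {K : Type*} [Field K] {D D' : Der K}
    (hD : ∀ x, D (D' x) = D' (D x)) (x : K) : D (D' x / x) = D' (D x / x) := by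
  simp only [div_eq_mul_inv, Der.map_mul, Der.map_inv, hD]
  ring

/- In the lowest row `p` of a block with `h p ≠ 0`, the equation `∑ Pⱼ ∇ⱼ h = 0` says that the
closed form `B p p + dlog (h p)` annihilates the vector field. -/
theorem IsTriangularSystem.exists_closed_form
    (hcomm : ∀ i j x, laurentDeriv (d i) (γ i) e (laurentDeriv (d j) (γ j) e x) =
      laurentDeriv (d j) (γ j) e (laurentDeriv (d i) (γ i) e x))
    (H : IsTriangularSystem (fun i => laurentDeriv (d i) (γ i) e) P k₀ ρ B h)
    (hsplit : ∀ j a b, B j a b ≠ 0 → SameIrregularPart B a b) {l : ι} (hl : h l ≠ 0) :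
    ∃ t : σ → F⸨X⸩,
      (∀ i j, laurentDeriv (d i) (γ i) e (t j) = laurentDeriv (d j) (γ j) e (t i)) ∧
      ∑ j, P j * t j = 0 ∧ ∀ a, SameIrregularPart B l a → ∀ j, B j a a + t j ∈ ordGE F 0 := by
  have hequiv := SameIrregularPart.equivalence B
  obtain ⟨p, ⟨hlp, hp⟩, hmax⟩ := Set.exists_max_image {a | SameIrregularPart B l a ∧ h a ≠ 0} ρ
    (Set.toFinite _) ⟨l, hequiv.refl l, hl⟩
  have hrow (j : σ) : conn (fun i => laurentDeriv (d i) (γ i) e) B j h p =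
      laurentDeriv (d j) (γ j) e (h p) + B j p p * h p := by
    rw [conn_apply, Fintype.sum_eq_single p]
    intro b hbp
    by_contra h0
    rw [← ne_eq, mul_ne_zero_iff] at h0
    exact (H.lt_of_ne_zero hbp.symm h0.1).not_ge
      (hmax b ⟨hequiv.trans hlp (hsplit j p b h0.1), h0.2⟩)
  refine ⟨fun j => -(B j p p + laurentDeriv (d j) (γ j) e (h p) / h p), fun i j => ?_, ?_,
    fun a hla j => ?_⟩
  · simp only [map_neg, map_add]
    rw [H.map_diag hcomm i j, derivation_logDeriv_comm (hcomm i j)]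
  · have hproj := congrFun H.proj p
    simp only [Finset.sum_apply, Pi.smul_apply, hrow, smul_eq_mul, Pi.zero_apply] at hproj
    have hscale : (∑ j, P j * -(B j p p + laurentDeriv (d j) (γ j) e (h p) / h p)) * h p = 0 := by
      rw [Finset.sum_mul, ← neg_eq_zero, ← Finset.sum_neg_distrib, ← hproj]
      refine Finset.sum_congr rfl fun j _ => ?_
      field_simp
      ring
    exact (mul_eq_zero.1 hscale).resolve_right hp
  · change B j a a + -(_ + _) ∈ _
    rw [neg_add, ← add_assoc, ← sub_eq_add_neg, ← sub_eq_add_neg]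
    exact sub_mem (hequiv.trans (hequiv.symm hla) hlp j) (logDeriv_mem_ordGE _ _ _ hp)

theorem IsTriangularSystem.exists_prune
    (hcomm : ∀ i j x, laurentDeriv (d i) (γ i) e (laurentDeriv (d j) (γ j) e x) =
      laurentDeriv (d j) (γ j) e (laurentDeriv (d i) (γ i) e x))
    (H : IsTriangularSystem (fun i => laurentDeriv (d i) (γ i) e) P k₀ ρ B h)
    (hsplit : ∀ j a b, B j a b ≠ 0 → SameIrregularPart B a b) :
    ∃ B', IsTriangularSystem (fun i => laurentDeriv (d i) (γ i) e) P k₀ ρ B' h ∧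
      (∀ j a b, B' j a b ≠ 0 → SameIrregularPart B' a b) ∧
      ∀ a, (∃ l, SameIrregularPart B' l a ∧ h l ≠ 0) ∨ ∀ j, B' j a a = 0 := by
  classical
  have hequiv := SameIrregularPart.equivalence B
  let p (a : ι) : Prop := ∃ l, SameIrregularPart B l a ∧ h l ≠ 0
  have hp {a b : ι} (hab : SameIrregularPart B a b) : p a → p b := fun ⟨l, hla, hl⟩ =>
    ⟨l, hequiv.trans hla hab, hl⟩
  have hp0 {a : ι} (ha : h a ≠ 0) : p a := ⟨a, hequiv.refl a, ha⟩
  have hsame {a b : ι} (ha : p a) (hab : SameIrregularPart B a b) :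
      SameIrregularPart (fun j => of fun a b => if p a then B j a b else 0) a b :=
    (SameIrregularPart.congr_diag fun _ => ⟨if_pos ha, if_pos (hp hab ha)⟩).2 hab
  refine ⟨_, H.prune (fun j a b hab => hp (hsplit j a b hab)) (fun a ha j => ⟨?_, ?_⟩) hcomm,
    fun j a b hab => ?_, fun a => ?_⟩
  · rw [conn_apply, not_imp_comm.1 hp0 ha, map_zero, zero_add]
    refine Finset.sum_eq_zero fun b _ => ?_
    by_contra h0
    rw [← ne_eq, mul_ne_zero_iff] at h0
    exact ha (hp (hequiv.symm (hsplit j a b h0.1)) (hp0 h0.2))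
  · exact not_imp_comm.1 hp0 ha
  · rw [of_apply, ite_ne_right_iff] at hab
    exact hsame hab.1 (hsplit j a b hab.2)
  · by_cases ha : p a
    · obtain ⟨l, hla, hl⟩ := ha
      exact .inl ⟨l, hsame (hp0 hl) hla, hl⟩
    · exact .inr fun j => if_neg ha

theorem IsTriangularSystem.exists_regular
    (hcomm : ∀ i j x, laurentDeriv (d i) (γ i) e (laurentDeriv (d j) (γ j) e x) =
      laurentDeriv (d j) (γ j) e (laurentDeriv (d i) (γ i) e x))
    (H : IsTriangularSystem (fun i => laurentDeriv (d i) (γ i) e) P k₀ ρ B h) :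
    ∃ (ρ' : ι ⊕ (ι ⊕ Unit) → ℕ) (B' : _) (h' : _),
      IsTriangularSystem (fun i => laurentDeriv (d i) (γ i) e) P k₀ ρ' B' h' ∧
        ∀ j a, B' j a a ∈ ordGE F 0 := by
  classical
  obtain ⟨B, h, H, hsplit⟩ := H.exists_split hcomm
  obtain ⟨B, H, hsplit, hsupp⟩ := H.exists_prune hcomm hsplit
  let s : Setoid ι := ⟨_, SameIrregularPart.equivalence B⟩
  have hform (q : Quotient s) : ∃ t : σ → F⸨X⸩,
      (∀ i j, laurentDeriv (d i) (γ i) e (t j) = laurentDeriv (d j) (γ j) e (t i)) ∧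
      ∑ j, P j * t j = 0 ∧ ∀ a, ⟦a⟧ = q → ∀ j, B j a a + t j ∈ ordGE F 0 := by
    by_cases hq : ∃ l, ⟦l⟧ = q ∧ h l ≠ 0
    · obtain ⟨l, rfl, hl⟩ := hq
      obtain ⟨t, hclosed, hPt, hreg⟩ := H.exists_closed_form hcomm hsplit hl
      exact ⟨t, hclosed, hPt, fun a ha => hreg a (Quotient.exact ha.symm)⟩
    · refine ⟨0, fun i j => by simp, by simp, ?_⟩
      rintro a rfl j
      rw [(hsupp a).resolve_left (fun ⟨l, hla, hl⟩ => hq ⟨l, Quotient.sound hla, hl⟩) j]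
      simp
  choose t hclosed hPt hreg using hform
  obtain ⟨ρ', H'⟩ := H.exists_twist hcomm (τ := fun j a => t ⟦a⟧ j)
    (fun j a b hab i => congrArg (t · i) (Quotient.sound (hsplit j a b hab)))
    (fun i j => funext fun a => hclosed _ i j) (funext fun a => by simpa using hPt ⟦a⟧)
  refine ⟨ρ', _, _, H', ?_⟩
  rintro j (a | _ | _)
  · simpa using hreg ⟦a⟧ a rfl j
  all_goals simp

end Regular

section Truncation

open HahnSeries Matrix

open scoped LaurentSeries

variable {F : Type*} [Field F] {ι : Type*} {w : ι → ℤ} {m : ℤ} {K : ℕ} {v : ι → F⸨X⸩}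

/-- The vectors of Laurent series whose component at `a` has no term of degree less than
`w a + m`. -/
def lattice (F : Type*) [Field F] (w : ι → ℤ) (m : ℤ) : AddSubgroup (ι → F⸨X⸩) :=
  AddSubgroup.pi Set.univ fun a => ordGE F (w a + m)

theorem mem_lattice : v ∈ lattice F w m ↔ ∀ a, v a ∈ ordGE F (w a + m) := by
  simp [lattice, AddSubgroup.mem_pi]

theorem C_smul_mem_lattice (c : F) (hv : v ∈ lattice F w m) : (C c : F⸨X⸩) • v ∈ lattice F w m :=
  mem_lattice.2 fun a => by simpa using mul_mem_ordGE (C_mem_ordGE c) (mem_lattice.1 hv a)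

/-- The first `K` coefficients, starting in degree `w a`, of each component of a vector. -/
def truncation (F : Type*) [Field F] (w : ι → ℤ) (K : ℕ) : (ι → F⸨X⸩) →+ (ι × Fin K → F) where
  toFun v a := (v a.1).coeff (w a.1 + a.2)
  map_zero' := rfl
  map_add' _ _ := rfl

/-- The vector of Laurent polynomials with given coefficients, a section of `truncation`. -/
noncomputable def ofCoeffs (w : ι → ℤ) (K : ℕ) : (ι × Fin K → F) →+ (ι → F⸨X⸩) where
  toFun v a := ∑ m : Fin K, single (w a + m) (v (a, m))
  map_zero' := by
    ext a
    simp
  map_add' v v' := by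
    ext1 a
    simp [Finset.sum_add_distrib]

theorem truncation_apply (v : ι → F⸨X⸩) (a : ι) (m : Fin K) :
    truncation F w K v (a, m) = (v a).coeff (w a + m) := rfl

theorem ofCoeffs_apply (v : ι × Fin K → F) (a : ι) :
    ofCoeffs w K v a = ∑ m : Fin K, single (w a + m) (v (a, m)) := rfl

theorem truncation_ofCoeffs (v : ι × Fin K → F) : truncation F w K (ofCoeffs w K v) = v := by
  ext ⟨a, m⟩
  rw [truncation_apply, ofCoeffs_apply, coeff_sum, Fintype.sum_eq_single m, coeff_single_same]
  exact fun m' hm => coeff_single_of_ne fun h0 => hm (Fin.ext (by omega))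

theorem ofCoeffs_mem_lattice (v : ι × Fin K → F) : ofCoeffs w K v ∈ lattice F w 0 :=
  mem_lattice.2 fun _ => sum_mem fun _ _ => ordGE_antitone (by omega) (single_mem_ordGE _ _)

theorem truncation_smul (c : F) (v : ι → F⸨X⸩) :
    truncation F w K ((C c : F⸨X⸩) • v) = c • truncation F w K v := by
  ext ⟨a, m⟩
  simp [truncation_apply]

theorem ofCoeffs_smul (c : F) (v : ι × Fin K → F) :
    ofCoeffs w K (c • v) = (C c : F⸨X⸩) • ofCoeffs w K v := by
  ext1 a
  simp [ofCoeffs_apply, Finset.mul_sum, C_apply, single_mul_single]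

theorem ofCoeffs_single [DecidableEq ι] (b : ι) (m : Fin K) :
    ofCoeffs w K (Pi.single (b, m) (1 : F)) = (single (w b + m) 1 : F⸨X⸩) • Pi.single b 1 := by
  ext1 c
  rw [ofCoeffs_apply, Fintype.sum_eq_single m fun m' hm' => by
    rw [Pi.single_eq_of_ne (by simp [hm']), single_eq_zero]]
  rcases eq_or_ne c b with rfl | hcb
  · simp
  · simp [hcb]

theorem truncation_eq_zero_of_mem (hv : v ∈ lattice F w K) : truncation F w K v = 0 := by
  ext ⟨a, m⟩
  exact mem_lattice.1 hv a _ (by simp)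

theorem mem_lattice_of_truncation_eq_zero (hv : v ∈ lattice F w 0)
    (h0 : truncation F w K v = 0) : v ∈ lattice F w K := by
  refine mem_lattice.2 fun a k hk => ?_
  rcases lt_or_ge k (w a) with hlt | hge
  · exact mem_lattice.1 hv a k (by omega)
  · obtain ⟨m, rfl⟩ := Int.le.dest hge
    exact congrFun h0 (a, ⟨m, by omega⟩)

theorem exists_linearIndependent_truncation [Finite ι] {J : Type*} [Finite J] {u : J → ι → F⸨X⸩}
    (hu : LinearIndependent F⸨X⸩ u) (hw : ∀ j, u j ∈ lattice F w 0) :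
    ∃ K : ℕ, LinearIndependent F fun j => truncation F w K (u j) := by
  classical
  cases nonempty_fintype J
  cases nonempty_fintype ι
  obtain ⟨A, hA⟩ := exists_mul_eq_one_of_linearIndependent_row (A := of u) hu
  obtain ⟨c, -, hc⟩ := exists_nonpos_forall_mem_ordGE fun x : ι × J => A x.1 x.2
  obtain ⟨b, hb⟩ := (Set.finite_range w).bddBelow
  refine ⟨(1 - (b + c)).toNat, Fintype.linearIndependent_iff.2 fun z hz j => ?_⟩
  set K := (1 - (b + c)).toNat
  have hmem : ∑ j, (C (z j) : F⸨X⸩) • u j ∈ lattice F w K :=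
    mem_lattice_of_truncation_eq_zero (sum_mem fun j _ => C_smul_mem_lattice _ (hw j))
      (by simpa only [map_sum, truncation_smul] using hz)
  have hzA : (∑ j, (C (z j) : F⸨X⸩) • u j) ᵥ* A = fun j => C (z j) := by
    change _ = (C ∘ z : J → F⸨X⸩)
    rw [← vecMul_one (C ∘ z), ← hA, ← vecMul_vecMul, vecMul_eq_sum (C ∘ z)]
    rfl
  have hzj : C (z j) ∈ ordGE F 1 := by
    rw [← congrFun hzA j]
    refine sum_mem fun a _ => ordGE_antitone ?_ (mul_mem_ordGE (mem_lattice.1 hmem a) (hc (a, j)))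
    have hba : b ≤ w a := hb ⟨a, rfl⟩
    omega
  simpa using hzj 0 one_pos

variable {σ : Type*} {d : σ → Der F} {γ : σ → F} {e : ℕ} [Fintype ι] {B : σ → Matrix ι ι F⸨X⸩}

/-- The operators that a connection induces on truncated vectors. -/
noncomputable def truncConn (D : σ → Der F⸨X⸩) (B : σ → Matrix ι ι F⸨X⸩) (w : ι → ℤ) (K : ℕ)
    (j : σ) : (ι × Fin K → F) →+ (ι × Fin K → F) :=
  (truncation F w K).comp ((conn D B j).comp (ofCoeffs w K))

theorem truncConn_apply (D : σ → Der F⸨X⸩) (B : σ → Matrix ι ι F⸨X⸩) (j : σ) (v : ι × Fin K → F) :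
    truncConn D B w K j v = truncation F w K (conn D B j (ofCoeffs w K v)) := rfl

theorem truncConn_smul (j : σ) (c : F) (v : ι × Fin K → F) :
    truncConn (fun i => laurentDeriv (d i) (γ i) e) B w K j (c • v) =
      d j c • v + c • truncConn (fun i => laurentDeriv (d i) (γ i) e) B w K j v := by
  rw [truncConn_apply, ofCoeffs_smul, conn_smul, map_add, truncation_smul, laurentDeriv_C,
    truncation_smul, truncation_ofCoeffs, truncConn_apply]

theorem truncConn_truncation {D : σ → Der F⸨X⸩}
    (hstable : ∀ j m, ∀ v ∈ lattice F w m, conn D B j v ∈ lattice F w m) (j : σ)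
    (hv : v ∈ lattice F w 0) :
    truncConn D B w K j (truncation F w K v) = truncation F w K (conn D B j v) := by
  have hdiff : ofCoeffs w K (truncation F w K v) - v ∈ lattice F w K :=
    mem_lattice_of_truncation_eq_zero (sub_mem (ofCoeffs_mem_lattice _) hv)
      (by rw [map_sub, truncation_ofCoeffs, sub_self])
  rw [truncConn_apply, ← sub_eq_zero, ← map_sub, ← map_sub]
  exact truncation_eq_zero_of_mem (hstable j _ _ hdiff)

theorem truncConn_comm {D : σ → Der F⸨X⸩}
    (hstable : ∀ j m, ∀ v ∈ lattice F w m, conn D B j v ∈ lattice F w m)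
    (hcomm : ∀ i j v, conn D B i (conn D B j v) = conn D B j (conn D B i v)) (i j : σ)
    (v : ι × Fin K → F) :
    truncConn D B w K i (truncConn D B w K j v) = truncConn D B w K j (truncConn D B w K i v) := by
  have htwo (i j : σ) : truncConn D B w K i (truncConn D B w K j v) =
      truncation F w K (conn D B i (conn D B j (ofCoeffs w K v))) := by
    rw [truncConn_apply D B j,
      truncConn_truncation hstable i (hstable j 0 _ (ofCoeffs_mem_lattice v))]
  rw [htwo i j, htwo j i, hcomm]

theorem truncConn_single_eq_zero [DecidableEq ι] {D : σ → Der F⸨X⸩} {ρ : ι → ℕ}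
    (hstable : ∀ j m, ∀ v ∈ lattice F w m, conn D B j v ∈ lattice F w m)
    (hB : ∀ j, (B j).BlockTriangular ρ) (j : σ) {a b : ι} {m m' : Fin K}
    (h : m < m' ∨ ρ b < ρ a) : truncConn D B w K j (Pi.single (b, m') 1) (a, m) = 0 := by
  rw [truncConn_apply, ofCoeffs_single, truncation_apply]
  rcases h with hm | hρ
  · have hmem : (single (w b + m') (1 : F) : F⸨X⸩) • Pi.single b 1 ∈ lattice F w m' := by
      refine mem_lattice.2 fun c => ?_
      rcases eq_or_ne c b with rfl | hcb
      · simpa using single_mem_ordGE (w c + m') (1 : F)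
      · simp [hcb]
    exact mem_lattice.1 (hstable j _ _ hmem) a _ (by simpa using hm)
  · have hab : a ≠ b := fun h0 => hρ.ne (congrArg ρ h0.symm)
    rw [conn_smul, Pi.add_apply, Pi.smul_apply, Pi.smul_apply, conn_single, hB j hρ,
      Pi.single_eq_of_ne hab, smul_zero, smul_zero, add_zero, coeff_zero]

variable [Fintype σ] {k₀ : σ} {ρ : ι → ℕ} {h : ι → F⸨X⸩}

theorem IsTriangularSystem.exists_stable_lattice {P : σ → F⸨X⸩}
    (H : IsTriangularSystem (fun i => laurentDeriv (d i) (γ i) e) P k₀ ρ B h)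
    (hreg : ∀ j a, B j a a ∈ ordGE F 0) :
    ∃ w : ι → ℤ, h ∈ lattice F w 0 ∧ ∀ j m, ∀ v ∈ lattice F w m,
      conn (fun i => laurentDeriv (d i) (γ i) e) B j v ∈ lattice F w m := by
  obtain ⟨R, hR⟩ := (Set.finite_range ρ).bddAbove
  obtain ⟨c₁, hc₁, hB⟩ := exists_nonpos_forall_mem_ordGE fun x : σ × ι × ι => B x.1 x.2.1 x.2.2
  obtain ⟨c₂, -, hh⟩ := exists_nonpos_forall_mem_ordGE h
  refine ⟨fun a => c₂ + c₁ * (R - ρ a), mem_lattice.2 fun a => ordGE_antitone ?_ (hh a),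
    fun j m v hv => mem_lattice.2 fun a => ?_⟩
  · have hRa : (ρ a : ℤ) ≤ R := by exact_mod_cast hR ⟨a, rfl⟩
    linarith [mul_nonpos_of_nonpos_of_nonneg hc₁ (sub_nonneg.2 hRa)]
  · rw [mem_lattice] at hv
    refine add_mem (laurentDeriv_mem_ordGE _ _ _ (hv a)) (sum_mem fun b _ => ?_)
    change B j a b * v b ∈ _
    rcases eq_or_ne a b with rfl | hab
    · simpa using mul_mem_ordGE (hreg j a) (hv a)
    by_cases h0 : B j a b = 0
    · rw [h0, zero_mul]
      exact zero_mem _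
    · have hρ : (ρ a : ℤ) + 1 ≤ ρ b := by exact_mod_cast H.lt_of_ne_zero hab h0
      refine ordGE_antitone ?_ (mul_mem_ordGE (hB (j, a, b)) (hv b))
      linarith [mul_le_mul_of_nonpos_left hρ hc₁]

theorem IsTriangularSystem.exists_truncate {P : σ → F}
    (H : IsTriangularSystem (fun i => laurentDeriv (d i) (γ i) e) (C ∘ P) k₀ ρ B h)
    (hreg : ∀ j a, B j a a ∈ ordGE F 0) :
    ∃ (K : ℕ) (ρ' : ι × Fin K → ℕ) (B' : _) (h' : _), IsTriangularSystem d P k₀ ρ' B' h' := by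
  classical
  obtain ⟨w, hh, hstable⟩ := H.exists_stable_lattice hreg
  obtain ⟨K, hK⟩ := exists_linearIndependent_truncation H.indep fun j => hstable j 0 h hh
  obtain ⟨ρ', hρ'⟩ := exists_nat_rank fun a : ι × Fin K => toLex (OrderDual.toDual a.2, ρ a.1)
  refine ⟨K, ρ', _, truncation F w K h, IsTriangularSystem.of_leibniz truncConn_smul ?_
    (fun j a b hab => ?_) (truncConn_comm hstable H.comm) ?_ ?_⟩
  · have hinj : Function.Injective
        fun a : ι × Fin K => toLex (OrderDual.toDual a.2, ρ a.1) := fun a b hab => by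
      simp only [toLex_inj, Prod.mk.injEq, OrderDual.toDual_inj] at hab
      exact Prod.ext (H.inj hab.2) hab.1
    exact fun a b hab => hinj (le_antisymm (not_lt.1 fun hlt => ((hρ' b a).2 hlt).ne' hab)
      (not_lt.1 fun hlt => ((hρ' a b).2 hlt).ne hab))
  · exact truncConn_single_eq_zero hstable H.tri j
      ((Prod.Lex.toLex_lt_toLex.1 ((hρ' b a).1 hab)).imp_right And.right)
  · have hproj := congrArg (truncation F w K) H.proj
    simpa only [map_sum, truncation_smul, Function.comp_apply, map_zero,
      ← truncConn_truncation hstable _ hh] using hproj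
  · simpa only [truncConn_truncation hstable _ hh] using hK

end Truncation

section Descent

variable {Ω : Type*} [Field Ω] [CharZero Ω] [IsAlgClosed Ω] {σ : Type*} [Fintype σ]
  {d : σ → Der Ω} {P : σ → Ω} {k₀ : σ}

open scoped IntermediateField in
theorem HasTriangularSystem.descend (hd : ∀ i j a, d i (d j a) = d j (d i a)) {S : Subfield Ω}
    (hS : IsStable d S) (hSc : ∀ x : Ω, IsAlgebraic S x → x ∈ S) {t : Ω} (ht : Transcendental S t)
    (htS : (∀ i, d i t ∈ S) ∨ (∀ i, d i t / t ∈ S)) (hP : ∀ j, P j ∈ S)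
    (H : HasTriangularSystem d P k₀ (algClosure S⟮t⟯.toSubfield)) :
    HasTriangularSystem d P k₀ S := by
  obtain ⟨ι, _, ρ, B, h, H⟩ := H
  obtain ⟨γ, e, hγ, T, hST, hT, ψ, hZ, hψS, hψ⟩ := exists_laurent_embedding hd hS hSc ht htS
    (Z := Set.range (fun x : σ × ι × ι => (B x.1 x.2.1 x.2.2 : Ω)) ∪ Set.range fun a => (h a : Ω))
    ((Set.finite_range _).union (Set.finite_range _)) (by
      rintro _ (⟨x, rfl⟩ | ⟨a, rfl⟩)
      exacts [mem_algClosure.1 (B x.1 x.2.1 x.2.2).2, mem_algClosure.1 (h a).2])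
  let B' (j : σ) : Matrix ι ι T := .of fun a b => ⟨B j a b, hZ (.inl ⟨(j, a, b), rfl⟩)⟩
  let h' (a : ι) : T := ⟨h a, hZ (.inr ⟨a, rfl⟩)⟩
  let P' (j : σ) : S := ⟨P j, hP j⟩
  have hdT (i j : σ) (a : T) : (d i).restrict T (hT i) ((d j).restrict T (hT j) a) =
      (d j).restrict T (hT j) ((d i).restrict T (hT i) a) := Subtype.ext (hd i j a)
  have hdS (i j : σ) (a : S) : (d i).restrict S (hS i) ((d j).restrict S (hS j) a) =
      (d j).restrict S (hS j) ((d i).restrict S (hS i) a) := Subtype.ext (hd i j a)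
  have hcomm (i j : σ) := laurentDeriv_comm e (hdS i j) (hγ i j)
  have HT : IsTriangularSystem _ (fun j => ⟨P j, hST (hP j)⟩) k₀ ρ B' h' :=
    (isTriangularSystem_map_iff hdT hd T.subtype fun _ _ => rfl).1 H
  have HX := (isTriangularSystem_map_iff hdT hcomm ψ hψ).2 HT
  obtain ⟨ρ₁, B₁, h₁, HX₁, hreg⟩ := HX.exists_regular hcomm
  have hψP : ψ ∘ (fun j => (⟨P j, hST (hP j)⟩ : T)) = HahnSeries.C ∘ P' :=
    funext fun j => hψS (P' j)
  rw [hψP] at HX₁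
  obtain ⟨K, ρ₂, B₂, h₂, HS⟩ := HX₁.exists_truncate hreg
  exact ⟨_, inferInstance, ρ₂, B₂, h₂,
    (isTriangularSystem_map_iff hdS hd S.subtype fun _ _ => rfl).2 HS⟩

end Descent

section Determinant

open Matrix

variable {K : Type*} [Field K] {J : Type*} [Fintype J] [DecidableEq J]

theorem Der.map_prod {κ : Type*} [DecidableEq κ] (D : Der K) (s : Finset κ) (f : κ → K) :
    D (∏ i ∈ s, f i) = ∑ i ∈ s, D (f i) * ∏ j ∈ s.erase i, f j := by
  induction s using Finset.induction_on with
  | empty => rw [Finset.prod_empty, Finset.sum_empty, D.map_one_eq_zero]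
  | insert a s ha ih =>
    rw [Finset.prod_insert ha, Finset.sum_insert ha, Der.map_mul, ih, Finset.erase_insert ha,
      Finset.mul_sum, add_comm, mul_comm (∏ i ∈ s, f i)]
    congr 1
    refine Finset.sum_congr rfl fun i hi => ?_
    rw [Finset.erase_insert_of_ne (ne_of_mem_of_not_mem hi ha).symm,
      Finset.prod_insert fun h => ha (Finset.mem_of_mem_erase h)]
    ring

theorem vecMul_adjugate_apply (M : Matrix J J K) (r : J → K) (k : J) :
    (r ᵥ* M.adjugate) k = (M.updateRow k r).det := by
  rw [← mulVec_transpose, adjugate_transpose, ← cramer_eq_adjugate_mulVec, cramer_transpose_apply]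

theorem Der.map_det (D : Der K) (M : Matrix J J K) :
    D M.det = (M.map D * M.adjugate).trace := by
  have hdet (N : Matrix J J K) : N.det = ∑ π : Equiv.Perm J, Equiv.Perm.sign π * ∏ i, N i (π i) :=
    by rw [← det_transpose, det_apply']; rfl
  have hrow (k : J) : (M.map D * M.adjugate) k k = (M.updateRow k (D ∘ M k)).det :=
    vecMul_adjugate_apply M (D ∘ M k) k
  simp only [trace, diag_apply, hrow]
  simp only [hdet, map_sum]
  rw [Finset.sum_comm]
  refine Finset.sum_congr rfl fun π _ => ?_
  rw [Der.map_mul, Derivation.map_intCast, mul_zero, add_zero, Der.map_prod, Finset.mul_sum]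
  refine Finset.sum_congr rfl fun k _ => ?_
  rw [← Finset.mul_prod_erase _ _ (Finset.mem_univ k), updateRow_self]
  congr 2
  refine Finset.prod_congr rfl fun i hi => ?_
  rw [updateRow_ne (Finset.ne_of_mem_erase hi)]

variable {ι : Type*} [Fintype ι]

theorem exists_det_submatrix_ne_zero {A : Matrix ι J K} {C : Matrix J ι K} (hCA : C * A = 1) :
    ∃ s : J → ι, (A.submatrix s id).det ≠ 0 := by
  classical
  by_contra! hA
  have hrows : (1 : Matrix J J K) = fun j => ∑ a, C j a • A a := by
    rw [← hCA]
    ext j l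
    simp [mul_apply]
  have hdet : (1 : Matrix J J K).det = 0 := by
    rw [hrows]
    refine ((detRowAlternating (R := K)).toMultilinearMap.map_sum fun j a => C j a • A a).trans
      (Finset.sum_eq_zero fun s _ => ?_)
    rw [MultilinearMap.map_smul_univ]
    exact smul_eq_zero_of_right _ (hA s)
  rw [det_one] at hdet
  exact one_ne_zero hdet

theorem exists_maximal_minor {A : Matrix ι J K} {C : Matrix J ι K} (hCA : C * A = 1) (ρ : ι → ℕ) :
    ∃ s : J → ι, (A.submatrix s id).det ≠ 0 ∧
      ∀ k b, ρ (s k) < ρ b → ((A.submatrix s id).updateRow k (A b)).det = 0 := by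
  classical
  obtain ⟨s₀, hs₀⟩ := exists_det_submatrix_ne_zero hCA
  obtain ⟨s, hs, hmax⟩ := Finset.exists_max_image
    (Finset.univ.filter fun s : J → ι => (A.submatrix s id).det ≠ 0)
    (fun s => ∑ j, ρ (s j)) ⟨s₀, Finset.mem_filter.2 ⟨Finset.mem_univ _, hs₀⟩⟩
  refine ⟨s, (Finset.mem_filter.1 hs).2, fun k b hb => by_contra fun h0 => ?_⟩
  have hupdate : A.submatrix (Function.update s k b) id = (A.submatrix s id).updateRow k (A b) := by
    ext j l
    rcases eq_or_ne j k with rfl | hj <;> simp [*]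
  have hs' := hmax (Function.update s k b)
    (Finset.mem_filter.2 ⟨Finset.mem_univ _, hupdate.symm ▸ h0⟩)
  refine hs'.not_gt (Finset.sum_lt_sum (fun j _ => ?_) ⟨k, Finset.mem_univ k, ?_⟩)
  · rcases eq_or_ne j k with rfl | hj
    · rw [Function.update_self]
      exact hb.le
    · rw [Function.update_of_ne hj]
  · rwa [Function.update_self]

/- For a minor `Q` on rows `s` maximizing `∑ ρ (s k)`, replacing row `s k` by a row of larger `ρ`
kills the determinant, so a triangular `β` acts on `det Q` through its diagonal only. -/
theorem exists_map_det_submatrix {ρ : ι → ℕ} (hρ : Function.Injective ρ) {A : Matrix ι J K}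
    {C : Matrix J ι K} (hCA : C * A = 1) (D : Der K) {β : Matrix ι ι K} {N : Matrix J J K}
    (hβ : β.BlockTriangular ρ) (hA : A.map D + β * A = -(A * N)) :
    ∃ s : J → ι, (A.submatrix s id).det ≠ 0 ∧
      D (A.submatrix s id).det =
        -(∑ k, β (s k) (s k) + N.trace) * (A.submatrix s id).det := by
  obtain ⟨s, hs, hmax⟩ := exists_maximal_minor hCA ρ
  refine ⟨s, hs, ?_⟩
  set Q := A.submatrix s id
  have hQ : Q.map D + (β * A).submatrix s id = -(Q * N) := congrArg (·.submatrix s id) hA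
  have hβtrace : ((β * A).submatrix s id * Q.adjugate).trace = (∑ k, β (s k) (s k)) * Q.det := by
    rw [trace, Finset.sum_mul]
    refine Finset.sum_congr rfl fun k _ => ?_
    have hrow : ((β * A).submatrix s id * Q.adjugate) k k =
        ∑ b, β (s k) b * (Q.updateRow k (A b)).det := by
      simp only [← vecMul_adjugate_apply]
      exact congrFun₂ (Matrix.mul_assoc β A Q.adjugate) (s k) k
    rw [diag_apply, hrow, Fintype.sum_eq_single (s k)]
    · rw [show A (s k) = Q k from rfl, updateRow_eq_self]
    · intro b hb
      rcases lt_or_gt_of_ne (hρ.ne hb) with hlt | hlt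
      · rw [hβ hlt, zero_mul]
      · rw [hmax k b hlt, mul_zero]
  have hNtrace : (Q * N * Q.adjugate).trace = N.trace * Q.det := by
    rw [trace_mul_comm, ← Matrix.mul_assoc, adjugate_mul, smul_mul, Matrix.one_mul, trace_smul,
      smul_eq_mul, mul_comm]
  rw [Der.map_det, eq_sub_of_add_eq hQ, Matrix.sub_mul, Matrix.neg_mul, trace_sub, trace_neg,
    hβtrace, hNtrace]
  ring

end Determinant

section Divergence

open Matrix

variable {K : Type*} [Field K] {σ : Type*} [Fintype σ] {ι : Type*} [Fintype ι]
  {d : σ → Der K} {P : σ → K} {k₀ : σ} {ρ : ι → ℕ} {B : σ → Matrix ι ι K} {h : ι → K}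

theorem IsTriangularSystem.smul (H : IsTriangularSystem d P k₀ ρ B h) (c : K) :
    IsTriangularSystem d (c • P) k₀ ρ B h where
  __ := H
  proj := by simp only [Pi.smul_apply, smul_assoc, ← Finset.smul_sum, H.proj, smul_zero]

theorem IsTriangularSystem.sum_smul_conn_conn (H : IsTriangularSystem d P k₀ ρ B h) (j : σ) :
    ∑ i, P i • conn d B i (conn d B j h) = -∑ i, d j (P i) • conn d B i h := by
  have hproj := congrArg (conn d B j) H.proj
  simp only [map_sum, map_zero, conn_smul, Finset.sum_add_distrib] at hproj
  simp only [H.comm _ j]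
  exact eq_neg_of_add_eq_zero_right hproj

theorem sum_smul_derivation_apply (d : σ → Der K) (P : σ → K) (x : K) :
    (∑ i, P i • d i) x = ∑ i, P i * d i x :=
  (congrFun (map_sum (Derivation.coeFnAddMonoidHom : Der K →+ K → K) _ _) x).trans
    (Finset.sum_apply _ _ _)

theorem IsTriangularSystem.map_add_mul_eq_neg_mul [DecidableEq σ]
    (H : IsTriangularSystem d P k₀ ρ B h) (hP : ∀ j, d j (P k₀) = 0)
    {A : Matrix ι {j // j ≠ k₀} K}
    (hA : A = of fun a (j : {j // j ≠ k₀}) => conn d B j h a) :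
    A.map (∑ i, P i • d i : Der K) + (∑ i, P i • B i) * A =
      -(A * of fun (i j : {j // j ≠ k₀}) => d j (P i)) := by
  subst hA
  set A : Matrix ι {j // j ≠ k₀} K := of fun a j => conn d B j h a
  ext a j
  have hj := congrFun (H.sum_smul_conn_conn j) a
  rw [Fintype.sum_eq_add_sum_subtype_ne (fun i => d j (P i) • conn d B i h) k₀, hP, zero_smul,
    zero_add] at hj
  have hβA : ((∑ i, P i • B i) * A) a j = ∑ i, P i * (B i * A) a j := by
    simp only [Matrix.sum_mul, Matrix.sum_apply, smul_mul, Matrix.smul_apply, smul_eq_mul]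
  have hconn (i : σ) : conn d B i (conn d B j h) a = d i (A a j) + (B i * A) a j := rfl
  simp only [Finset.sum_apply, Pi.neg_apply, Pi.smul_apply, smul_eq_mul, hconn, mul_add,
    Finset.sum_add_distrib] at hj
  rw [Matrix.add_apply, map_apply, sum_smul_derivation_apply, hβA, hj, Matrix.neg_apply, mul_apply]
  exact congrArg Neg.neg (Finset.sum_congr rfl fun _ _ => mul_comm _ _)

theorem IsTriangularSystem.exists_form_of_eq_one (H : IsTriangularSystem d P k₀ ρ B h)
    (hd : ∀ i j a, d i (d j a) = d j (d i a)) (hP : P k₀ = 1) :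
    ∃ α : σ → K, (∀ i j, d i (α j) = d j (α i)) ∧ ∑ j, P j * α j = -∑ j, d j (P j) := by
  classical
  let J := {j : σ // j ≠ k₀}
  let A : Matrix ι J K := of fun a j => conn d B j h a
  have hdP (j : σ) : d j (P k₀) = 0 := by rw [hP, (d j).map_one_eq_zero]
  obtain ⟨C, hC⟩ := exists_mul_eq_one_of_linearIndependent_row (A := Aᵀ) H.indep
  have hCA : Cᵀ * A = 1 := by rw [← transpose_transpose A, ← transpose_mul, hC, transpose_one]
  have hβ : (∑ i, P i • B i).BlockTriangular ρ := fun a b hab => by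
    simp [Matrix.sum_apply, H.tri _ hab]
  obtain ⟨s, hs, hdet⟩ := exists_map_det_submatrix H.inj (C := Cᵀ) hCA _ hβ
    (H.map_add_mul_eq_neg_mul hdP rfl)
  refine ⟨fun i => d i (A.submatrix s id).det / (A.submatrix s id).det + ∑ k, B i (s k) (s k),
    fun i j => ?_, ?_⟩
  · simp only [map_add, map_sum, derivation_logDeriv_comm (hd i j), H.map_diag hd i j]
  · have htr : (of fun i j : J => d j (P i)).trace = ∑ j, d j (P j) := by
      rw [Fintype.sum_eq_add_sum_subtype_ne (fun j => d j (P j)) k₀, hdP, zero_add]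
      rfl
    rw [sum_smul_derivation_apply, htr] at hdet
    have hdlog : ∑ i, P i * (d i (A.submatrix s id).det / (A.submatrix s id).det) =
        -(∑ k, (∑ i, P i • B i) (s k) (s k) + ∑ j, d j (P j)) := by
      simp only [← mul_div_assoc]
      rw [← Finset.sum_div, hdet, mul_div_cancel_right₀ _ hs]
    have hdiag : ∑ i, P i * ∑ k, B i (s k) (s k) = ∑ k, (∑ i, P i • B i) (s k) (s k) := by
      simp only [Matrix.sum_apply, Matrix.smul_apply, smul_eq_mul, Finset.mul_sum]
      exact Finset.sum_comm
    simp only [mul_add, Finset.sum_add_distrib]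
    rw [hdlog, hdiag]
    ring

theorem IsTriangularSystem.exists_form (H : IsTriangularSystem d P k₀ ρ B h)
    (hd : ∀ i j a, d i (d j a) = d j (d i a))
    (hP : P k₀ ≠ 0) :
    ∃ α : σ → K, (∀ i j, d i (α j) = d j (α i)) ∧ ∑ j, P j * α j = -∑ j, d j (P j) := by
  obtain ⟨α, hα, hPα⟩ := (H.smul (P k₀)⁻¹).exists_form_of_eq_one hd (inv_mul_cancel₀ hP)
  refine ⟨fun j => α j - d j (P k₀) / P k₀, fun i j => ?_, ?_⟩
  · simp only [map_sub, hα i j, derivation_logDeriv_comm (hd i j)]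
  · have hquot (j : σ) : P k₀ * d j ((P k₀)⁻¹ * P j) = d j (P j) - P j * (d j (P k₀) / P k₀) := by
      rw [Der.map_mul, Der.map_inv]
      field_simp
      ring
    calc ∑ j, P j * (α j - d j (P k₀) / P k₀)
        = P k₀ * ∑ j, (P k₀)⁻¹ * P j * α j - ∑ j, P j * (d j (P k₀) / P k₀) := by
          simp only [mul_assoc, ← Finset.mul_sum, mul_inv_cancel_left₀ hP, mul_sub,
            Finset.sum_sub_distrib]
      _ = -∑ j, P k₀ * d j ((P k₀)⁻¹ * P j) - ∑ j, P j * (d j (P k₀) / P k₀) := by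
          rw [← Finset.mul_sum, ← mul_neg]
          exact congrArg (P k₀ * · - _) hPα
      _ = -∑ j, d j (P j) := by
          simp only [hquot, Finset.sum_sub_distrib]
          ring

theorem linearIndependent_col_of_mulVec_eq_zero {M : Matrix ι σ K}
    (hM : LinearIndependent K M.row) (hcard : Fintype.card ι + 1 = Fintype.card σ) {v : σ → K}
    (hv : M *ᵥ v = 0) (hk : v k₀ ≠ 0) : LinearIndependent K fun j : {j // j ≠ k₀} => M.col j := by
  classical
  obtain ⟨C, hC⟩ := exists_mul_eq_one_of_linearIndependent_row hM
  refine linearIndependent_of_top_le_span_of_card_eq_finrank (fun w _ => ?_) ?_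
  · let c : σ → K := C *ᵥ w - ((C *ᵥ w) k₀ / v k₀) • v
    have hw : M *ᵥ c = w := by
      rw [mulVec_sub, mulVec_mulVec, hC, one_mulVec, mulVec_smul, hv, smul_zero, sub_zero]
    have hc : c k₀ = 0 := by
      simp only [c, Pi.sub_apply, Pi.smul_apply, smul_eq_mul, div_mul_cancel₀ _ hk, sub_self]
    rw [← hw, mulVec_eq_sum, Fintype.sum_eq_add_sum_subtype_ne _ k₀, hc, MulOpposite.op_zero,
      zero_smul, zero_add]
    refine sum_mem fun j _ => ?_
    rw [op_smul_eq_smul]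
    exact Submodule.smul_mem _ (c j) (Submodule.subset_span ⟨j, rfl⟩)
  · rw [Module.finrank_fintype_fun_eq_card, Fintype.card_subtype_compl, Fintype.card_subtype_eq]
    omega

theorem isTriangularSystem_of_linearIndependent (hd : ∀ i j a, d i (d j a) = d j (d i a))
    (hk : P k₀ ≠ 0) (hρ : Function.Injective ρ) (hcard : Fintype.card ι + 1 = Fintype.card σ)
    (hh : ∀ a, ∑ j, P j * d j (h a) = 0) (hind : LinearIndependent K fun a j => d j (h a)) :
    IsTriangularSystem d P k₀ ρ 0 h := by
  have hconn (j : σ) (v : ι → K) : conn d 0 j v = d j ∘ v := by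
    rw [conn_def, Pi.zero_apply, zero_mulVec, add_zero]
  refine ⟨hρ, fun _ => blockTriangular_zero, fun i j v => ?_, ?_, ?_⟩
  · simp only [hconn]
    exact funext fun a => hd i j (v a)
  · ext a
    simpa only [hconn, Finset.sum_apply, Pi.smul_apply, Function.comp_apply,
      smul_eq_mul, Pi.zero_apply] using hh a
  · simp only [hconn]
    refine linearIndependent_col_of_mulVec_eq_zero (M := of fun a j => d j (h a)) hind hcard
      (funext fun a => ?_) hk
    exact (Finset.sum_congr rfl fun j _ => mul_comm _ _).trans (hh a)

end Divergence

section Average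

open scoped IntermediateField

variable {Ω : Type*} [Field Ω] [CharZero Ω] {S : Subfield Ω}

/-- The average over the conjugates over `S`. Only its values on `algClosure S` are meaningful; it
is extended `S`-linearly to `Ω` in an arbitrary way. -/
noncomputable def average (S : Subfield Ω) : Ω →ₗ[S] Ω :=
  (LinearMap.exists_extend (p := (algebraicClosure S Ω).toSubmodule)
    (Algebra.linearMap S Ω ∘ₗ Algebra.normalizedTrace S (algebraicClosure S Ω))).choose

theorem average_apply (x : algebraicClosure S Ω) :
    average S x = Algebra.normalizedTrace S (algebraicClosure S Ω) x :=
  LinearMap.congr_fun (LinearMap.exists_extend (p := (algebraicClosure S Ω).toSubmodule)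
    (Algebra.linearMap S Ω ∘ₗ Algebra.normalizedTrace S (algebraicClosure S Ω))).choose_spec x

theorem average_mem {x : Ω} (hx : x ∈ algClosure S) : average S x ∈ S := by
  rw [average_apply ⟨x, hx⟩]
  exact Subtype.property _

theorem average_mul {c : Ω} (hc : c ∈ S) (x : Ω) : average S (c * x) = c * average S x :=
  (average S).map_smul (⟨c, hc⟩ : S) x

theorem average_of_mem {x : Ω} (hx : x ∈ S) : average S x = x :=
  (average_apply (algebraMap S (algebraicClosure S Ω) ⟨x, hx⟩)).trans
    (congrArg Subtype.val (Algebra.normalizedTrace_algebraMap_apply_eq_self S _ (⟨x, hx⟩ : S)))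

theorem average_eq_sum [IsAlgClosed Ω] (L : IntermediateField S Ω) [FiniteDimensional S L] (x : L) :
    average S x = (Module.finrank S L : Ω)⁻¹ * ∑ τ : L →ₐ[S] Ω, τ x := by
  have hL : L ≤ algebraicClosure S Ω := fun y hy =>
    mem_algebraicClosure_iff.2 ((Algebra.IsAlgebraic.isAlgebraic (⟨y, hy⟩ : L)).algebraMap (A := Ω))
  have htrace := Algebra.normalizedTrace_map S (algebraicClosure S Ω)
    (IntermediateField.inclusion hL) x
  rw [average_apply (⟨(x : Ω), hL x.2⟩ : algebraicClosure S Ω), ← trace_eq_sum_embeddings Ω]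
  refine (congrArg Subtype.val htrace).trans ?_
  rw [Algebra.normalizedTrace_eq_of_finiteDimensional_apply]
  rfl

theorem algHom_derivation (D : Der Ω) (hS : ∀ a ∈ S, D a ∈ S) {L : IntermediateField S Ω}
    [Algebra.IsAlgebraic S L] (hL : ∀ x ∈ L, D x ∈ L) (τ : L →ₐ[S] Ω) (x : L) :
    D (τ x) = τ ⟨D x, hL x x.2⟩ :=
  map_derivation_of_isAlgebraic (A := S) τ.toRingHom (D.restrict L.toSubfield hL) D
    (fun a => (congrArg D (τ.commutes a)).trans (τ.commutes ⟨D a, hS a a.2⟩).symm)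
    (Algebra.IsAlgebraic.isAlgebraic x)

theorem derivation_mem_intermediateField (D : Der Ω) (hS : ∀ a ∈ S, D a ∈ S)
    (L : IntermediateField S Ω) [Algebra.IsAlgebraic S L] {x : Ω} (hx : x ∈ L) : D x ∈ L :=
  derivation_mem_of_isAlgebraic (T := L.toSubfield) D hS (fun a ha => L.algebraMap_mem ⟨a, ha⟩) hx
    ((Algebra.IsAlgebraic.isAlgebraic (⟨x, hx⟩ : L)).algebraMap (A := Ω))

theorem average_derivation [IsAlgClosed Ω] (D : Der Ω) (hS : ∀ a ∈ S, D a ∈ S) {x : Ω}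
    (hx : x ∈ algClosure S) : average S (D x) = D (average S x) := by
  have _ := IntermediateField.adjoin.finiteDimensional (mem_algClosure.1 hx).isIntegral
  have hL (y : Ω) (hy : y ∈ S⟮x⟯) : D y ∈ S⟮x⟯ := derivation_mem_intermediateField D hS _ hy
  have hx' := IntermediateField.mem_adjoin_simple_self S x
  rw [average_eq_sum S⟮x⟯ ⟨x, hx'⟩, average_eq_sum S⟮x⟯ ⟨D x, hL x hx'⟩, Der.map_mul, Der.map_inv,
    Derivation.map_natCast, mul_zero, mul_zero, add_zero, map_sum]
  simp only [algHom_derivation D hS hL]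

theorem Der.map_prod_div {K ι : Type*} [Field K] (D : Der K) (s : Finset ι) {f : ι → K}
    (hf : ∀ i ∈ s, f i ≠ 0) : D (∏ i ∈ s, f i) / ∏ i ∈ s, f i = ∑ i ∈ s, D (f i) / f i := by
  classical
  rw [Der.map_prod, Finset.sum_div]
  refine Finset.sum_congr rfl fun i hi => ?_
  rw [← Finset.mul_prod_erase s f hi, mul_div_mul_right]
  exact Finset.prod_ne_zero_iff.2 fun j hj => hf j (Finset.mem_of_mem_erase hj)

theorem average_logDeriv [IsAlgClosed Ω] (D : Der Ω) (hS : ∀ a ∈ S, D a ∈ S) {a : Ω}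
    (ha : a ∈ algClosure S) (ha₀ : a ≠ 0) :
    average S (D a / a) = (Module.finrank S S⟮a⟯ : Ω)⁻¹ *
      (D (Algebra.norm S (IntermediateField.AdjoinSimple.gen S a)) /
        Algebra.norm S (IntermediateField.AdjoinSimple.gen S a)) := by
  have _ := IntermediateField.adjoin.finiteDimensional (mem_algClosure.1 ha).isIntegral
  have hL (y : Ω) (hy : y ∈ S⟮a⟯) : D y ∈ S⟮a⟯ := derivation_mem_intermediateField D hS _ hy
  set a' := IntermediateField.AdjoinSimple.gen S a
  have hnorm : ((Algebra.norm S a' : S) : Ω) = ∏ τ : S⟮a⟯ →ₐ[S] Ω, τ a' :=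
    Algebra.norm_eq_prod_embeddings S Ω a'
  have hτ (τ : S⟮a⟯ →ₐ[S] Ω) : τ a' ≠ 0 := fun h =>
    ha₀ (congrArg Subtype.val ((map_eq_zero τ).1 h))
  rw [hnorm, Der.map_prod_div _ _ fun τ _ => hτ τ]
  simp only [algHom_derivation D hS hL, ← map_div₀]
  exact average_eq_sum S⟮a⟯ (⟨D a', hL a' a'.2⟩ / a')

end Average

section LogForms

variable {Ω σ : Type*} [Field Ω]

/-- The forms `dR + ∑ c da/a` with coefficients `c` in `k` and functions `R`, `a` in `S`. -/
def logForms (d : σ → Der Ω) (k S : Subfield Ω) : AddSubmonoid (σ → Ω) :=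
  AddSubmonoid.closure ({α | ∃ R ∈ S, α = fun i => d i R} ∪
    {α | ∃ c ∈ k, ∃ a ∈ S, a ≠ 0 ∧ α = fun i => c * (d i a / a)})

variable {d : σ → Der Ω} {k S T : Subfield Ω} {α : σ → Ω}

theorem logForms_mono (h : S ≤ T) : logForms d k S ≤ logForms d k T := by
  refine AddSubmonoid.closure_mono (Set.union_subset_union ?_ ?_)
  · rintro _ ⟨R, hR, rfl⟩
    exact ⟨R, h hR, rfl⟩
  · rintro _ ⟨c, hc, a, ha, ha₀, rfl⟩
    exact ⟨c, hc, a, h ha, ha₀, rfl⟩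

theorem exact_mem_logForms {R : Ω} (hR : R ∈ S) : (fun i => d i R) ∈ logForms d k S :=
  AddSubmonoid.subset_closure (Or.inl ⟨R, hR, rfl⟩)

theorem dlog_mem_logForms {c a : Ω} (hc : c ∈ k) (ha : a ∈ S) (ha₀ : a ≠ 0) :
    (fun i => c * (d i a / a)) ∈ logForms d k S :=
  AddSubmonoid.subset_closure (Or.inr ⟨c, hc, a, ha, ha₀, rfl⟩)

theorem apply_mem_of_mem_logForms {i : σ} (hkS : k ≤ S) (hS : ∀ x ∈ S, d i x ∈ S)
    (hα : α ∈ logForms d k S) : α i ∈ S := by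
  induction hα using AddSubmonoid.closure_induction with
  | mem α h =>
    rcases h with ⟨R, hR, rfl⟩ | ⟨c, hc, a, ha, _, rfl⟩
    exacts [hS R hR, mul_mem (hkS hc) (div_mem (hS a ha) ha)]
  | zero => exact zero_mem S
  | add α β _ _ h1 h2 => exact add_mem h1 h2

theorem apply_eq_zero_of_mem_logForms {i : σ} (hS : ∀ x ∈ S, d i x = 0)
    (hα : α ∈ logForms d k S) : α i = 0 := by
  induction hα using AddSubmonoid.closure_induction with
  | mem α h =>
    rcases h with ⟨R, hR, rfl⟩ | ⟨c, _, a, ha, _, rfl⟩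
    · exact hS R hR
    · simp only [hS a ha, zero_div, mul_zero]
  | zero => rfl
  | add α β _ _ h1 h2 => rw [Pi.add_apply, h1, h2, add_zero]

theorem logForms_closed (hd : ∀ i j a, d i (d j a) = d j (d i a))
    (hk : ∀ i, ∀ c ∈ k, d i c = 0) (hα : α ∈ logForms d k S) (i j : σ) :
    d i (α j) = d j (α i) := by
  induction hα using AddSubmonoid.closure_induction with
  | mem α h =>
    rcases h with ⟨R, _, rfl⟩ | ⟨c, hc, a, _, _, rfl⟩
    · exact hd i j R
    · simp only [Der.map_mul, hk _ c hc, Derivation.leibniz_div, smul_eq_mul, hd i j]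
      ring
  | zero => simp only [Pi.zero_apply, map_zero]
  | add α β _ _ h1 h2 => simp only [Pi.add_apply, map_add, h1, h2]

theorem average_mem_logForms [CharZero Ω] [IsAlgClosed Ω] (hS : IsStable d S) (hkS : k ≤ S)
    (hα : α ∈ logForms d k (algClosure S)) : (fun i => average S (α i)) ∈ logForms d k S := by
  induction hα using AddSubmonoid.closure_induction with
  | mem α h =>
    rcases h with ⟨R, hR, rfl⟩ | ⟨c, hc, a, ha, ha₀, rfl⟩
    · simp only [average_derivation (d _) (hS _) hR]
      exact exact_mem_logForms (average_mem hR)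
    · simp only [average_mul (hkS hc), average_logDeriv (d _) (hS _) ha ha₀, ← mul_assoc]
      have _ := IntermediateField.adjoin.finiteDimensional (mem_algClosure.1 ha).isIntegral
      have hnorm := Algebra.norm_ne_zero_iff (R := S).2
        fun h : IntermediateField.AdjoinSimple.gen S a = 0 => ha₀ (congrArg Subtype.val h)
      exact dlog_mem_logForms (mul_mem hc (inv_mem (natCast_mem k _))) (Subtype.property _)
        (Subtype.coe_ne_coe.2 hnorm)
  | zero =>
    simp only [Pi.zero_apply, map_zero]
    exact zero_mem _
  | add α β _ _ h1 h2 =>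
    simp only [Pi.add_apply, map_add]
    exact add_mem h1 h2

end LogForms

section PartialFractions

open HahnSeries
open scoped IntermediateField LaurentSeries

variable {Ω : Type*} [Field Ω] {F : Subfield Ω} {t : Ω} {D : Der Ω}

theorem sub_ne_zero_of_transcendental (ht : Transcendental F t) (ρ : F) : t - ρ ≠ 0 := fun h =>
  ht (sub_eq_zero.1 h ▸ isAlgebraic_algebraMap ρ)

/-- The elements `D R + ∑ a / (t - ρ)` with `R` in `F(t)` and `a`, `ρ` in `F`: those with an
elementary primitive in the sense of Liouville. -/
def elementarilyIntegrable (D : Der Ω) (F : Subfield Ω) (t : Ω) : AddSubmonoid Ω where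
  carrier := {y | ∃ R ∈ F⟮t⟯, ∃ c : F →₀ F, y = D R + c.sum fun ρ a => (a : Ω) / (t - ρ)}
  zero_mem' := ⟨0, zero_mem _, 0, by rw [map_zero, Finsupp.sum_zero_index, add_zero]⟩
  add_mem' := by
    rintro _ _ ⟨R, hR, c, rfl⟩ ⟨R', hR', c', rfl⟩
    have hsum : (c + c').sum (fun ρ a => (a : Ω) / (t - ρ)) =
        c.sum (fun ρ a => (a : Ω) / (t - ρ)) + c'.sum fun ρ a => (a : Ω) / (t - ρ) :=
      Finsupp.sum_add_index' (fun ρ => zero_div (t - (ρ : Ω)))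
        fun ρ a b => add_div (a : Ω) b (t - ρ)
    refine ⟨R + R', add_mem hR hR', c + c', ?_⟩
    rw [map_add, hsum]
    ring

theorem div_sub_mem_elementarilyIntegrable (ρ a : F) :
    (a : Ω) / (t - ρ) ∈ elementarilyIntegrable D F t :=
  ⟨0, zero_mem _, Finsupp.single ρ a, by
    rw [map_zero, zero_add, Finsupp.sum_single_index (zero_div (t - (ρ : Ω)))]⟩

theorem mul_pow_mul_derivation_mem_elementarilyIntegrable [CharZero Ω] (hDF : ∀ a ∈ F, D a = 0)
    (a : F) {u : Ω} (hu : u ∈ F⟮t⟯) (m : ℕ) :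
    (a : Ω) * u ^ m * D u ∈ elementarilyIntegrable D F t := by
  have hm : ((m + 1 : ℕ) : Ω) ≠ 0 := Nat.cast_ne_zero.2 m.succ_ne_zero
  have ha : (a / (m + 1 : ℕ) : Ω) ∈ F := div_mem a.2 (natCast_mem F _)
  refine ⟨a / (m + 1 : ℕ) * u ^ (m + 1),
    mul_mem (F⟮t⟯.algebraMap_mem ⟨_, ha⟩) (pow_mem hu _), 0, ?_⟩
  rw [Der.map_mul, hDF _ ha, mul_zero, add_zero, Derivation.leibniz_pow, Finsupp.sum_zero_index,
    add_zero, Nat.add_sub_cancel, nsmul_eq_mul, smul_eq_mul]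
  field_simp

theorem aeval_mem_elementarilyIntegrable [CharZero Ω] (hDF : ∀ a ∈ F, D a = 0) (hDt : D t = 1)
    (q : Polynomial F) : Polynomial.aeval t q ∈ elementarilyIntegrable D F t := by
  rw [Polynomial.aeval_eq_sum_range]
  refine sum_mem fun i _ => ?_
  have h := mul_pow_mul_derivation_mem_elementarilyIntegrable hDF (q.coeff i)
    (IntermediateField.mem_adjoin_simple_self F t) i
  rwa [hDt, mul_one] at h

theorem mul_inv_sub_pow_mem_elementarilyIntegrable [CharZero Ω] (hDF : ∀ a ∈ F, D a = 0)
    (hDt : D t = 1) (ρ a : F) (j : ℕ) :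
    (a : Ω) * (t - ρ)⁻¹ ^ (j + 1) ∈ elementarilyIntegrable D F t := by
  cases j with
  | zero =>
    rw [zero_add, pow_one, ← div_eq_mul_inv]
    exact div_sub_mem_elementarilyIntegrable ρ a
  | succ j =>
    have hu : (t - ρ : Ω)⁻¹ ∈ F⟮t⟯ := inv_mem
      (sub_mem (IntermediateField.mem_adjoin_simple_self F t) (F⟮t⟯.algebraMap_mem ρ))
    have h := mul_pow_mul_derivation_mem_elementarilyIntegrable hDF (-a) hu j
    rw [Der.map_inv, map_sub, hDt, hDF ρ ρ.2] at h
    convert h using 1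
    push_cast
    ring

theorem aeval_X_sub_C (t : Ω) (ρ : F) :
    Polynomial.aeval t (Polynomial.X - Polynomial.C ρ) = t - ρ := by
  rw [map_sub, Polynomial.aeval_X, Polynomial.aeval_C]
  rfl

theorem aeval_eq_leadingCoeff_mul_prod_roots [DecidableEq F] [IsAlgClosed F] (t : Ω)
    (s : Polynomial F) : Polynomial.aeval t s = s.leadingCoeff *
      ∏ ρ ∈ s.roots.toFinset, (t - (ρ : Ω)) ^ s.roots.count ρ := by
  conv_lhs => rw [(IsAlgClosed.splits s).eq_prod_roots, map_mul, Polynomial.aeval_C,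
    Finset.prod_multiset_map_count, map_prod]
  simp only [map_pow, aeval_X_sub_C]
  rfl

theorem exists_partialFraction [IsAlgClosed F] (ht : Transcendental F t) (r s : Polynomial F) :
    ∃ (q : Polynomial F) (Z : Finset F) (N : F → ℕ) (g : (ρ : F) → Fin (N ρ) → F),
      Polynomial.aeval t r / Polynomial.aeval t s = Polynomial.aeval t q +
        ∑ ρ ∈ Z, ∑ j, (g ρ j : Ω) * (t - ρ)⁻¹ ^ (j.1 + 1) := by
  classical
  let _ : Algebra (Polynomial F) Ω := (Polynomial.aeval t).toRingHom.toAlgebra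
  have hmap (p : Polynomial F) : algebraMap (Polynomial F) Ω p = Polynomial.aeval t p := rfl
  obtain ⟨q, g, hg, h⟩ :=
    Polynomial.mul_prod_pow_inverse_eq_quo_add_sum_rem_mul_pow_inverse (K := Ω)
      (s := s.roots.toFinset) (Polynomial.C s.leadingCoeff⁻¹ * r)
      (fun ρ _ => Polynomial.monic_X_sub_C ρ)
      (fun ρ _ ρ' _ hne => Polynomial.isCoprime_X_sub_C_of_isUnit_sub
        (isUnit_iff_ne_zero.2 (sub_ne_zero.2 hne))) (fun ρ => s.roots.count ρ)
      (gi := fun ρ => (t - ρ)⁻¹) (fun ρ _ => by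
        rw [hmap, aeval_X_sub_C, inv_mul_cancel₀ (sub_ne_zero_of_transcendental ht ρ)])
  have hconst : ∀ ρ ∈ s.roots.toFinset, ∀ j, g ρ j = Polynomial.C ((g ρ j).coeff 0) :=
    fun ρ hρ j => by
      have hdeg := hg ρ hρ j
      rw [Polynomial.degree_X_sub_C] at hdeg
      exact Polynomial.eq_C_of_degree_le_zero (Order.le_of_lt_succ hdeg)
  refine ⟨q, s.roots.toFinset, _, fun ρ j => (g ρ j).coeff 0, ?_⟩
  have hrs : Polynomial.aeval t r / Polynomial.aeval t s =
      algebraMap (Polynomial F) Ω (Polynomial.C s.leadingCoeff⁻¹ * r) *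
        ∏ ρ ∈ s.roots.toFinset, (t - (ρ : Ω))⁻¹ ^ s.roots.count ρ := by
    simp only [inv_pow, Finset.prod_inv_distrib]
    rw [hmap, map_mul, Polynomial.aeval_C, aeval_eq_leadingCoeff_mul_prod_roots t s, map_inv₀,
      div_eq_mul_inv, mul_inv, mul_left_comm, mul_assoc]
    rfl
  rw [hrs, h]
  refine congrArg₂ _ rfl (Finset.sum_congr rfl fun ρ hρ => Finset.sum_congr rfl fun j _ => ?_)
  rw [hconst ρ hρ j, hmap, Polynomial.aeval_C]
  rfl

theorem exists_primitive_add_sum [CharZero Ω] [IsAlgClosed F] (ht : Transcendental F t)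
    (hDF : ∀ a ∈ F, D a = 0) (hDt : D t = 1) {y : Ω} (hy : y ∈ F⟮t⟯) :
    ∃ R ∈ F⟮t⟯, ∃ c : F →₀ F, y = D R + c.sum fun ρ a => (a : Ω) / (t - ρ) := by
  change y ∈ elementarilyIntegrable D F t
  obtain ⟨r, s, rfl⟩ := (IntermediateField.mem_adjoin_simple_iff F y).1 hy
  obtain ⟨q, Z, N, g, h⟩ := exists_partialFraction ht r s
  rw [h]
  exact add_mem (aeval_mem_elementarilyIntegrable hDF hDt q) (sum_mem fun ρ _ => sum_mem fun j _ =>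
    mul_inv_sub_pow_mem_elementarilyIntegrable hDF hDt ρ _ j)

theorem transcendental_single_add_C {F : Type*} [Field F] (ρ : F) :
    Transcendental F (single 1 1 + C ρ : F⸨X⸩) := fun h =>
  transcendental_single one_ne_zero (by
    have hρ := h.sub (isAlgebraic_algebraMap ρ)
    rwa [algebraMap_eq_C, add_sub_cancel_right] at hρ)

/- Expansion in powers of `t - ρ`: there `(t - ρ) d/dt` multiplies the `j`-th coefficient by `j`. -/
theorem exists_expansion (ht : Transcendental F t) (hDF : ∀ a ∈ F, D a = 0) (hDt : D t = 1)
    (ρ : F) :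
    ∃ ψ : F⟮t⟯ →ₐ[F] F⸨X⸩, ψ (IntermediateField.AdjoinSimple.gen F t) = single 1 1 + C ρ ∧
      ∀ x y : F⟮t⟯, (y : Ω) = (t - ρ) * D x → ∀ j, (ψ y).coeff j = j * (ψ x).coeff j := by
  obtain ⟨ψ, hψ⟩ := exists_algHom_of_transcendental ht (transcendental_single_add_C ρ)
  have htm := IntermediateField.mem_adjoin_simple_self F t
  let E : Der Ω := (t - (ρ : Ω)) • D
  have hEF (a : F) : E (algebraMap F Ω a) = 0 :=
    (congrArg (_ * ·) (hDF a a.2)).trans (mul_zero _)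
  have hEt : E t = t - ρ := (congrArg (_ * ·) hDt).trans (mul_one _)
  have hE (x : Ω) (hx : x ∈ F⟮t⟯) : E x ∈ F⟮t⟯ :=
    derivation_mem_adjoin E (fun a => hEF a ▸ zero_mem _)
      (hEt ▸ sub_mem htm (F⟮t⟯.algebraMap_mem ρ)) hx
  have hψE := map_derivation_of_mem_adjoin E (laurentDeriv (0 : Der F) 1 0) ψ.toRingHom hE
    (fun a => by
      have h0 : (⟨E (algebraMap F Ω a), hE _ (F⟮t⟯.algebraMap_mem a)⟩ : F⟮t⟯) = 0 :=
        Subtype.ext (hEF a)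
      rw [h0, map_zero]
      change laurentDeriv _ _ _ (ψ _) = 0
      rw [ψ.commutes, algebraMap_eq_C, laurentDeriv_C, Derivation.zero_apply, map_zero])
    (by
      have h0 : (⟨E t, hE _ htm⟩ : F⟮t⟯) =
        IntermediateField.AdjoinSimple.gen F t - algebraMap F _ ρ := Subtype.ext hEt
      rw [h0]
      change laurentDeriv _ _ _ (ψ _) = ψ _
      rw [map_sub ψ, ψ.commutes, algebraMap_eq_C, hψ, add_sub_cancel_right, map_add, laurentDeriv_C,
        laurentDeriv_single, Derivation.zero_apply, map_zero, add_zero, Int.cast_one, mul_one]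
      rfl)
  refine ⟨ψ, hψ, fun x y hxy j => ?_⟩
  have hy : y = ⟨E x, hE x x.2⟩ := Subtype.ext hxy
  have hcoeff : (ψ y).coeff j = (laurentDeriv (0 : Der F) 1 0 (ψ x)).coeff j := by
    rw [hy]
    exact congrArg (fun z : F⸨X⸩ => z.coeff j) (hψE x).symm
  rw [hcoeff, coeff_laurentDeriv, Derivation.zero_apply, zero_add, mul_one, Nat.cast_zero, sub_zero]

theorem coeff_zero_single_div_single_add_C {F : Type*} [Field F] {b : F} (hb : b ≠ 0) :
    (single 1 1 / (single 1 1 + C b) : F⸨X⸩).coeff 0 = 0 := by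
  set z : F⸨X⸩ := single 1 1 + C b with hz
  have hcoeff : z.coeff 0 ≠ 0 := by
    rwa [hz, coeff_add, coeff_single_of_ne (by norm_num), zero_add, C_apply, coeff_single_same]
  have hinv := inv_mem_ordGE (x := z) (ne_zero_of_coeff_ne_zero hcoeff)
  have hord := order_le_of_coeff_ne_zero hcoeff
  rw [div_eq_mul_inv]
  exact mul_mem_ordGE (single_mem_ordGE 1 1) hinv 0 (by omega)

theorem eq_zero_of_derivation_eq_sum (ht : Transcendental F t)
    (hDF : ∀ a ∈ F, D a = 0) (hDt : D t = 1) {G : Ω} (hG : G ∈ F⟮t⟯) {c : F →₀ F}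
    (hc : D G = c.sum fun ρ a => (a : Ω) / (t - ρ)) : c = 0 := by
  classical
  ext1 ρ
  obtain ⟨ψ, hψ, hψD⟩ := exists_expansion ht hDF hDt ρ
  let x : F⟮t⟯ := IntermediateField.AdjoinSimple.gen F t
  let y : F⟮t⟯ := c.sum fun τ a =>
    algebraMap F _ a * ((x - algebraMap F _ ρ) / (x - algebraMap F _ τ))
  have hy : (y : Ω) = (t - ρ) * D G := by
    simp only [y, x, hc, Finsupp.sum, Finset.mul_sum]
    push_cast
    refine Finset.sum_congr rfl fun τ _ => ?_
    rw [IntermediateField.AdjoinSimple.coe_gen, mul_div_left_comm]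
    rfl
  have hterm (τ : F) : (ψ (algebraMap F _ (c τ) *
      ((x - algebraMap F _ ρ) / (x - algebraMap F _ τ)))).coeff 0 = if τ = ρ then c τ else 0 := by
    have hψ' (τ : F) : ψ (x - algebraMap F _ τ) = single 1 1 + C (ρ - τ) := by
      rw [map_sub ψ, ψ.commutes, algebraMap_eq_C, hψ, map_sub, add_sub_assoc]
    rw [_root_.map_mul ψ, map_div₀ ψ, ψ.commutes, algebraMap_eq_C, hψ', hψ', sub_self, map_zero,
      add_zero]
    split_ifs with h
    · rw [h, sub_self, map_zero, add_zero, div_self (single_ne_zero one_ne_zero), mul_one, C_apply,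
        coeff_single_same]
    · rw [C_apply, coeff_single_zero_mul,
        coeff_zero_single_div_single_add_C (sub_ne_zero.2 (Ne.symm h)), mul_zero]
  have hcoeff := hψD ⟨G, hG⟩ y hy 0
  rw [Int.cast_zero, zero_mul] at hcoeff
  simp only [y, Finsupp.sum, map_sum, coeff_sum, hterm, Finset.sum_ite_eq',
    Finsupp.mem_support_iff] at hcoeff
  rw [Finsupp.zero_apply]
  by_contra h
  exact h (by rwa [if_pos h] at hcoeff)

end PartialFractions

section Constants

open scoped IntermediateField LaurentSeries

variable {Ω : Type*} [Field Ω]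

theorem derivation_eq_zero_of_isAlgebraic [CharZero Ω] {S : Subfield Ω} (D : Der Ω)
    (h : ∀ y ∈ S, D y = 0) {y : Ω} (hy : IsAlgebraic S y) : D y = 0 :=
  (map_derivation_of_isAlgebraic (A := S) (RingHom.id Ω) D 0 (fun a => (h a a.2).symm) hy).symm

theorem mem_of_derivation_eq_zero [CharZero Ω] {F : Subfield Ω} {t : Ω} {D : Der Ω}
    (ht : Transcendental F t) (hDF : ∀ a ∈ F, D a = 0) (hDt : D t = 1) {y : Ω} (hy : y ∈ F⟮t⟯)
    (hDy : D y = 0) : y ∈ F := by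
  obtain ⟨ψ, -, hψD⟩ := exists_expansion ht hDF hDt 0
  have hcoeff (j : ℤ) (hj : j ≠ 0) : (ψ ⟨y, hy⟩).coeff j = 0 := by
    have h := hψD ⟨y, hy⟩ 0 ((congrArg (_ * ·) hDy).trans (mul_zero _)).symm j
    rw [map_zero, HahnSeries.coeff_zero, zero_eq_mul] at h
    exact h.resolve_left (Int.cast_ne_zero.2 hj)
  have hconst : ψ ⟨y, hy⟩ = ψ (algebraMap F _ ((ψ ⟨y, hy⟩).coeff 0)) := by
    rw [ψ.commutes, algebraMap_eq_C, HahnSeries.C_apply]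
    ext1
    funext j
    rw [HahnSeries.coeff_single]
    split_ifs with hj
    exacts [hj ▸ rfl, hcoeff j hj]
  rw [show y = algebraMap F Ω ((ψ ⟨y, hy⟩).coeff 0) from
    congrArg Subtype.val (ψ.toRingHom.injective hconst)]
  exact Subtype.property _

theorem derivation_coeff_minpoly_eq_zero {S : Subfield Ω} (D : Der Ω) (hS : ∀ x ∈ S, D x ∈ S)
    {c : Ω} (hc : IsIntegral S c) (hDc : D c = 0) (j : ℕ) : D ((minpoly S c).coeff j) = 0 := by
  let _ : Differential S := ⟨D.restrict S hS⟩
  let _ : Differential Ω := ⟨D⟩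
  have _ : DifferentialAlgebra S Ω := ⟨fun _ => rfl⟩
  let q := Differential.mapCoeffs (minpoly S c)
  have hq : Polynomial.aeval c q = 0 := by
    have h := Differential.deriv_aeval_eq c (minpoly S c)
    have hDc' : Differential.deriv c = 0 := hDc
    rwa [minpoly.aeval, map_zero, hDc', mul_zero, add_zero, eq_comm] at h
  have hcoeff (i : ℕ) : q.coeff i = D.restrict S hS ((minpoly S c).coeff i) :=
    Differential.coeff_mapCoeffs _ _
  have hdeg : q.degree < (minpoly S c).degree := by
    rw [Polynomial.degree_eq_natDegree (minpoly.ne_zero hc), Polynomial.degree_lt_iff_coeff_zero]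
    intro i hi
    rw [hcoeff]
    rcases hi.eq_or_lt with rfl | hi
    · rw [(minpoly.monic hc).coeff_natDegree, Derivation.map_one_eq_zero]
    · rw [Polynomial.coeff_eq_zero_of_natDegree_lt hi, map_zero]
  have hq0 : q = 0 := by
    by_contra h
    exact (minpoly.degree_le_of_ne_zero S c h hq).not_gt hdeg
  have h := hcoeff j
  rw [hq0, Polynomial.coeff_zero] at h
  exact congrArg Subtype.val h.symm

theorem mem_of_isAlgebraic_of_constant {σ : Type*} {d : σ → Der Ω} {k S : Subfield Ω}
    (hkc : ∀ x : Ω, IsAlgebraic k x → x ∈ k) (hS : IsStable d S)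
    (hconst : ∀ y ∈ S, (∀ i, d i y = 0) → y ∈ k) {c : Ω} (hc : IsAlgebraic S c)
    (hdc : ∀ i, d i c = 0) : c ∈ k := by
  have hlift : (minpoly S c).map (algebraMap S Ω) ∈ Polynomial.lifts (algebraMap k Ω) := by
    refine (Polynomial.lifts_iff_coeff_lifts _).2 fun j => ⟨⟨(minpoly S c).coeff j, ?_⟩, ?_⟩
    · exact hconst _ (Subtype.property _) fun i =>
        derivation_coeff_minpoly_eq_zero (d i) (hS i) hc.isIntegral (hdc i) j
    · rw [Polynomial.coeff_map]
      rfl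
  obtain ⟨q, hq⟩ := (Polynomial.mem_lifts _).1 hlift
  refine hkc c ⟨q, fun h => ?_, ?_⟩
  · rw [h, Polynomial.map_zero, eq_comm, Polynomial.map_eq_zero] at hq
    exact minpoly.ne_zero hc.isIntegral hq
  · rw [Polynomial.aeval_def, ← Polynomial.eval_map, hq, Polynomial.eval_map,
      ← Polynomial.aeval_def, minpoly.aeval]

end Constants

section Coordinates

open scoped IntermediateField

variable {Ω σ : Type*} [Field Ω] {d : σ → Der Ω} {k : Subfield Ω} {x : σ → Ω} {s : Set σ} {a : σ}

/-- The derivations `d` are the partial derivatives with respect to the coordinates `x`, over an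
algebraically closed field `k` of constants. -/
structure IsCoordinateSystem (d : σ → Der Ω) (k : Subfield Ω) (x : σ → Ω) : Prop where
  comm : ∀ i j a, d i (d j a) = d j (d i a)
  apply_constant : ∀ i, ∀ c ∈ k, d i c = 0
  mem_of_isAlgebraic : ∀ y, IsAlgebraic k y → y ∈ k
  apply_self : ∀ i, d i (x i) = 1
  apply_of_ne : ∀ {i j}, i ≠ j → d i (x j) = 0

/-- The field `k(xᵢ : i ∈ s)` of rational functions in some of the coordinates. -/
def coordField (k : Subfield Ω) (x : σ → Ω) (s : Set σ) : Subfield Ω :=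
  Subfield.closure (k ∪ x '' s)

theorem le_coordField : k ≤ coordField k x s := fun _ hy => Subfield.subset_closure (Or.inl hy)

theorem mem_coordField {i : σ} (hi : i ∈ s) : x i ∈ coordField k x s :=
  Subfield.subset_closure (Or.inr ⟨i, hi, rfl⟩)

theorem coordField_le {S : Subfield Ω} (hk : k ≤ S) (hx : ∀ i ∈ s, x i ∈ S) :
    coordField k x s ≤ S :=
  Subfield.closure_le.2 (Set.union_subset hk (Set.image_subset_iff.2 hx))

theorem coordField_insert_le {F : Subfield Ω} (hF : coordField k x s ≤ F) :
    coordField k x (insert a s) ≤ F⟮x a⟯.toSubfield :=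
  coordField_le (fun c hc => F⟮x a⟯.algebraMap_mem ⟨c, hF (le_coordField hc)⟩) fun j hj => by
    rcases hj with rfl | hj
    exacts [IntermediateField.mem_adjoin_simple_self F (x j),
      F⟮x a⟯.algebraMap_mem ⟨x j, hF (mem_coordField hj)⟩]

theorem adjoin_le_algClosure_coordField :
    (algClosure (coordField k x s))⟮x a⟯.toSubfield ≤
      algClosure (coordField k x (insert a s)) := by
  intro y hy
  have hmono : coordField k x s ≤ coordField k x (insert a s) :=
    coordField_le le_coordField fun i hi => mem_coordField (Or.inr hi)
  induction hy using IntermediateField.adjoin_induction with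
  | mem y hy => exact hy ▸ le_algClosure _ (mem_coordField (Or.inl rfl))
  | algebraMap c => exact algClosure_mono hmono c.2
  | add y z _ _ h1 h2 => exact add_mem h1 h2
  | inv y _ h => exact inv_mem h
  | mul y z _ _ h1 h2 => exact mul_mem h1 h2

theorem derivation_mem_coordField {D : Der Ω} (hk : ∀ c ∈ k, D c ∈ coordField k x s)
    (hx : ∀ i ∈ s, D (x i) ∈ coordField k x s) {y : Ω} (hy : y ∈ coordField k x s) :
    D y ∈ coordField k x s := by
  induction hy using Subfield.closure_induction with
  | mem y h =>
    rcases h with h | ⟨i, hi, rfl⟩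
    exacts [hk y h, hx i hi]
  | one => exact D.map_one_eq_zero ▸ zero_mem _
  | add y z _ _ h1 h2 => exact map_add D y z ▸ add_mem h1 h2
  | neg y _ h => exact map_neg D y ▸ neg_mem h
  | inv y hy h => exact D.map_inv y ▸ mul_mem (neg_mem (pow_mem (inv_mem hy) 2)) h
  | mul y z hy hz h1 h2 => exact D.map_mul y z ▸ add_mem (mul_mem hy h2) (mul_mem hz h1)

theorem derivation_coordField_eq_zero {D : Der Ω} (hk : ∀ c ∈ k, D c = 0)
    (hx : ∀ i ∈ s, D (x i) = 0) {y : Ω} (hy : y ∈ coordField k x s) : D y = 0 := by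
  induction hy using Subfield.closure_induction with
  | mem y h =>
    rcases h with h | ⟨i, hi, rfl⟩
    exacts [hk y h, hx i hi]
  | one => exact D.map_one_eq_zero
  | add y z _ _ h1 h2 => rw [map_add, h1, h2, add_zero]
  | neg y _ h => rw [map_neg, h, neg_zero]
  | inv y _ h => rw [D.map_inv, h, mul_zero]
  | mul y z _ _ h1 h2 => rw [D.map_mul, h1, h2, mul_zero, mul_zero, add_zero]

namespace IsCoordinateSystem

variable (hx : IsCoordinateSystem d k x)
include hx

theorem isStable_coordField : IsStable d (coordField k x s) := fun i _ hy =>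
  derivation_mem_coordField (fun c hc => hx.apply_constant i c hc ▸ zero_mem _) (fun j _ => by
    rcases eq_or_ne i j with rfl | hij
    exacts [hx.apply_self i ▸ one_mem _, hx.apply_of_ne hij ▸ zero_mem _]) hy

theorem derivation_eq_zero (ha : a ∉ s) {y : Ω} (hy : y ∈ coordField k x s) : d a y = 0 :=
  derivation_coordField_eq_zero (hx.apply_constant a)
    (fun _ hi => hx.apply_of_ne fun h => ha (h ▸ hi)) hy

variable [CharZero Ω]

theorem derivation_algClosure_eq_zero (ha : a ∉ s) {y : Ω}
    (hy : y ∈ algClosure (coordField k x s)) : d a y = 0 :=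
  derivation_eq_zero_of_isAlgebraic (d a) (fun _ => hx.derivation_eq_zero ha) (mem_algClosure.1 hy)

theorem transcendental (ha : a ∉ s) : Transcendental (algClosure (coordField k x s)) (x a) :=
  fun h => one_ne_zero ((hx.apply_self a).symm.trans
    (hx.derivation_algClosure_eq_zero ha (mem_algClosure_of_isAlgebraic h)))

theorem mem_coordField_of_insert (ha : a ∉ s) {y : Ω} (hy : y ∈ coordField k x (insert a s))
    (h : d a y = 0) : y ∈ coordField k x s :=
  mem_of_derivation_eq_zero
    (fun ht => hx.transcendental ha (isAlgebraic_of_subfield_le (le_algClosure _) ht))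
    (fun _ => hx.derivation_eq_zero ha) (hx.apply_self a) (coordField_insert_le le_rfl hy) h

theorem mem_of_forall_derivation_eq_zero (s : Finset σ) {y : Ω} (hy : y ∈ coordField k x s)
    (h : ∀ i, d i y = 0) : y ∈ k := by
  classical
  induction s using Finset.induction_on with
  | empty =>
    rw [Finset.coe_empty] at hy
    exact coordField_le le_rfl (fun i hi => hi.elim) hy
  | insert a s ha ih =>
    rw [Finset.coe_insert] at hy
    exact ih (hx.mem_coordField_of_insert ha hy (h a))

end IsCoordinateSystem

end Coordinates

section ClosedForms

open scoped IntermediateField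

variable {Ω : Type*} [Field Ω]

/- Up to the `D`-derivative of `-c E ρ / (t - ρ)`, applying `E` to `c / (t - ρ)` yields
`E c / (t - ρ)`; and a `D`-derivative has no residues. -/
theorem derivation_residue_eq_zero {F : Subfield Ω} {t : Ω} {D E : Der Ω}
    (ht : Transcendental F t) (hDE : ∀ y, E (D y) = D (E y)) (hDF : ∀ a ∈ F, D a = 0)
    (hDt : D t = 1) (hEF : ∀ a ∈ F, E a ∈ F) (hEt : E t = 0) {R y : Ω} (hR : R ∈ F⟮t⟯)
    (hy : y ∈ F⟮t⟯) {c : F →₀ F} (h : D y = E (D R + c.sum fun ρ a => (a : Ω) / (t - ρ))) (ρ : F) :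
    E (c ρ) = 0 := by
  have hF (a : F) : (a : Ω) ∈ F⟮t⟯ := F⟮t⟯.algebraMap_mem a
  have htm := IntermediateField.mem_adjoin_simple_self F t
  let c' : F →₀ F := c.mapRange (E.restrict F hEF) (map_zero _)
  let G : Ω := y - E R + c.sum fun ρ a => (a : Ω) * E ρ / (t - ρ)
  have hER : E R ∈ F⟮t⟯ := derivation_mem_adjoin E (fun a : F => hF ⟨E a, hEF a a.2⟩)
    (hEt ▸ zero_mem _) hR
  have hG : G ∈ F⟮t⟯ := add_mem (sub_mem hy hER) (sum_mem fun τ _ =>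
    div_mem (mul_mem (hF (c τ)) (hF ⟨E τ, hEF τ τ.2⟩)) (sub_mem htm (hF τ)))
  have hc'sum : (c'.sum fun ρ a => (a : Ω) / (t - ρ)) = c.sum fun ρ a => E a / (t - ρ) :=
    Finsupp.sum_mapRange_index fun ρ => zero_div (t - (ρ : Ω))
  have hDG : D G = c'.sum fun ρ a => (a : Ω) / (t - ρ) := by
    rw [hc'sum, map_add, map_sub, h, map_add, hDE R, add_sub_cancel_left, Finsupp.sum, Finsupp.sum,
      Finsupp.sum, map_sum, map_sum, ← Finset.sum_add_distrib]
    refine Finset.sum_congr rfl fun τ _ => ?_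
    have hτ := sub_ne_zero_of_transcendental ht τ
    rw [Derivation.leibniz_div, Derivation.leibniz_div, Der.map_mul, map_sub, map_sub, hDt, hEt,
      hDF _ (c τ).2, hDF _ τ.2, hDF _ (hEF _ τ.2)]
    simp only [smul_eq_mul]
    field_simp
    ring
  have hc' := DFunLike.congr_fun (eq_zero_of_derivation_eq_sum ht hDF hDt hG hDG) ρ
  rw [Finsupp.mapRange_apply] at hc'
  exact congrArg Subtype.val hc'

variable [CharZero Ω] [IsAlgClosed Ω] {σ : Type*} {d : σ → Der Ω} {k : Subfield Ω} {x : σ → Ω}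

theorem IsCoordinateSystem.exists_mem_logForms_apply_eq (hx : IsCoordinateSystem d k x)
    {s : Finset σ} {a : σ} (ha : a ∉ s) {α : σ → Ω}
    (hα : ∀ i, α i ∈ coordField k x (insert a s)) (hcl : ∀ i j, d i (α j) = d j (α i)) :
    ∃ β ∈ logForms d k (coordField k x (insert a s)), β a = α a := by
  set F := algClosure (coordField k x s)
  have _ : IsAlgClosed F := isAlgClosed_of_forall_mem fun _ => mem_algClosure_of_isAlgebraic
  have ht : Transcendental F (x a) := hx.transcendental ha
  have hdF (b : Ω) (hb : b ∈ F) : d a b = 0 := hx.derivation_algClosure_eq_zero ha hb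
  have hFt : coordField k x (insert a s) ≤ F⟮x a⟯.toSubfield :=
    coordField_insert_le (le_algClosure _)
  obtain ⟨R, hR, c, hc⟩ := exists_primitive_add_sum ht hdF (hx.apply_self a) (hFt (hα a))
  have hres (ρ : F) (i : σ) : d i (c ρ) = 0 := by
    rcases eq_or_ne i a with rfl | hi
    · exact hdF _ (c ρ).2
    · exact derivation_residue_eq_zero ht (hx.comm i a) hdF (hx.apply_self a)
        (hx.isStable_coordField.algClosure i) (hx.apply_of_ne hi) hR (hFt (hα i))
        (hc ▸ hcl a i) ρ
  have hck (ρ : F) : (c ρ : Ω) ∈ k :=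
    mem_of_isAlgebraic_of_constant hx.mem_of_isAlgebraic hx.isStable_coordField
      (fun _ => hx.mem_of_forall_derivation_eq_zero s) (mem_algClosure.1 (c ρ).2) (hres ρ)
  let β : σ → Ω := (fun i => d i R) +
    ∑ ρ ∈ c.support, fun i => (c ρ : Ω) * (d i (x a - ρ) / (x a - ρ))
  have hβ : β ∈ logForms d k F⟮x a⟯.toSubfield := add_mem (exact_mem_logForms hR)
    (sum_mem fun ρ _ => dlog_mem_logForms (hck ρ)
      (sub_mem (IntermediateField.mem_adjoin_simple_self F _) (F⟮x a⟯.algebraMap_mem ρ))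
      (sub_ne_zero_of_transcendental ht ρ))
  have hβa : β a = α a := by
    rw [hc, Finsupp.sum]
    simp only [β, Pi.add_apply, Finset.sum_apply, map_sub, hx.apply_self,
      hdF _ (Subtype.property _), sub_zero, mul_one_div]
  exact ⟨_, average_mem_logForms hx.isStable_coordField le_coordField
    (logForms_mono adjoin_le_algClosure_coordField hβ), by rw [hβa, average_of_mem (hα a)]⟩

theorem IsCoordinateSystem.mem_logForms_of_closed (hx : IsCoordinateSystem d k x) (s : Finset σ)
    {α : σ → Ω} (hα : ∀ i, α i ∈ coordField k x s) (hα₀ : ∀ i ∉ s, α i = 0)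
    (hcl : ∀ i j, d i (α j) = d j (α i)) : α ∈ logForms d k (coordField k x s) := by
  classical
  induction s using Finset.induction_on generalizing α with
  | empty => exact (funext fun i => hα₀ i (Finset.notMem_empty i) : α = 0) ▸ zero_mem _
  | insert a s ha ih =>
    rw [Finset.coe_insert] at hα ⊢
    obtain ⟨β, hβ, hβa⟩ := hx.exists_mem_logForms_apply_eq ha hα hcl
    have hγcl (i j : σ) : d i (α j - β j) = d j (α i - β i) := by
      rw [map_sub, map_sub, hcl, logForms_closed hx.comm hx.apply_constant hβ]
    have hγa : α a - β a = 0 := sub_eq_zero.2 hβa.symm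
    have hγ : (fun i => α i - β i) ∈ logForms d k (coordField k x s) := by
      refine ih (fun i => ?_) (fun i hi => ?_) hγcl
      · refine hx.mem_coordField_of_insert ha (sub_mem (hα i)
          (apply_mem_of_mem_logForms le_coordField (hx.isStable_coordField i) hβ)) ?_
        rw [hγcl, hγa, map_zero]
      · rcases eq_or_ne i a with rfl | hia
        · exact hγa
        · have hi' : i ∉ insert a s := fun h => (Finset.mem_insert.1 h).elim hia hi
          rw [hα₀ i hi', apply_eq_zero_of_mem_logForms (fun y hy => hx.derivation_eq_zero
            (s := insert a s) (by rwa [← Finset.coe_insert]) hy) hβ, sub_zero]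
    have hmono : coordField k x s ≤ coordField k x (insert a s) :=
      coordField_le le_coordField fun i hi => mem_coordField (Or.inr hi)
    have hdecomp : α = (fun i => α i - β i) + β := (sub_add_cancel α β).symm
    exact hdecomp ▸ add_mem (logForms_mono hmono hγ) hβ

end ClosedForms

section LiouvilleTower

open scoped IntermediateField

variable {Ω σ : Type*} [Field Ω] {d : σ → Der Ω} {S₀ S : Subfield Ω}

/-- `S` is obtained from `S₀` by finitely many steps, each of which adjoins a primitive or an
exponential of a primitive and then passes to the algebraic closure. -/
inductive IsLiouvilleTower (d : σ → Der Ω) (S₀ : Subfield Ω) : Subfield Ω → Prop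
  | base : IsLiouvilleTower d S₀ S₀
  | step (S : Subfield Ω) (t : Ω) : IsLiouvilleTower d S₀ S → Transcendental S t →
      ((∀ i, d i t ∈ S) ∨ (∀ i, d i t / t ∈ S)) →
      IsLiouvilleTower d S₀ (algClosure S⟮t⟯.toSubfield)

namespace IsLiouvilleTower

theorem le (h : IsLiouvilleTower d S₀ S) : S₀ ≤ S := by
  induction h with
  | base => exact le_rfl
  | step S t _ _ _ ih =>
    exact fun a ha => le_algClosure _ (S⟮t⟯.algebraMap_mem ⟨a, ih ha⟩)

theorem mem_of_isAlgebraic (h : IsLiouvilleTower d S₀ S)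
    (hc₀ : ∀ x : Ω, IsAlgebraic S₀ x → x ∈ S₀) {x : Ω} (hx : IsAlgebraic S x) : x ∈ S := by
  cases h with
  | base => exact hc₀ x hx
  | step => exact mem_algClosure_of_isAlgebraic hx

theorem isStable [CharZero Ω] (h : IsLiouvilleTower d S₀ S) (h₀ : IsStable d S₀) :
    IsStable d S := by
  induction h with
  | base => exact h₀
  | step S t _ ht htS ih =>
    have hS (a : Ω) (ha : a ∈ S) : a ∈ S⟮t⟯ := S⟮t⟯.algebraMap_mem ⟨a, ha⟩
    have ht₀ : t ≠ 0 := fun h => ht (h ▸ isAlgebraic_zero)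
    refine IsStable.algClosure fun i x hx =>
      derivation_mem_adjoin (d i) (fun a => hS _ (ih i a a.2)) ?_ hx
    rcases htS with h | h
    · exact hS _ (h i)
    · exact div_mul_cancel₀ (d i t) ht₀ ▸
        mul_mem (hS _ (h i)) (IntermediateField.mem_adjoin_simple_self S t)

theorem hasTriangularSystem [Fintype σ] [CharZero Ω] [IsAlgClosed Ω] {P : σ → Ω} {k₀ : σ}
    (h : IsLiouvilleTower d S₀ S) (hd : ∀ i j a, d i (d j a) = d j (d i a)) (h₀ : IsStable d S₀)
    (hc₀ : ∀ x : Ω, IsAlgebraic S₀ x → x ∈ S₀) (hP : ∀ j, P j ∈ S₀)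
    (H : HasTriangularSystem d P k₀ S) :
    HasTriangularSystem d P k₀ S₀ := by
  induction h with
  | base => exact H
  | step S t hS ht htS ih =>
    exact ih (H.descend hd (hS.isStable h₀) (fun _ => hS.mem_of_isAlgebraic hc₀) ht htS
      fun j => hS.le (hP j))

theorem exists_adjoin (h : IsLiouvilleTower d S₀ S) (hc₀ : ∀ x : Ω, IsAlgebraic S₀ x → x ∈ S₀)
    {t : Ω} (ht : (∀ i, d i t ∈ S) ∨ (∀ i, d i t / t ∈ S)) :
    ∃ S', IsLiouvilleTower d S₀ S' ∧ S ≤ S' ∧ t ∈ S' := by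
  by_cases htr : IsAlgebraic S t
  · exact ⟨S, h, le_rfl, h.mem_of_isAlgebraic hc₀ htr⟩
  · exact ⟨_, h.step S t htr ht, fun a ha => le_algClosure _ (S⟮t⟯.algebraMap_mem ⟨a, ha⟩),
      le_algClosure _ (IntermediateField.mem_adjoin_simple_self S t)⟩

end IsLiouvilleTower

end LiouvilleTower

section Embedding

open scoped IntermediateField

theorem map_mem_of_mem_adjoin {K M Ω : Type*} [Field K] [Field M] [Algebra K M] [Field Ω]
    (f : M →+* Ω) {S : Subfield Ω} {t x : M} (hK : ∀ a : K, f (algebraMap K M a) ∈ S)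
    (ht : f t ∈ S) (hx : x ∈ K⟮t⟯) : f x ∈ S := by
  induction hx using IntermediateField.adjoin_induction with
  | mem x hx => rwa [Set.mem_singleton_iff.1 hx]
  | algebraMap a => exact hK a
  | add x y _ _ h1 h2 => exact map_add f x y ▸ add_mem h1 h2
  | inv x _ h => exact map_inv₀ f x ▸ inv_mem h
  | mul x y _ _ h1 h2 => exact map_mul f x y ▸ mul_mem h1 h2

variable {n : ℕ} {M Ω : Type*} [Field M] [Algebra (RatField n) M] [Field Ω] [Algebra M Ω]
  {𝒟 : DiffExtension n M} {d : Fin n → Der Ω} {S₀ S : Subfield Ω}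

namespace IsLiouvilleTower

theorem exists_of_isLiouvillianStep
    (hdδ : ∀ i a, d i (algebraMap M Ω a) = algebraMap M Ω (𝒟.δ i a))
    (hc₀ : ∀ x : Ω, IsAlgebraic S₀ x → x ∈ S₀) (h : IsLiouvilleTower d S₀ S)
    {E F : IntermediateField (RatField n) M} (hE : ∀ a ∈ E, algebraMap M Ω a ∈ S)
    (hEF : IsLiouvillianStep 𝒟 E F) :
    ∃ S', IsLiouvilleTower d S₀ S' ∧ S ≤ S' ∧ ∀ a ∈ F, algebraMap M Ω a ∈ S' := by
  obtain ⟨hle, hstep⟩ := hEF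
  have hadjoin (t : M) (ht : IntermediateField.extendScalars hle = E⟮t⟯)
      (htS : (∀ i, d i (algebraMap M Ω t) ∈ S) ∨
        (∀ i, d i (algebraMap M Ω t) / algebraMap M Ω t ∈ S)) :
      ∃ S', IsLiouvilleTower d S₀ S' ∧ S ≤ S' ∧ ∀ a ∈ F, algebraMap M Ω a ∈ S' := by
    obtain ⟨S', hS', hSS', htS'⟩ := h.exists_adjoin hc₀ htS
    exact ⟨S', hS', hSS', fun a ha => map_mem_of_mem_adjoin (K := E) (algebraMap M Ω)
      (fun c => hSS' (hE c c.2)) htS' (ht ▸ ha)⟩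
  rcases hstep with hfin | ⟨t, _, ht, htE⟩ | ⟨t, _, ht, htE⟩
  · refine ⟨S, h, le_rfl, fun a ha => h.mem_of_isAlgebraic hc₀ ?_⟩
    have haE : IsAlgebraic E a := (Algebra.IsAlgebraic.isAlgebraic (R := E)
      (⟨a, ha⟩ : IntermediateField.extendScalars hle)).algebraMap (A := M)
    let f : E →+* S := ((algebraMap M Ω).comp (algebraMap E M)).codRestrict S fun c => hE c c.2
    exact haE.ringHom_of_comp_eq f (algebraMap M Ω) f.injective rfl
  · exact hadjoin t ht (Or.inr fun i => by
      rw [hdδ, ← map_div₀]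
      exact hE _ (htE i))
  · exact hadjoin t ht (Or.inl fun i => hdδ i t ▸ hE _ (htE i))

theorem exists_of_isLiouvillian
    (hdδ : ∀ i a, d i (algebraMap M Ω a) = algebraMap M Ω (𝒟.δ i a))
    (hc₀ : ∀ x : Ω, IsAlgebraic S₀ x → x ∈ S₀)
    (hR : ∀ a : RatField n, algebraMap M Ω (algebraMap _ M a) ∈ S₀) (h : IsLiouvilleTower d S₀ S)
    {a : M} (ha : IsLiouvillian 𝒟 a) :
    ∃ S', IsLiouvilleTower d S₀ S' ∧ S ≤ S' ∧ algebraMap M Ω a ∈ S' := by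
  obtain ⟨L, ⟨r, K, hK₀, rfl, _, hstep⟩, haL⟩ := ha
  have hreach : ∀ m ≤ r, ∃ S', IsLiouvilleTower d S₀ S' ∧ S ≤ S' ∧
      ∀ a ∈ K m, algebraMap M Ω a ∈ S' := by
    intro m
    induction m with
    | zero =>
      refine fun _ => ⟨S, h, le_rfl, fun a ha => ?_⟩
      rw [hK₀] at ha
      obtain ⟨b, rfl⟩ := IntermediateField.mem_bot.1 ha
      exact h.le (hR b)
    | succ m ih =>
      intro hm
      obtain ⟨S₁, hS₁, hle₁, hmem₁⟩ := ih (Nat.le_of_succ_le hm)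
      obtain ⟨S₂, hS₂, hle₂, hmem₂⟩ := hS₁.exists_of_isLiouvillianStep hdδ hc₀ hmem₁ (hstep m hm)
      exact ⟨S₂, hS₂, hle₁.trans hle₂, hmem₂⟩
  obtain ⟨S', hS', hle, hmem⟩ := hreach r le_rfl
  exact ⟨S', hS', hle, hmem a haL⟩

theorem exists_of_forall_isLiouvillian {ι : Type*} [Finite ι]
    (hdδ : ∀ i a, d i (algebraMap M Ω a) = algebraMap M Ω (𝒟.δ i a))
    (hc₀ : ∀ x : Ω, IsAlgebraic S₀ x → x ∈ S₀)
    (hR : ∀ a : RatField n, algebraMap M Ω (algebraMap _ M a) ∈ S₀) {H : ι → M}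
    (hH : ∀ j, IsLiouvillian 𝒟 (H j)) :
    ∃ S, IsLiouvilleTower d S₀ S ∧ ∀ j, algebraMap M Ω (H j) ∈ S := by
  have hreach (s : Set ι) (hs : s.Finite) :
      ∃ S, IsLiouvilleTower d S₀ S ∧ ∀ j ∈ s, algebraMap M Ω (H j) ∈ S := by
    induction s, hs using Set.Finite.induction_on with
    | empty => exact ⟨S₀, .base, fun _ hj => hj.elim⟩
    | insert _ _ ih =>
      obtain ⟨S, hS, hmem⟩ := ih
      obtain ⟨S', hS', hle, hj⟩ := hS.exists_of_isLiouvillian hdδ hc₀ hR (hH _)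
      exact ⟨S', hS', fun l hl => hl.elim (fun h => h ▸ hj) fun h => hle (hmem l h)⟩
  obtain ⟨S, hS, hmem⟩ := hreach Set.univ Set.finite_univ
  exact ⟨S, hS, fun j => hmem j (Set.mem_univ j)⟩

end IsLiouvilleTower

end Embedding

section RationalForms

open MvPolynomial

variable {σ 𝕜 F : Type*} [Field 𝕜] [Field F]

/-- The irreducible polynomial `f` is the chosen representative of its class of associates, so that
distinct such polynomials are not associated. -/
def IsPrimeRepresentative (f : MvPolynomial σ 𝕜) : Prop :=
  Irreducible f ∧ Quot.out (Associates.mk f) = f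

theorem IsPrimeRepresentative.eq_of_associated {f g : MvPolynomial σ 𝕜}
    (hf : IsPrimeRepresentative f) (hg : IsPrimeRepresentative g) (h : Associated f g) : f = g := by
  rw [← hf.2, ← hg.2, Associates.mk_eq_mk_iff_associated.2 h]

theorem exists_isPrimeRepresentative {p : MvPolynomial σ 𝕜} (hp : Irreducible p) :
    ∃ f, IsPrimeRepresentative f ∧ Associated f p := by
  have hmk : Associates.mk (Quot.out (Associates.mk p)) = Associates.mk p := Quot.out_eq _
  have hass := Associates.mk_eq_mk_iff_associated.1 hmk
  exact ⟨_, ⟨hass.symm.irreducible hp, congrArg Quot.out hmk⟩, hass⟩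

/-- The `i`-th coefficient of the form `∑ e(f) df / f`, read in the field `F` through `A`. -/
noncomputable def dlogSum (A : MvPolynomial σ 𝕜 →+* F) (e : MvPolynomial σ 𝕜 →₀ 𝕜) (i : σ) : F :=
  e.sum fun f c => A (C c) * (A (pderiv i f) / A f)

variable {A : MvPolynomial σ 𝕜 →+* F}

theorem dlogSum_add (e e' : MvPolynomial σ 𝕜 →₀ 𝕜) (i : σ) :
    dlogSum A (e + e') i = dlogSum A e i + dlogSum A e' i :=
  Finsupp.sum_add_index' (fun f => by rw [C_0, map_zero, zero_mul]) fun f c c' => by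
    rw [C_add, map_add, add_mul]

theorem dlogSum_zero (i : σ) : dlogSum A 0 i = 0 := Finsupp.sum_zero_index

theorem dlogSum_single (f : MvPolynomial σ 𝕜) (c : 𝕜) (i : σ) :
    dlogSum A (Finsupp.single f c) i = A (C c) * (A (pderiv i f) / A f) :=
  Finsupp.sum_single_index (by rw [C_0, map_zero, zero_mul])

theorem forall_mem_support_add {α : Type*} {p : α → Prop} {e e' : α →₀ 𝕜}
    (h : ∀ f ∈ e.support, p f) (h' : ∀ f ∈ e'.support, p f) : ∀ f ∈ (e + e').support, p f := by
  classical
  exact fun f hf => (Finset.mem_union.1 (Finsupp.support_add hf)).elim (h f) (h' f)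

theorem pderiv_eq_zero_of_isUnit {u : MvPolynomial σ 𝕜} (hu : IsUnit u) (i : σ) :
    pderiv i u = 0 := by
  obtain ⟨r, -, rfl⟩ := isUnit_iff_eq_C_of_isReduced.1 hu
  exact pderiv_C

theorem logDeriv_mul (hA : Function.Injective A) {p q : MvPolynomial σ 𝕜} (hp : p ≠ 0) (hq : q ≠ 0)
    (i : σ) : A (pderiv i (p * q)) / A (p * q) = A (pderiv i p) / A p + A (pderiv i q) / A q := by
  have hAp := (map_ne_zero_iff A hA).2 hp
  have hAq := (map_ne_zero_iff A hA).2 hq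
  rw [pderiv_mul, map_add, map_mul, map_mul, map_mul, div_add_div _ _ hAp hAq]

theorem exists_dlogSum_eq (hA : Function.Injective A) (c : 𝕜) {p : MvPolynomial σ 𝕜} (hp : p ≠ 0) :
    ∃ e : MvPolynomial σ 𝕜 →₀ 𝕜, (∀ f ∈ e.support, IsPrimeRepresentative f) ∧
      ∀ i, A (C c) * (A (pderiv i p) / A p) = dlogSum A e i := by
  induction p using WfDvdMonoid.induction_on_irreducible with
  | zero => exact absurd rfl hp
  | unit u hu =>
    refine ⟨0, fun f hf => absurd rfl (Finsupp.mem_support_iff.1 hf), fun i => ?_⟩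
    rw [pderiv_eq_zero_of_isUnit hu, map_zero, zero_div, mul_zero, dlogSum_zero]
  | mul a p ha hirr ih =>
    obtain ⟨e, he, h⟩ := ih ha
    obtain ⟨f, hf, u, rfl⟩ := exists_isPrimeRepresentative hirr
    refine ⟨Finsupp.single f c + e, forall_mem_support_add (fun g hg => ?_) he, fun i => ?_⟩
    · exact Finset.mem_singleton.1 (Finsupp.support_single_subset hg) ▸ hf
    · rw [dlogSum_add, dlogSum_single, ← h, logDeriv_mul hA hirr.ne_zero ha,
        logDeriv_mul hA hf.1.ne_zero u.ne_zero, pderiv_eq_zero_of_isUnit u.isUnit, map_zero,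
        zero_div, add_zero, mul_add]

/-- The `i`-th logarithmic derivative of the Darboux function `exp (g / h) * ∏ f ^ e(f)`, read in
the field `F` through `A`. The junk value `x / 0 = 0` intervenes where `A` annihilates `h` or one of
the `f`. -/
noncomputable def darbouxGradient (A : MvPolynomial σ 𝕜 →+* F) (g h : MvPolynomial σ 𝕜)
    (e : MvPolynomial σ 𝕜 →₀ 𝕜) (i : σ) : F :=
  (A (pderiv i g) * A h - A g * A (pderiv i h)) / A h ^ 2 + dlogSum A e i

/-- The equation `∑ Pᵢ ∂ᵢJ / J = -div P`, read in the field `F` through `A`, by which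
`J = exp (g / h) * ∏ f ^ e(f)` is a Jacobian multiplier of the vector field `P`. -/
def IsDarbouxMultiplier [Fintype σ] (A : MvPolynomial σ 𝕜 →+* F) (P : σ → MvPolynomial σ 𝕜)
    (g h : MvPolynomial σ 𝕜) (e : MvPolynomial σ 𝕜 →₀ 𝕜) : Prop :=
  ∑ i, A (P i) * darbouxGradient A g h e i = -∑ i, A (pderiv i (P i))

/-- The common denominator of the logarithmic derivatives of `exp (g / h) * ∏ f ^ e(f)`. -/
noncomputable def darbouxDenominator (h : MvPolynomial σ 𝕜) (e : MvPolynomial σ 𝕜 →₀ 𝕜) :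
    MvPolynomial σ 𝕜 :=
  h ^ 2 * ∏ f ∈ e.support, f

open Classical in
/-- The numerator of the `i`-th logarithmic derivative of `exp (g / h) * ∏ f ^ e(f)` over
`darbouxDenominator h e`. -/
noncomputable def darbouxNumerator (g h : MvPolynomial σ 𝕜) (e : MvPolynomial σ 𝕜 →₀ 𝕜) (i : σ) :
    MvPolynomial σ 𝕜 :=
  (pderiv i g * h - g * pderiv i h) * ∏ f ∈ e.support, f +
    h ^ 2 * ∑ f ∈ e.support, C (e f) * pderiv i f * ∏ f' ∈ e.support.erase f, f'

theorem map_darbouxDenominator_mul {g h : MvPolynomial σ 𝕜} {e : MvPolynomial σ 𝕜 →₀ 𝕜}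
    (hh : A h ≠ 0) (hf : ∀ f ∈ e.support, A f ≠ 0) (i : σ) :
    A (darbouxDenominator h e) * darbouxGradient A g h e i = A (darbouxNumerator g h e i) := by
  classical
  have hdlog : A (∏ f ∈ e.support, f) * dlogSum A e i =
      A (∑ f ∈ e.support, C (e f) * pderiv i f * ∏ f' ∈ e.support.erase f, f') := by
    rw [dlogSum, Finsupp.sum, Finset.mul_sum, map_sum]
    refine Finset.sum_congr rfl fun f hfe => ?_
    have hAf := hf f hfe
    rw [← Finset.mul_prod_erase _ _ hfe, map_mul, map_mul, map_mul]
    field_simp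
  have hfrac : A h ^ 2 * ((A (pderiv i g) * A h - A g * A (pderiv i h)) / A h ^ 2) =
      A (pderiv i g) * A h - A g * A (pderiv i h) := mul_div_cancel₀ _ (pow_ne_zero 2 hh)
  rw [darbouxNumerator, darbouxDenominator, darbouxGradient]
  simp only [map_add, map_mul, map_sub, map_pow]
  linear_combination A (∏ f ∈ e.support, f) * hfrac + A h ^ 2 * hdlog

theorem isDarbouxMultiplier_iff [Fintype σ] {P : σ → MvPolynomial σ 𝕜} {g h : MvPolynomial σ 𝕜}
    {e : MvPolynomial σ 𝕜 →₀ 𝕜} (hh : A h ≠ 0) (hf : ∀ f ∈ e.support, A f ≠ 0) :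
    IsDarbouxMultiplier A P g h e ↔ A (∑ i, P i * darbouxNumerator g h e i +
      darbouxDenominator h e * ∑ i, pderiv i (P i)) = 0 := by
  have hD : A (darbouxDenominator h e) ≠ 0 := by
    rw [darbouxDenominator, map_mul, map_pow, map_prod]
    exact mul_ne_zero (pow_ne_zero 2 hh) (Finset.prod_ne_zero_iff.2 hf)
  have hnum (i : σ) : A (P i * darbouxNumerator g h e i) =
      A (darbouxDenominator h e) * (A (P i) * darbouxGradient A g h e i) := by
    rw [map_mul, ← map_darbouxDenominator_mul hh hf, mul_left_comm]
  rw [map_add, map_sum, Finset.sum_congr rfl fun i _ => hnum i, ← Finset.mul_sum, map_mul, map_sum,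
    ← mul_add, mul_eq_zero_iff_left hD, IsDarbouxMultiplier, eq_neg_iff_add_eq_zero]

/- Without its denominators the equation is a polynomial identity, which may be evaluated. -/
theorem IsDarbouxMultiplier.of_injective [Fintype σ] {P : σ → MvPolynomial σ 𝕜}
    {g h : MvPolynomial σ 𝕜} {e : MvPolynomial σ 𝕜 →₀ 𝕜} (H : IsDarbouxMultiplier A P g h e)
    (hA : Function.Injective A) {F' : Type*} [Field F'] {A' : MvPolynomial σ 𝕜 →+* F'}
    (hh : A' h ≠ 0) (hf : ∀ f ∈ e.support, A' f ≠ 0) : IsDarbouxMultiplier A' P g h e := by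
  have hne {p : MvPolynomial σ 𝕜} (hp : A' p ≠ 0) : A p ≠ 0 :=
    (map_ne_zero_iff A hA).2 fun h => hp (h ▸ map_zero A')
  rw [isDarbouxMultiplier_iff (hne hh) fun f hfe => hne (hf f hfe), map_eq_zero_iff A hA] at H
  rw [isDarbouxMultiplier_iff hh hf, H, map_zero]

end RationalForms

section PolynomialCoordinates

open MvPolynomial

theorem mem_fieldRange_of_isAlgebraic {F Ω : Type*} [Field F] [IsAlgClosed F] [Field Ω]
    (f : F →+* Ω) {x : Ω} (hx : IsAlgebraic f.fieldRange x) : x ∈ f.fieldRange := by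
  obtain ⟨p, hp, hpx⟩ := hx
  let q : Polynomial F := p.map f.rangeRestrictFieldEquiv.symm.toRingHom
  have hq : q.map f = p.map (algebraMap f.fieldRange Ω) := by
    rw [Polynomial.map_map]
    congr 1
    ext y
    exact congrArg Subtype.val (f.rangeRestrictFieldEquiv.apply_symm_apply y)
  have hroot : x ∈ (q.map f).roots := by rwa [hq, Polynomial.mem_roots_map hp]
  rw [(IsAlgClosed.splits q).roots_map, Multiset.mem_map] at hroot
  obtain ⟨y, -, rfl⟩ := hroot
  exact ⟨y, rfl⟩

variable {σ 𝕜 Ω : Type*} [Field 𝕜] [Field Ω] {A : MvPolynomial σ 𝕜 →+* Ω} {d : σ → Der Ω}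

theorem isCoordinateSystem_map_X [IsAlgClosed 𝕜] (hd : ∀ i j a, d i (d j a) = d j (d i a))
    (hdA : ∀ i p, d i (A p) = A (pderiv i p)) :
    IsCoordinateSystem d (A.comp C).fieldRange fun i => A (X i) where
  comm := hd
  apply_constant := by
    rintro i _ ⟨c, rfl⟩
    rw [RingHom.comp_apply, hdA, pderiv_C, map_zero]
  mem_of_isAlgebraic _ := mem_fieldRange_of_isAlgebraic _
  apply_self i := by rw [hdA, pderiv_X_self, map_one]
  apply_of_ne h := by rw [hdA, pderiv_X_of_ne h.symm, map_zero]

theorem map_mem_coordField (p : MvPolynomial σ 𝕜) :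
    A p ∈ coordField (A.comp C).fieldRange (fun i => A (X i)) Set.univ := by
  induction p using MvPolynomial.induction_on with
  | C c => exact le_coordField ⟨c, rfl⟩
  | add p q h1 h2 => exact map_add A p q ▸ add_mem h1 h2
  | mul_X p i h =>
    exact map_mul A p (X i) ▸ mul_mem h (mem_coordField (x := fun i => A (X i)) (Set.mem_univ i))

theorem exists_eq_div_of_mem_coordField (hA : Function.Injective A) {y : Ω}
    (hy : y ∈ coordField (A.comp C).fieldRange (fun i => A (X i)) Set.univ) :
    ∃ g h : MvPolynomial σ 𝕜, h ≠ 0 ∧ IsRelPrime g h ∧ y = A g / A h := by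
  let φ : FractionRing (MvPolynomial σ 𝕜) →+* Ω := IsFractionRing.lift hA
  have hφ (p : MvPolynomial σ 𝕜) : φ (algebraMap _ _ p) = A p := IsFractionRing.lift_algebraMap hA p
  have hle : coordField (A.comp C).fieldRange (fun i => A (X i)) Set.univ ≤ φ.fieldRange :=
    coordField_le (fun _ ⟨c, hc⟩ => ⟨algebraMap _ _ (C c), (hφ _).trans hc⟩)
      fun i _ => ⟨algebraMap _ _ (X i), hφ _⟩
  obtain ⟨R, rfl⟩ := hle hy
  refine ⟨IsFractionRing.num (MvPolynomial σ 𝕜) R, IsFractionRing.den (MvPolynomial σ 𝕜) R,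
    nonZeroDivisors.coe_ne_zero _, IsFractionRing.num_den_reduced _ _, ?_⟩
  rw [← hφ, ← hφ, ← map_div₀, ← IsFractionRing.mk'_eq_div, IsFractionRing.mk'_num_den]

theorem exists_exact_add_dlogSum (hA : Function.Injective A)
    (hdA : ∀ i p, d i (A p) = A (pderiv i p)) {k S : Subfield Ω} {α : σ → Ω}
    (hk : k = (A.comp C).fieldRange) (hS : S = coordField k (fun i => A (X i)) Set.univ)
    (hα : α ∈ logForms d k S) :
    ∃ R ∈ S, ∃ e : MvPolynomial σ 𝕜 →₀ 𝕜, (∀ f ∈ e.support, IsPrimeRepresentative f) ∧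
      ∀ i, α i = d i R + dlogSum A e i := by
  subst hk hS
  have hsupp (f) (hf : f ∈ (0 : MvPolynomial σ 𝕜 →₀ 𝕜).support) : IsPrimeRepresentative f :=
    absurd rfl (Finsupp.mem_support_iff.1 hf)
  induction hα using AddSubmonoid.closure_induction with
  | mem α h =>
    rcases h with ⟨R, hR, rfl⟩ | ⟨_, ⟨c, rfl⟩, a, ha, ha₀, rfl⟩
    · exact ⟨R, hR, 0, hsupp, fun i => by rw [dlogSum_zero, add_zero]⟩
    · obtain ⟨p, q, hq, -, rfl⟩ := exists_eq_div_of_mem_coordField hA ha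
      have hp : p ≠ 0 := fun h => ha₀ (by rw [h, map_zero, zero_div])
      obtain ⟨e, he, h⟩ := exists_dlogSum_eq hA c hp
      obtain ⟨e', he', h'⟩ := exists_dlogSum_eq hA (-c) hq
      refine ⟨0, zero_mem _, e + e', forall_mem_support_add he he', fun i => ?_⟩
      have hAp := (map_ne_zero_iff A hA).2 hp
      have hAq := (map_ne_zero_iff A hA).2 hq
      beta_reduce
      rw [dlogSum_add, ← h, ← h', map_zero, Derivation.leibniz_div, hdA, hdA, C_neg, map_neg,
        smul_eq_mul, RingHom.comp_apply]
      field_simp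
      ring
  | zero => exact ⟨0, zero_mem _, 0, hsupp, fun i => by
      rw [Pi.zero_apply, map_zero, dlogSum_zero, add_zero]⟩
  | add α β _ _ h1 h2 =>
    obtain ⟨R, hR, e, he, h1⟩ := h1
    obtain ⟨R', hR', e', he', h2⟩ := h2
    refine ⟨R + R', add_mem hR hR', e + e', forall_mem_support_add he he', fun i => ?_⟩
    rw [Pi.add_apply, h1, h2, map_add, dlogSum_add, add_add_add_comm]

theorem exists_darbouxGradient_eq [Finite σ] [IsAlgClosed 𝕜] [CharZero Ω] [IsAlgClosed Ω]
    (hA : Function.Injective A) (hd : ∀ i j a, d i (d j a) = d j (d i a))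
    (hdA : ∀ i p, d i (A p) = A (pderiv i p)) {α : σ → Ω}
    (hα : ∀ i, α i ∈ coordField (A.comp C).fieldRange (fun i => A (X i)) Set.univ)
    (hcl : ∀ i j, d i (α j) = d j (α i)) :
    ∃ (g h : MvPolynomial σ 𝕜) (e : MvPolynomial σ 𝕜 →₀ 𝕜), h ≠ 0 ∧ IsRelPrime g h ∧
      (∀ f ∈ e.support, IsPrimeRepresentative f) ∧ α = darbouxGradient A g h e := by
  cases nonempty_fintype σ
  have hlog := (isCoordinateSystem_map_X hd hdA).mem_logForms_of_closed Finset.univ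
    (fun i => Finset.coe_univ (α := σ) ▸ hα i) (fun i hi => absurd (Finset.mem_univ i) hi) hcl
  rw [Finset.coe_univ] at hlog
  obtain ⟨R, hR, e, he, hαe⟩ := exists_exact_add_dlogSum hA hdA rfl rfl hlog
  obtain ⟨g, h, hh, hgh, rfl⟩ := exists_eq_div_of_mem_coordField hA hR
  refine ⟨g, h, e, hh, hgh, he, funext fun i => ?_⟩
  rw [hαe, darbouxGradient, Derivation.leibniz_div, hdA, hdA]
  simp only [smul_eq_mul]
  ring

end PolynomialCoordinates

section ExistsForm

theorem exists_commuting_derivation_extension (M Ω : Type*) {σ : Type*} [Field M] [Field Ω]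
    [Algebra M Ω] [CharZero M] [Algebra.IsAlgebraic M Ω] (δ : σ → Der M)
    (hδ : ∀ i j a, δ i (δ j a) = δ j (δ i a)) :
    ∃ d : σ → Der Ω, (∀ i j a, d i (d j a) = d j (d i a)) ∧
      ∀ i a, d i (algebraMap M Ω a) = algebraMap M Ω (δ i a) := by
  choose d hdδ using fun i => exists_derivation_extension M Ω (δ i)
  refine ⟨d, fun i j a => ?_, hdδ⟩
  have hbracket := map_derivation_of_isAlgebraic (A := M) (RingHom.id Ω) ⁅d i, d j⁆ 0
    (fun a => by simp only [Derivation.commutator_apply, RingHom.id_apply, Derivation.zero_apply,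
      hdδ, hδ i j, sub_self]) (Algebra.IsAlgebraic.isAlgebraic (R := M) a)
  exact sub_eq_zero.1 hbracket.symm

variable {σ Ω : Type*} [Fintype σ] [Field Ω] [CharZero Ω] [IsAlgClosed Ω] {d : σ → Der Ω}
  {P : σ → Ω} {k₀ : σ} {S : Subfield Ω}

theorem HasTriangularSystem.exists_form (H : HasTriangularSystem d P k₀ (algClosure S))
    (hd : ∀ i j a, d i (d j a) = d j (d i a)) (hS : IsStable d S) (hPS : ∀ j, P j ∈ S)
    (hP : P k₀ ≠ 0) :
    ∃ α : σ → Ω, (∀ i, α i ∈ S) ∧ (∀ i j, d i (α j) = d j (α i)) ∧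
      ∑ j, P j * α j = -∑ j, d j (P j) := by
  obtain ⟨ι, _, ρ, B, h, H⟩ := H
  have hS' : IsStable d (algClosure S) := hS.algClosure
  let d' (i : σ) : Der (algClosure S) := (d i).restrict _ (hS' i)
  have hd' (i j : σ) (a : algClosure S) : d' i (d' j a) = d' j (d' i a) := Subtype.ext (hd i j a)
  let P' (j : σ) : algClosure S := ⟨P j, le_algClosure S (hPS j)⟩
  have H' : IsTriangularSystem d' P' k₀ ρ B h :=
    (isTriangularSystem_map_iff (P := P') hd' hd (algClosure S).subtype fun _ _ => rfl).1 H
  obtain ⟨α, hα, hPα⟩ := H'.exists_form hd' fun h => hP (congrArg Subtype.val h)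
  have hPα' : ∑ j, P j * α j = -∑ j, d j (P j) := by
    have hval := congrArg (algClosure S).subtype hPα
    simp only [map_neg, map_sum, map_mul] at hval
    exact hval
  refine ⟨fun i => average S (α i), fun i => average_mem (α i).2, fun i j => ?_, ?_⟩
  · rw [← average_derivation (d i) (hS i) (α j).2, ← average_derivation (d j) (hS j) (α i).2]
    exact congrArg (fun x : algClosure S => average S x) (hα i j)
  · simp only [← average_mul (hPS _)]
    rw [← map_sum, hPα']
    exact average_of_mem (neg_mem (sum_mem fun j _ => hS j _ (hPS j)))

end ExistsForm

section LiouvillianIntegrable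

open MvPolynomial

variable {n : ℕ} {M Ω : Type*} [Field M] [Algebra (RatField n) M] [Field Ω] [Algebra M Ω]
  {𝒟 : DiffExtension n M} {d : Fin n → Der Ω} {P : Fin n → MvPolynomial (Fin n) ℂ} {k₀ : Fin n}

variable (n M Ω) in
/-- The inclusion of `ℂ[x]` into an extension `Ω` of the differential extension `M` of `ℂ(x)`. -/
noncomputable def polyInclusion : MvPolynomial (Fin n) ℂ →+* Ω :=
  ((algebraMap M Ω).comp (algebraMap (RatField n) M)).comp (algebraMap _ (RatField n))

theorem polyInclusion_injective : Function.Injective (polyInclusion n M Ω) :=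
  ((algebraMap M Ω).comp (algebraMap (RatField n) M)).injective.comp
    (IsFractionRing.injective _ (RatField n))

theorem derivation_polyInclusion (hdδ : ∀ i a, d i (algebraMap M Ω a) = algebraMap M Ω (𝒟.δ i a))
    (i : Fin n) (p : MvPolynomial (Fin n) ℂ) :
    d i (polyInclusion n M Ω p) = polyInclusion n M Ω (pderiv i p) :=
  (hdδ i _).trans (congrArg (algebraMap M Ω) (𝒟.extend i p))

variable (n M Ω) in
/-- The image of `ℂ(x)` in an extension `Ω` of the differential extension `M` of `ℂ(x)`, as the
subfield generated by the constants and the coordinates. -/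
noncomputable def rationalSubfield : Subfield Ω :=
  coordField ((polyInclusion n M Ω).comp C).fieldRange (fun i => polyInclusion n M Ω (X i)) Set.univ

theorem polyInclusion_mem_rationalSubfield (p : MvPolynomial (Fin n) ℂ) :
    polyInclusion n M Ω p ∈ rationalSubfield n M Ω :=
  map_mem_coordField p

theorem algebraMap_mem_rationalSubfield (a : RatField n) :
    algebraMap M Ω (algebraMap _ M a) ∈ rationalSubfield n M Ω := by
  obtain ⟨p, q, -, rfl⟩ := IsFractionRing.div_surjective (A := MvPolynomial (Fin n) ℂ) a
  rw [map_div₀, map_div₀]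
  exact div_mem (polyInclusion_mem_rationalSubfield p) (polyInclusion_mem_rationalSubfield q)

theorem hasTriangularSystem_of_isFirstIntegral (hd : ∀ i j a, d i (d j a) = d j (d i a))
    (hdδ : ∀ i a, d i (algebraMap M Ω a) = algebraMap M Ω (𝒟.δ i a)) (hk₀ : P k₀ ≠ 0)
    {H : Fin (n - 1) → M} (hH : ∀ j, IsFirstIntegral 𝒟 P (H j))
    (hind : FunctionallyIndependent 𝒟 H) {S : Subfield Ω} (hHS : ∀ j, algebraMap M Ω (H j) ∈ S) :
    HasTriangularSystem d (fun j => polyInclusion n M Ω (P j)) k₀ S := by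
  let δ (i : Fin n) : Der M := Der.ofAddMonoidHom (𝒟.δ i) (𝒟.leibniz i)
  let P' (j : Fin n) : M := algebraMap (RatField n) M (algebraMap _ _ (P j))
  have hPk₀ : P' k₀ ≠ 0 :=
    (map_ne_zero _).2 ((map_ne_zero_iff _ (IsFractionRing.injective _ (RatField n))).2 hk₀)
  have hcard : Fintype.card (Fin (n - 1)) + 1 = Fintype.card (Fin n) := by
    rw [Fintype.card_fin, Fintype.card_fin, Nat.sub_add_cancel k₀.pos]
  have hM : IsTriangularSystem δ P' k₀ Fin.val 0 H :=
    isTriangularSystem_of_linearIndependent 𝒟.commute hPk₀ Fin.val_injective hcard hH hind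
  refine ⟨Fin (n - 1), inferInstance, Fin.val, 0, fun j => ⟨algebraMap M Ω (H j), hHS j⟩, ?_⟩
  convert (isTriangularSystem_map_iff 𝒟.commute hd (algebraMap M Ω) hdδ).2 hM using 2
  · rfl
  · exact (Matrix.map_zero _ (map_zero _)).trans (Matrix.map_zero _ (map_zero _)).symm
  · rfl

theorem hasTriangularSystem_rationalSubfield [CharZero Ω] [IsAlgClosed Ω]
    (hd : ∀ i j a, d i (d j a) = d j (d i a))
    (hdδ : ∀ i a, d i (algebraMap M Ω a) = algebraMap M Ω (𝒟.δ i a)) (hk₀ : P k₀ ≠ 0)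
    {H : Fin (n - 1) → M} (hH : ∀ j, IsLiouvillian 𝒟 (H j) ∧ IsFirstIntegral 𝒟 P (H j))
    (hind : FunctionallyIndependent 𝒟 H) :
    HasTriangularSystem d (fun j => polyInclusion n M Ω (P j)) k₀
      (algClosure (rationalSubfield n M Ω)) := by
  have hcoord := isCoordinateSystem_map_X hd (derivation_polyInclusion hdδ)
  have hc₀ (x : Ω) (hx : IsAlgebraic (algClosure (rationalSubfield n M Ω)) x) :
      x ∈ algClosure (rationalSubfield n M Ω) := mem_algClosure_of_isAlgebraic hx
  obtain ⟨S, hS, hHS⟩ := IsLiouvilleTower.exists_of_forall_isLiouvillian hdδ hc₀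
    (fun a => le_algClosure _ (algebraMap_mem_rationalSubfield a)) fun j => (hH j).1
  exact hS.hasTriangularSystem hd hcoord.isStable_coordField.algClosure hc₀
    (fun j => le_algClosure _ (polyInclusion_mem_rationalSubfield (P j)))
    (hasTriangularSystem_of_isFirstIntegral hd hdδ hk₀ (fun j => (hH j).2) hind hHS)

theorem IsLiouvillianIntegrable.exists_isDarbouxMultiplier (hP : IsLiouvillianIntegrable.{u} P)
    (hk₀ : P k₀ ≠ 0) :
    ∃ (g h : MvPolynomial (Fin n) ℂ) (e : MvPolynomial (Fin n) ℂ →₀ ℂ), h ≠ 0 ∧ IsRelPrime g h ∧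
      (∀ f ∈ e.support, IsPrimeRepresentative f) ∧
      ∀ x, eval x h ≠ 0 → (∀ f ∈ e.support, eval x f ≠ 0) →
        IsDarbouxMultiplier (eval x) P g h e := by
  obtain ⟨M, _, _, 𝒟, H, hH, hind⟩ := hP
  have _ : CharZero M := charZero_of_injective_algebraMap (algebraMap (RatField n) M).injective
  let Ω := AlgebraicClosure M
  have _ : CharZero Ω := charZero_of_injective_algebraMap (algebraMap M Ω).injective
  obtain ⟨d, hd, hdδ⟩ := exists_commuting_derivation_extension M Ω
    (fun i => Der.ofAddMonoidHom (𝒟.δ i) (𝒟.leibniz i)) 𝒟.commute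
  have hdA := derivation_polyInclusion hdδ
  have htri := hasTriangularSystem_rationalSubfield hd hdδ hk₀ hH hind
  obtain ⟨α, hαS, hαcl, hαP⟩ := htri.exists_form hd
    (isCoordinateSystem_map_X hd hdA).isStable_coordField
    (fun j => polyInclusion_mem_rationalSubfield (P j))
    ((map_ne_zero_iff _ polyInclusion_injective).2 hk₀)
  obtain ⟨g, h, e, hh, hgh, he, rfl⟩ :=
    exists_darbouxGradient_eq polyInclusion_injective hd hdA hαS hαcl
  have hmult : IsDarbouxMultiplier (polyInclusion n M Ω) P g h e := by
    rw [IsDarbouxMultiplier, hαP]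
    simp only [hdA]
  exact ⟨g, h, e, hh, hgh, he, fun x => hmult.of_injective polyInclusion_injective⟩

end LiouvillianIntegrable

section Evaluation

open MeasureTheory MvPolynomial

variable {ι : Type*}

theorem contDiff_eval [Fintype ι] (p : MvPolynomial ι ℂ) {m : WithTop ℕ∞} :
    ContDiff ℂ m fun x : ι → ℂ => eval x p :=
  (AnalyticOnNhd.eval_mvPolynomial p).contDiff

theorem differentiableAt_eval [Finite ι] (p : MvPolynomial ι ℂ) (x : ι → ℂ) :
    DifferentiableAt ℂ (fun y : ι → ℂ => eval y p) x := by
  cases nonempty_fintype ι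
  exact (contDiff_eval p (m := 1)).contDiffAt.differentiableAt one_ne_zero

theorem fderiv_eval [Finite ι] [DecidableEq ι] (p : MvPolynomial ι ℂ) (x : ι → ℂ) (i : ι) :
    fderiv ℂ (fun y : ι → ℂ => eval y p) x (Pi.single i 1) = eval x (pderiv i p) := by
  cases nonempty_fintype ι
  induction p using MvPolynomial.induction_on with
  | C c => simp only [eval_C, pderiv_C, map_zero, fderiv_fun_const, Pi.zero_apply, zero_apply]
  | add p q hp hq =>
    simp only [map_add, fderiv_fun_add (differentiableAt_eval p x) (differentiableAt_eval q x),
      add_apply, hp, hq]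
  | mul_X p j hp =>
    have hj : HasFDerivAt (fun y : ι → ℂ => y j)
        (ContinuousLinearMap.proj j : (ι → ℂ) →L[ℂ] ℂ) x := hasFDerivAt_apply j x
    simp only [map_mul, eval_X, pderiv_mul, map_add, pderiv_X,
      fderiv_fun_mul (differentiableAt_eval p x) hj.differentiableAt, hj.fderiv,
      add_apply, smul_apply, hp, smul_eq_mul, ContinuousLinearMap.proj_apply]
    rcases eq_or_ne j i with rfl | hij
    · simp only [Pi.single_eq_same, map_one]
      ring
    · simp only [Pi.single_eq_of_ne hij, map_zero]
      ring

theorem finite_setOf_eval_cons_eq_zero {R : Type*} [CommRing R] [IsDomain R] {n : ℕ}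
    {p : MvPolynomial (Fin (n + 1)) R} {y : Fin n → R}
    (hy : eval y (finSuccEquiv R n p).leadingCoeff ≠ 0) :
    {t : R | eval (Fin.cons t y : Fin (n + 1) → R) p = 0}.Finite := by
  have hmap : (finSuccEquiv R n p).map (eval y) ≠ 0 := fun h => hy (by
    rw [Polynomial.leadingCoeff, ← Polynomial.coeff_map, h, Polynomial.coeff_zero])
  refine (Polynomial.finite_setOfPred_isRoot hmap).subset fun t ht => ?_
  rwa [Set.mem_ofPred_eq, eval_eq_eval_mv_eval'] at ht

theorem volume_setOf_eval_eq_zero {n : ℕ} {p : MvPolynomial (Fin n) ℂ} (hp : p ≠ 0) :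
    volume {x : Fin n → ℂ | eval x p = 0} = 0 := by
  induction n with
  | zero =>
    obtain ⟨c, rfl⟩ := C_surjective (Fin 0) p
    have hc : c ≠ 0 := fun h => hp (by rw [h, map_zero])
    simp only [eval_C, hc, Set.ofPred_false, measure_empty]
  | succ n ih =>
    let q := finSuccEquiv ℂ n p
    have hq : q ≠ 0 := (map_ne_zero_iff _ (finSuccEquiv ℂ n).injective).2 hp
    let s : Set (ℂ × (Fin n → ℂ)) := {z | eval (Fin.cons z.1 z.2 : Fin (n + 1) → ℂ) p = 0}
    have hs : MeasurableSet s := (isClosed_singleton.preimage ((MvPolynomial.continuous_eval p).comp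
      (continuous_fst.finCons continuous_snd))).measurableSet
    have hpre : (MeasurableEquiv.piFinSuccAbove (fun _ : Fin (n + 1) => ℂ) 0) ⁻¹' s =
        {x : Fin (n + 1) → ℂ | eval x p = 0} := by
      ext x
      change eval (Fin.cons (x 0) (Fin.tail x) : Fin (n + 1) → ℂ) p = 0 ↔ _
      rw [Fin.cons_self_tail, Set.mem_ofPred_eq]
    rw [← hpre, (volume_preserving_piFinSuccAbove _ 0).measure_preimage hs.nullMeasurableSet]
    change (volume.prod volume) s = 0
    have hlead : ∀ᵐ y : Fin n → ℂ, eval y q.leadingCoeff ≠ 0 :=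
      measure_mono_null (fun y hy => not_not.1 hy) (ih (Polynomial.leadingCoeff_ne_zero.2 hq))
    rw [Measure.prod_apply_symm hs, lintegral_eq_zero_iff (measurable_measure_prodMk_right hs)]
    filter_upwards [hlead] with y hy
    exact (finite_setOf_eval_cons_eq_zero hy).measure_zero volume

theorem eq_zero_of_one_add_mul_I_mul_notMem_slitPlane {s t : ℝ} (hst : s ≠ t) {z : ℂ}
    (hs : (1 + s * Complex.I) * z ∉ Complex.slitPlane)
    (ht : (1 + t * Complex.I) * z ∉ Complex.slitPlane) : z = 0 := by
  have him (r : ℝ) (hr : (1 + r * Complex.I) * z ∉ Complex.slitPlane) : z.im + r * z.re = 0 := by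
    rw [Complex.mem_slitPlane_iff, not_or, not_not] at hr
    simpa using hr.2
  have hre : z.re = 0 := (mul_eq_zero.1 (show (s - t) * z.re = 0 by
    linear_combination him s hs - him t ht)).resolve_left (sub_ne_zero.2 hst)
  exact Complex.ext hre (by simpa [hre] using him s hs)

/- The sets of points which are rotated into the cut are disjoint for different rotations, so only
countably many of them have positive measure. -/
theorem exists_mul_mem_slitPlane {X : Type*} [MeasurableSpace X] (μ : Measure X) [SFinite μ]
    {f : X → ℂ} (hf : Measurable f) (h0 : μ {x | f x = 0} = 0) :
    ∃ c : ℂ, c ≠ 0 ∧ μ {x | c * f x ∉ Complex.slitPlane} = 0 := by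
  let c (t : ℝ) : ℂ := 1 + t * Complex.I
  have hc (t : ℝ) : c t ≠ 0 := fun h => by simpa [c] using congrArg Complex.re h
  let B (t : ℝ) : Set X := {x | f x ≠ 0 ∧ c t * f x ∉ Complex.slitPlane}
  have hB (t : ℝ) : MeasurableSet (B t) :=
    (hf (measurableSet_singleton 0)).compl.inter
      ((measurable_const.mul hf) Complex.isOpen_slitPlane.measurableSet).compl
  have hdisj : Pairwise (Function.onFun Disjoint B) := fun s t hst =>
    Set.disjoint_left.2 fun x hs ht =>
      hs.1 (eq_zero_of_one_add_mul_I_mul_notMem_slitPlane hst hs.2 ht.2)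
  have hcount := Measure.countable_meas_pos_of_disjoint_iUnion (μ := μ) hB hdisj
  obtain ⟨t, ht⟩ : ∃ t, t ∉ {t | 0 < μ (B t)} := by
    by_contra! h
    exact Set.not_countable_univ (α := ℝ) (Set.eq_univ_of_forall h ▸ hcount)
  have hBt : μ (B t) = 0 := nonpos_iff_eq_zero.1 (not_lt.1 ht)
  refine ⟨c t, hc t, measure_mono_null (fun x hx => ?_) (measure_union_null h0 hBt)⟩
  exact (em (f x = 0)).imp id fun h => ⟨h, hx⟩

end Evaluation

section DarbouxFunction

open MeasureTheory MvPolynomial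

variable {ι : Type*} {g h : MvPolynomial ι ℂ} {e : MvPolynomial ι ℂ →₀ ℂ}
  {c : MvPolynomial ι ℂ → ℂ}

/-- The branch of `log f` obtained by rotating the values of `f` by `c`. -/
noncomputable def rotatedLog (c : ℂ) (f : MvPolynomial ι ℂ) (x : ι → ℂ) : ℂ :=
  Complex.log (c * eval x f) - Complex.log c

theorem exp_rotatedLog {c : ℂ} (hc : c ≠ 0) {f : MvPolynomial ι ℂ} {x : ι → ℂ}
    (hf : c * eval x f ∈ Complex.slitPlane) : Complex.exp (rotatedLog c f x) = eval x f := by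
  rw [rotatedLog, Complex.exp_sub, Complex.exp_log (Complex.slitPlane_ne_zero hf),
    Complex.exp_log hc, mul_div_cancel_left₀ _ hc]

theorem contDiffAt_rotatedLog [Fintype ι] {c : ℂ} {f : MvPolynomial ι ℂ} {x : ι → ℂ}
    (hf : c * eval x f ∈ Complex.slitPlane) {m : WithTop ℕ∞} :
    ContDiffAt ℂ m (rotatedLog c f) x :=
  ((Complex.contDiffAt_log hf).comp x
    (contDiffAt_const.mul (contDiff_eval f).contDiffAt)).sub contDiffAt_const

theorem fderiv_rotatedLog [Finite ι] [DecidableEq ι] {c : ℂ} {f : MvPolynomial ι ℂ} {x : ι → ℂ}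
    (hf : c * eval x f ∈ Complex.slitPlane) (i : ι) :
    fderiv ℂ (rotatedLog c f) x (Pi.single i 1) = eval x (pderiv i f) / eval x f := by
  cases nonempty_fintype ι
  have hlog : HasFDerivAt (rotatedLog c f) _ x :=
    (((differentiableAt_eval f x).hasFDerivAt.const_mul c).clog hf).sub_const (Complex.log c)
  have hc : c ≠ 0 := left_ne_zero_of_mul (Complex.slitPlane_ne_zero hf)
  rw [hlog.fderiv, smul_apply, smul_apply, fderiv_eval, smul_eq_mul, smul_eq_mul,
    inv_mul_eq_div, mul_div_mul_left _ _ hc]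

/-- A logarithm of the Darboux function `exp (g / h) * ∏ f ^ e(f)`, where the branch of `log f` is
given by the rotation `c f`. -/
noncomputable def darbouxExponent (g h : MvPolynomial ι ℂ) (e : MvPolynomial ι ℂ →₀ ℂ)
    (c : MvPolynomial ι ℂ → ℂ) (x : ι → ℂ) : ℂ :=
  eval x g * (eval x h)⁻¹ + ∑ f ∈ e.support, e f * rotatedLog (c f) f x

/-- The set on which `darbouxExponent g h e c` is smooth. -/
def darbouxDomain (h : MvPolynomial ι ℂ) (e : MvPolynomial ι ℂ →₀ ℂ) (c : MvPolynomial ι ℂ → ℂ) :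
    Set (ι → ℂ) :=
  {x | eval x h ≠ 0} ∩ ⋂ f ∈ e.support, {x | c f * eval x f ∈ Complex.slitPlane}

theorem mem_darbouxDomain {x : ι → ℂ} : x ∈ darbouxDomain h e c ↔
    eval x h ≠ 0 ∧ ∀ f ∈ e.support, c f * eval x f ∈ Complex.slitPlane := by
  simp only [darbouxDomain, Set.mem_inter_iff, Set.mem_ofPred_eq, Set.mem_iInter]

theorem isOpen_darbouxDomain : IsOpen (darbouxDomain h e c) :=
  (isOpen_ne.preimage (MvPolynomial.continuous_eval h)).inter
    (isOpen_biInter_finset fun f _ => Complex.isOpen_slitPlane.preimage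
      (continuous_const.mul (MvPolynomial.continuous_eval f)))

theorem contDiffAt_darbouxExponent [Fintype ι] {x : ι → ℂ} (hx : x ∈ darbouxDomain h e c)
    {m : WithTop ℕ∞} : ContDiffAt ℂ m (darbouxExponent g h e c) x := by
  obtain ⟨hh, hf⟩ := mem_darbouxDomain.1 hx
  exact ((contDiff_eval g).contDiffAt.mul ((contDiff_eval h).contDiffAt.inv hh)).add
    (ContDiffAt.sum fun f hfe => contDiffAt_const.mul (contDiffAt_rotatedLog (hf f hfe)))

theorem fderiv_darbouxExponent [Finite ι] [DecidableEq ι] {x : ι → ℂ}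
    (hx : x ∈ darbouxDomain h e c) (i : ι) :
    fderiv ℂ (darbouxExponent g h e c) x (Pi.single i 1) = darbouxGradient (eval x) g h e i := by
  cases nonempty_fintype ι
  obtain ⟨hh, hf⟩ := mem_darbouxDomain.1 hx
  have hquot := (differentiableAt_eval g x).hasFDerivAt.mul
    ((hasDerivAt_inv hh).comp_hasFDerivAt x (differentiableAt_eval h x).hasFDerivAt)
  have hlog (f) (hfe : f ∈ e.support) : DifferentiableAt ℂ (rotatedLog (c f) f) x :=
    (contDiffAt_rotatedLog (hf f hfe) (m := 1)).differentiableAt one_ne_zero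
  have hsum := HasFDerivAt.fun_sum fun f hfe => (hlog f hfe).hasFDerivAt.const_mul (e f)
  have hexp : HasFDerivAt (darbouxExponent g h e c) _ x :=
    hquot.fun_add hsum
  rw [hexp.fderiv, add_apply, sum_apply, darbouxGradient, dlogSum, Finsupp.sum]
  congr 1
  · simp only [add_apply, smul_apply, fderiv_eval, smul_eq_mul, Function.comp_apply]
    field_simp
    ring
  · exact Finset.sum_congr rfl fun f hfe => by
      rw [smul_apply, fderiv_rotatedLog (hf f hfe), smul_eq_mul, eval_C]

theorem sum_fderiv_exp_mul_eval [Fintype ι] [DecidableEq ι] {P : ι → MvPolynomial ι ℂ} {x : ι → ℂ}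
    (hx : x ∈ darbouxDomain h e c) (H : IsDarbouxMultiplier (eval x) P g h e) :
    ∑ i, fderiv ℂ (fun y => Complex.exp (darbouxExponent g h e c y) * eval y (P i)) x
      (Pi.single i 1) = 0 := by
  have hexp := ((contDiffAt_darbouxExponent (g := g) hx (m := 1)).differentiableAt
    one_ne_zero).hasFDerivAt.cexp
  have hi (i : ι) : fderiv ℂ (fun y => Complex.exp (darbouxExponent g h e c y) * eval y (P i)) x
      (Pi.single i 1) = Complex.exp (darbouxExponent g h e c x) *
        (eval x (P i) * darbouxGradient (eval x) g h e i + eval x (pderiv i (P i))) := by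
    rw [(hexp.fun_mul (differentiableAt_eval (P i) x).hasFDerivAt).fderiv]
    simp only [add_apply, smul_apply, smul_eq_mul, fderiv_eval, fderiv_darbouxExponent hx]
    ring
  rw [Finset.sum_congr rfl fun i _ => hi i, ← Finset.mul_sum, Finset.sum_add_distrib, H,
    neg_add_cancel, mul_zero]

end DarbouxFunction

section JacobianMultiplier

open MeasureTheory MvPolynomial

variable {n : ℕ} {g h : MvPolynomial (Fin n) ℂ} {e : MvPolynomial (Fin n) ℂ →₀ ℂ}
  {c : MvPolynomial (Fin n) ℂ → ℂ}

theorem volume_compl_darbouxDomain (hh : h ≠ 0)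
    (hc : ∀ f ∈ e.support, volume {x | c f * eval x f ∉ Complex.slitPlane} = 0) :
    volume (darbouxDomain h e c)ᶜ = 0 := by
  refine measure_mono_null (fun x hx => ?_) (measure_union_null (volume_setOf_eval_eq_zero hh)
    ((measure_biUnion_null_iff e.support.countable_toSet).2 hc))
  by_contra! hx'
  refine hx (mem_darbouxDomain.2 ?_)
  simpa using hx'

theorem isDarbouxFunctionOn_exp_darbouxExponent (hh : h ≠ 0) (hgh : IsRelPrime g h)
    (he : ∀ f ∈ e.support, IsPrimeRepresentative f) (hc : ∀ f ∈ e.support, c f ≠ 0) :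
    IsDarbouxFunctionOn (fun x => Complex.exp (darbouxExponent g h e c x))
      (darbouxDomain h e c) := by
  let E := e.support.equivFin
  let f (j : Fin e.support.card) : MvPolynomial (Fin n) ℂ := E.symm j
  have hf (j) : f j ∈ e.support := (E.symm j).2
  refine ⟨_, g, h, f, fun j => e (f j), fun j => rotatedLog (c (f j)) (f j), hh, hgh,
    fun j => (he _ (hf j)).1, fun i j hij hass => hij ?_, fun x hx => (mem_darbouxDomain.1 hx).1,
    fun j => ⟨fun x hx => ?_, fun x hx => ?_⟩, fun x _ => ?_⟩
  · exact E.symm.injective (Subtype.ext ((he _ (hf i)).eq_of_associated (he _ (hf j)) hass))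
  · exact (contDiffAt_rotatedLog ((mem_darbouxDomain.1 hx).2 _ (hf j))
      (m := 0)).continuousAt.continuousWithinAt
  · exact exp_rotatedLog (hc _ (hf j)) ((mem_darbouxDomain.1 hx).2 _ (hf j))
  · simp only [darbouxExponent]
    rw [Complex.exp_add, ← Finset.sum_coe_sort, ← E.symm.sum_comp, Complex.exp_sum,
      ← div_eq_mul_inv]

theorem isJacobianMultiplierOn_exp_darbouxExponent {P : Fin n → MvPolynomial (Fin n) ℂ}
    (H : ∀ x ∈ darbouxDomain h e c, IsDarbouxMultiplier (eval x) P g h e) :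
    IsJacobianMultiplierOn P (fun x => Complex.exp (darbouxExponent g h e c x))
      (darbouxDomain h e c) :=
  ⟨fun _ hx => (contDiffAt_darbouxExponent hx).cexp.contDiffWithinAt,
    fun x hx => sum_fderiv_exp_mul_eval hx (H x hx)⟩

theorem hasDarbouxJacobianMultiplier_of_isDarbouxMultiplier {P : Fin n → MvPolynomial (Fin n) ℂ}
    (hh : h ≠ 0) (hgh : IsRelPrime g h) (he : ∀ f ∈ e.support, IsPrimeRepresentative f)
    (H : ∀ x, eval x h ≠ 0 → (∀ f ∈ e.support, eval x f ≠ 0) →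
      IsDarbouxMultiplier (eval x) P g h e) :
    HasDarbouxJacobianMultiplier P := by
  have hrot (f : MvPolynomial (Fin n) ℂ) (hf : f ∈ e.support) : ∃ c : ℂ, c ≠ 0 ∧
      volume {x | c * eval x f ∉ Complex.slitPlane} = 0 :=
    exists_mul_mem_slitPlane volume (MvPolynomial.continuous_eval f).measurable
      (volume_setOf_eval_eq_zero (he f hf).1.ne_zero)
  choose! c hc₀ hc using hrot
  refine ⟨darbouxDomain h e c, _, isOpen_darbouxDomain, volume_compl_darbouxDomain hh hc,
    isDarbouxFunctionOn_exp_darbouxExponent hh hgh he hc₀,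
    isJacobianMultiplierOn_exp_darbouxExponent fun x hx => ?_⟩
  obtain ⟨hhx, hfx⟩ := mem_darbouxDomain.1 hx
  exact H x hhx fun f hf => right_ne_zero_of_mul (Complex.slitPlane_ne_zero (hfx f hf))

end JacobianMultiplier

end LiouvilleDarboux

/-- A Liouvillian integrable polynomial differential system on `ℂⁿ` has a Darboux Jacobian
multiplier. -/
theorem theorem2 {n : ℕ} (P : Fin n → MvPolynomial (Fin n) ℂ)
    (hP : LiouvilleDarboux.IsLiouvillianIntegrable.{u} P) :
    LiouvilleDarboux.HasDarbouxJacobianMultiplier P := by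
  by_cases hP₀ : P = 0
  · subst hP₀
    refine LiouvilleDarboux.hasDarbouxJacobianMultiplier_of_isDarbouxMultiplier
      (g := 0) (h := 1) (e := 0) one_ne_zero isRelPrime_one_right (by simp) fun x _ _ => ?_
    simp [LiouvilleDarboux.IsDarbouxMultiplier]
  · obtain ⟨k, hk⟩ := Function.ne_iff.1 hP₀
    obtain ⟨g, h, e, hh, hgh, he, hJ⟩ := hP.exists_isDarbouxMultiplier hk
    exact LiouvilleDarboux.hasDarbouxJacobianMultiplier_of_isDarbouxMultiplier hh hgh he hJ
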